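/- Lemma 2.2 (Stronger Lemma 1.3 in [jhk-etal2021]). Given a finite graph $G=(V,E)$ and a coloring $\ell_0: V\to\{1,-1\}$ ($1$ = Red, $-1$ = Blue), majority dynamics starts from $\ell_0$ on day 0; on each following day every vertex adopts the color held by the majority of its neighbors on the previous day, and keeps its color in case of a tie. Let $\ell_1$ be the resulting coloring on day 1. For $D>0$, a vertex $v$ is called $D$-almost Red if $\sum_{u\in N(v)}\ell_1(u)\ge -D$. There are universal constants $C_1, C_2, A>0$ such that for every $B>0$ there is a constant $c_B>0$, depending only on $B$, for which the following holds. Let $n$ be a natural number, $p\in[0,1]$ and $D>0$ a real number with $$p\le n^{-1/2}\log^{1/4}n,\qquad pn\ge C_1\log^2 n,\qquad C_2\log n\le D\le B\sqrt{pn},$$ and let $\ell_0$ be any fixed coloring of the $n$ vertices with exactly $\lceil n/2\rceil$ Red vertices. Consider majority dynamics with initial coloring $\ell_0$ on a random graph $G\sim G(n,p)$, in which each pair of vertices is joined independently with probability $p$. Then $$\Pr\left(\#\{v : v \text{ is } D\text{-almost Red}\}\ \ge\ \frac n2+c_B D\sqrt{\frac np}\right)\ \ge\ 1-A\,\frac{\log^2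 n}{c_B^2D^2}.$$ -/

import Mathlib

namespace MajorityDynamics

/-- A Red/Blue coloring of `V`, written as a `±1` labeling: `1` is Red and `-1` is Blue. -/
abbrev Coloring (V : Type*) : Type _ := V → ℤˣ

/-- The Red side `R(ℓ) = ℓ⁻¹(1)` of a coloring. -/
def red {V : Type*} (ℓ : Coloring V) : Set V := {v | ℓ v = 1}

open Classical in
/-- The sum `∑_{u ∈ N(v)} ℓ(u)` of the colors of the neighbors of `v`, that is, the number of Red
neighbors minus the number of Blue neighbors. -/
noncomputable def neighborSum {V : Type*} [Fintype V] (G : SimpleGraph V) (ℓ : Coloring V)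
    (v : V) : ℤ :=
  ∑ u ∈ G.neighborFinset v, (ℓ u : ℤ)

/-- One day of majority dynamics: every vertex adopts the color held by the majority of its
neighbors, and keeps its own color in case of a tie. -/
noncomputable def nextDay {V : Type*} [Fintype V] (G : SimpleGraph V) (ℓ : Coloring V) :
    Coloring V := fun v =>
  if 0 < neighborSum G ℓ v then 1
  else if neighborSum G ℓ v < 0 then -1
  else ℓ v

/-- The coloring `ℓ_t` on day `t` of majority dynamics on `G` with day `0` coloring `ℓ₀`. -/
noncomputable def day {V : Type*} [Fintype V] (G : SimpleGraph V) (ℓ₀ : Coloring V) (t : ℕ) :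
    Coloring V :=
  (nextDay G)^[t] ℓ₀

/-- A vertex `v` is `D`-almost Red if `∑_{u ∈ N(v)} ℓ₁(u) ≥ -D`, where `ℓ₁` is the coloring on
day `1`. -/
def IsAlmostRed {V : Type*} [Fintype V] (G : SimpleGraph V) (ℓ₀ : Coloring V) (D : ℝ)
    (v : V) : Prop :=
  -D ≤ (neighborSum G (day G ℓ₀ 1) v : ℝ)

/-- The number of `D`-almost Red vertices of `G`. -/
noncomputable def numAlmostRed {V : Type*} [Fintype V] (G : SimpleGraph V) (ℓ₀ : Coloring V)
    (D : ℝ) : ℕ :=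
  {v | IsAlmostRed G ℓ₀ D v}.ncard

end MajorityDynamics

/-!
Fix the initial coloring `ℓ`, let `S_v` be the sum of the day `1` colors of the neighbours of `v`, and
put `s = √(p n)`, `L = log n`. The number of `D`-almost Red vertices is `X = ∑_v 1{S_v ≥ -D}`, and the
bound is Chebyshev's inequality for `X`.

*Expectation.* Exchanging the colors and relabelling the vertices turns `ℓ` into a coloring below `ℓ`,
since Red is not in the minority. As majority dynamics is odd and monotone in the coloring and the law
of the graph is invariant under relabelling, `∑_v P(S_v < -D) ≤ ∑_v P(S_v > D)`
(`sum_avg_lt_neg_le`). Hence `E X ≥ n / 2 + (1 / 2) ∑_v P(|S_v| ≤ D)`, and it remains to see that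
`P(|S_v| ≤ D)` is of order `D / s` (`exists_nextSum_small_ball`).

*Fresh vertices.* Both this estimate and the variance bound reveal the neighbourhoods involved and then
choose a set `O` of further vertices, with equally many Red and Blue vertices, that contains all but
`O(s²)` vertices (`exists_balanced`). Given all edges except those between a set `A` and `O`, the day
`1` colors on `A` are independent (`avg_cut`). Each is Red with a probability between `1 / 4` and
`3 / 4`, which is Lipschitz in the color sum outside `O` with constant `O(1 / s)`, because a signed sum
of independent bits with variance `σ²` has no atoms larger than `1 / σ` (`avg_signed_sum_eq_le`, by
Fourier inversion). The same atom bound makes the tails of a sum of these colors Lipschitz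
(`abs_tail_redProb_sub_le`).

*Small ball.* A sign with bias at most `1 / 2` is a fair sign with probability `1 / 2`. Conditioning on
which signs are fair reduces the lower bound on `P(|S_v| ≤ D)` to the local behaviour of central
binomial coefficients, provided that `E S_v² = O(s²)` (`exists_small_ball`). The second moment is
bounded because the day `1` colors of two vertices have correlation `O(1 / s²)`.

*Variance.* For `v ≠ w` the covariance of `1{S_v ≥ τ}` and `1{S_w ≥ τ}` is `O(L / s²)`
(`covar_sumGe_le`), by the law of total covariance with respect to the edges at `v` or `w`. The
conditional probability of the event at `v` hardly depends on the edges at `w`, the error being governed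
by the number of common neighbours. Given the neighbourhoods `A` and `B`, resampling the edges from
`A \ B` and from `B \ A` to `O` makes the two events independent; the conditional probabilities that
remain have variance `O(p)`, up to common neighbours, by the Efron–Stein inequality
(`covar_tail_self_le`). Common neighbours are few because `p² n ≤ √L`.

All probabilities are finite sums: a random graph is a family of independent bits indexed by `Sym2 V`,
and `avg q S f x` resamples the bits of `x` in `S`. The measure `SimpleGraph.binomialRandom` enters only
through `binomialRandom_real_eq_avg`.
-/

namespace MajorityDynamics

open Finset

set_option linter.unusedSectionVars false

/-! ### Resampling independent bits -/

section Averaging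

variable {ι : Type*} [Fintype ι] [DecidableEq ι] {q q' : ι → ℝ} {S T : Finset ι}
  {f g : (ι → Bool) → ℝ} {x : ι → Bool}

/-- The probability of the configuration `y` when the bits are independent and bit `i` is `true`
with probability `q i`. -/
def wt (q : ι → ℝ) (y : ι → Bool) : ℝ := ∏ i, if y i then q i else 1 - q i

/-- The conditional expectation of `f` given the bits outside `S`: the bits in `S` are resampled
independently, bit `i` being `true` with probability `q i`, and all other bits of `x` are kept. -/
def avg (q : ι → ℝ) (S : Finset ι) (f : (ι → Bool) → ℝ) (x : ι → Bool) : ℝ :=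
  ∑ y, wt q y * f (S.piecewise y x)

/-- `f` does not depend on the bits in `S`. -/
def Ignores {β : Type*} (f : (ι → Bool) → β) (S : Finset ι) : Prop :=
  ∀ x y, (∀ i, i ∉ S → x i = y i) → f x = f y

/-- All the numbers `q i` are probabilities. -/
def IsProb (q : ι → ℝ) : Prop := ∀ i, 0 ≤ q i ∧ q i ≤ 1

lemma wt_nonneg (hq : IsProb q) (y : ι → Bool) : 0 ≤ wt q y := by
  refine prod_nonneg fun i _ => ?_
  have := hq i
  split_ifs <;> linarith

lemma sum_wt_mul_prod (q : ι → ℝ) (h : ι → Bool → ℝ) :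
    ∑ y, wt q y * ∏ i, h i (y i) = ∏ i, (q i * h i true + (1 - q i) * h i false) := by
  have := Finset.prod_univ_sum (fun _ : ι => (univ : Finset Bool))
    (fun i b => (if b then q i else 1 - q i) * h i b)
  simp only [Fintype.piFinset_univ, prod_mul_distrib] at this
  simpa [wt] using this.symm

lemma sum_wt (q : ι → ℝ) : ∑ y, wt q y = 1 := by
  simpa using sum_wt_mul_prod q (fun _ _ => 1)

lemma sum_wt_mul_apply (q : ι → ℝ) (i : ι) (h : Bool → ℝ) :
    ∑ y, wt q y * h (y i) = q i * h true + (1 - q i) * h false := by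
  have := sum_wt_mul_prod q (fun j b => if j = i then h b else 1)
  simp only [prod_ite_eq', mem_univ, if_true] at this
  rw [this, Finset.prod_eq_single i]
  · simp
  · intro j _ hj; simp [hj]
  · simp

/-- Resampling a configuration on `T` by an independent one leaves its law unchanged. -/
lemma sum_wt_piecewise (q : ι → ℝ) (T : Finset ι) (h : (ι → Bool) → ℝ) :
    ∑ y, ∑ z, wt q y * wt q z * h (T.piecewise z y) = ∑ y, wt q y * h y := by
  -- Exchanging the bits of `y` and `z` on `T` is an involution that preserves the weight.
  have hswap : ∀ y z : ι → Bool,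
      wt q (T.piecewise z y) * wt q (T.piecewise y z) = wt q y * wt q z := by
    intro y z
    simp only [wt, ← prod_mul_distrib]
    refine prod_congr rfl fun i _ => ?_
    by_cases hi : i ∈ T <;> simp [hi, mul_comm]
  have hinv : ∀ y z : ι → Bool, T.piecewise (T.piecewise y z) (T.piecewise z y) = y := by
    intro y z; ext i; by_cases hi : i ∈ T <;> simp [hi]
  have h1 : ∑ a : (ι → Bool) × (ι → Bool), wt q a.1 * wt q a.2 * h (T.piecewise a.2 a.1)
      = ∑ a : (ι → Bool) × (ι → Bool), wt q a.1 * wt q a.2 * h a.1 := by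
    refine Finset.sum_nbij' (fun a => (T.piecewise a.2 a.1, T.piecewise a.1 a.2))
      (fun a => (T.piecewise a.2 a.1, T.piecewise a.1 a.2)) ?_ ?_ ?_ ?_ ?_
    · simp
    · simp
    · intro a _; simp [hinv]
    · intro a _; simp [hinv]
    · intro a _; simp only [hswap]
  rw [Fintype.sum_prod_type, Fintype.sum_prod_type] at h1
  rw [h1]
  refine sum_congr rfl fun y _ => ?_
  simp only []
  rw [← sum_mul, ← mul_sum, sum_wt, mul_one]

@[simp] lemma avg_empty : avg q ∅ f x = f x := by
  simp [avg, ← sum_mul, sum_wt]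

lemma avg_avg (q : ι → ℝ) (S T : Finset ι) (f : (ι → Bool) → ℝ) (x : ι → Bool) :
    avg q S (avg q T f) x = avg q (S ∪ T) f x := by
  have h := sum_wt_piecewise q T (fun y => f ((S ∪ T).piecewise y x))
  rw [avg, avg, ← h]
  refine sum_congr rfl fun y _ => ?_
  rw [avg, mul_sum]
  refine sum_congr rfl fun z _ => ?_
  rw [mul_assoc]
  congr 3
  ext i
  by_cases h1 : i ∈ S <;> by_cases h2 : i ∈ T <;> simp [h1, h2]

lemma avg_avg_of_subset (h : T ⊆ S) : avg q S (avg q T f) x = avg q S f x := by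
  rw [avg_avg, union_eq_left.2 h]

lemma avg_singleton (i : ι) :
    avg q {i} f x = q i * f (Function.update x i true) + (1 - q i) * f (Function.update x i false)
    := by
  rw [avg, ← sum_wt_mul_apply q i (fun b => f (Function.update x i b))]
  refine sum_congr rfl fun y _ => ?_
  rw [Finset.piecewise_singleton]

lemma avg_insert (i : ι) :
    avg q (insert i S) f x = q i * avg q S f (Function.update x i true)
      + (1 - q i) * avg q S f (Function.update x i false) := by
  rw [insert_eq, ← avg_avg, avg_singleton]

lemma avg_congr (h : ∀ y, (∀ i, i ∉ S → y i = x i) → f y = g y) : avg q S f x = avg q S g x := by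
  refine sum_congr rfl fun y _ => ?_
  rw [h]
  intro i hi; simp [hi]

lemma avg_mono (hq : IsProb q) (h : ∀ y, (∀ i, i ∉ S → y i = x i) → f y ≤ g y) :
    avg q S f x ≤ avg q S g x := by
  refine sum_le_sum fun y _ => mul_le_mul_of_nonneg_left (h _ ?_) (wt_nonneg hq y)
  intro i hi; simp [hi]

@[simp] lemma avg_const (c : ℝ) : avg q S (fun _ => c) x = c := by
  simp [avg, ← sum_mul, sum_wt]

lemma avg_add : avg q S (fun y => f y + g y) x = avg q S f x + avg q S g x := by
  simp [avg, mul_add, sum_add_distrib]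

lemma avg_sub : avg q S (fun y => f y - g y) x = avg q S f x - avg q S g x := by
  simp [avg, mul_sub, sum_sub_distrib]

lemma avg_const_mul (c : ℝ) : avg q S (fun y => c * f y) x = c * avg q S f x := by
  simp [avg, mul_sum, mul_left_comm]

lemma avg_sum {κ : Type*} (s : Finset κ) (F : κ → (ι → Bool) → ℝ) :
    avg q S (fun y => ∑ k ∈ s, F k y) x = ∑ k ∈ s, avg q S (F k) x := by
  simp only [avg, mul_sum]
  exact sum_comm

lemma avg_le_const (hq : IsProb q) {c : ℝ} (h : ∀ y, f y ≤ c) : avg q S f x ≤ c := by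
  calc avg q S f x ≤ avg q S (fun _ => c) x := avg_mono hq fun y _ => h y
    _ = c := avg_const c

lemma const_le_avg (hq : IsProb q) {c : ℝ} (h : ∀ y, c ≤ f y) : c ≤ avg q S f x := by
  calc c = avg q S (fun _ => c) x := (avg_const c).symm
    _ ≤ _ := avg_mono hq fun y _ => h y

lemma abs_avg_le (hq : IsProb q) : |avg q S f x| ≤ avg q S (fun y => |f y|) x := by
  refine (abs_sum_le_sum_abs _ _).trans (sum_le_sum fun y _ => ?_)
  rw [abs_mul, abs_of_nonneg (wt_nonneg hq y)]

/-- Averaging over `S` removes the dependence on `S`. -/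
lemma ignores_avg (q : ι → ℝ) (S : Finset ι) (f : (ι → Bool) → ℝ) : Ignores (avg q S f) S := by
  intro x y hxy
  refine sum_congr rfl fun z _ => ?_
  congr 2
  ext i
  by_cases hi : i ∈ S <;> simp [hi, hxy]

lemma Ignores.avg (hf : Ignores f T) : Ignores (avg q S f) T := by
  intro x y hxy
  refine sum_congr rfl fun z _ => ?_
  congr 1
  refine hf _ _ fun i hi => ?_
  by_cases hiS : i ∈ S <;> simp [hiS, hxy i hi]

lemma avg_mul_of_ignores (hf : Ignores f S) :
    avg q S (fun y => f y * g y) x = f x * avg q S g x := by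
  rw [avg, avg, mul_sum]
  refine sum_congr rfl fun y _ => ?_
  rw [hf (S.piecewise y x) x (by intro i hi; simp [hi])]
  ring

lemma avg_of_ignores (hf : Ignores f S) : avg q S f x = f x := by
  simpa using avg_mul_of_ignores (q := q) (g := fun _ => 1) (x := x) hf

lemma avg_union_of_ignores (hf : Ignores f S) : avg q (S ∪ T) f x = avg q T f x := by
  rw [← avg_avg, avg_of_ignores hf.avg]

lemma avg_of_subset_of_ignores (hT : T ⊆ S) (hf : Ignores f (S \ T)) :
    avg q S f x = avg q T f x := by
  rw [← sdiff_union_of_subset hT, avg_union_of_ignores hf]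

/-- Functions of disjoint sets of bits are independent. -/
lemma avg_mul_of_ignores_of_ignores (hf : Ignores f T) (hg : Ignores g S) :
    avg q (S ∪ T) (fun y => f y * g y) x = avg q (S ∪ T) f x * avg q (S ∪ T) g x := by
  rw [avg_union_of_ignores hg, union_comm, avg_union_of_ignores hf, union_comm, ← avg_avg]
  have : MajorityDynamics.avg q T (fun y => f y * g y)
      = fun y => f y * MajorityDynamics.avg q T g y := by
    ext y; exact avg_mul_of_ignores hf
  rw [this]
  simp only [mul_comm (f _)]
  rw [avg_mul_of_ignores hg.avg, mul_comm]

lemma avg_congr_prob (h : ∀ i ∈ S, q i = q' i) : avg q S f x = avg q' S f x := by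
  induction S using Finset.induction_on generalizing x with
  | empty => simp
  | insert i S hi ih =>
    have ih' := fun x => ih (x := x) fun j hj => h j (mem_insert_of_mem hj)
    rw [avg_insert, avg_insert, ih', ih', h i (mem_insert_self _ _)]

lemma avg_indicator_nonneg (hq : IsProb q) (P : (ι → Bool) → Prop) [DecidablePred P] :
    0 ≤ avg q S (fun y => if P y then 1 else 0) x :=
  const_le_avg hq fun y => by split_ifs <;> norm_num

/-- The expectation of a product over distinct bits is the product of the expectations. -/
lemma avg_prod (h : ι → Bool → ℝ) (hT : T ⊆ S) :
    avg q S (fun y => ∏ i ∈ T, h i (y i)) x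
      = ∏ i ∈ T, (q i * h i true + (1 - q i) * h i false) := by
  rw [avg]
  have : ∀ y : ι → Bool, ∏ i ∈ T, h i (S.piecewise y x i)
      = ∏ i, (fun j b => if j ∈ T then h j b else 1) i (y i) := by
    intro y
    simp only [prod_ite_mem, univ_inter]
    refine prod_congr rfl fun i hi => ?_
    rw [Finset.piecewise_eq_of_mem _ _ _ (hT hi)]
  rw [sum_congr rfl fun y _ => by rw [this y],
    sum_wt_mul_prod q (fun j b => if j ∈ T then h j b else 1), ← Finset.prod_subset (subset_univ T)]
  · exact prod_congr rfl fun i hi => by simp [hi]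
  · intro i _ hi; simp [hi]

lemma avg_bit {i : ι} (hi : i ∈ S) :
    avg q S (fun y => if y i then 1 else 0) x = q i := by
  simpa using avg_prod (q := q) (x := x) (S := S) (T := {i}) (fun _ b => if b then 1 else 0)
    (by simpa using hi)

/-- Relabelling the bits along a map that is injective on the set `T` of relevant bits. -/
lemma avg_image {κ : Type*} [Fintype κ] [DecidableEq κ] {φ : ι → κ} (hφ : Set.InjOn φ T)
    (Q : κ → ℝ) (hf : Ignores f Tᶜ) (hS : S ⊆ T) (x : κ → Bool) (x' : ι → Bool)
    (hx : ∀ i ∈ T, x' i = x (φ i)) :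
    avg Q (S.image φ) (fun y => f (fun i => y (φ i))) x = avg (fun i => Q (φ i)) S f x' := by
  induction S using Finset.induction_on generalizing x x' with
  | empty =>
    simp only [image_empty, avg_empty]
    exact hf _ _ fun i hi => (hx i (by simpa using hi)).symm
  | insert a S ha ih =>
    have haT : a ∈ T := hS (mem_insert_self _ _)
    have key : ∀ b, avg Q (S.image φ) (fun y => f (fun i => y (φ i))) (Function.update x (φ a) b)
        = avg (fun i => Q (φ i)) S f (Function.update x' a b) := by
      intro b
      refine ih ((subset_insert _ _).trans hS) _ _ fun i hi => ?_
      by_cases hia : i = a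
      · subst hia; simp
      · have : φ i ≠ φ a := fun h => hia (hφ hi haT h)
        simp [hia, this, hx i hi]
    rw [image_insert, avg_insert, avg_insert, key, key]

/-- If the events `e u`, `u ∈ A`, are determined by pairwise disjoint blocks of bits, then they are
independent: a function of their outcomes is averaged as if each outcome were a single bit. -/
lemma avg_blocks {V : Type*} [Fintype V] [DecidableEq V] (Qb : V → Finset ι)
    (e : V → (ι → Bool) → Bool) (A : Finset V)
    (he : ∀ u ∈ A, ∀ u' ∈ A, u ≠ u' → Ignores (e u) (Qb u')) (H : (V → Bool) → ℝ)
    (b : V → Bool) (x : ι → Bool) :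
    avg q (A.biUnion Qb) (fun y => H (fun u => if u ∈ A then e u y else b u)) x
      = avg (fun u => avg q (Qb u) (fun y => if e u y then 1 else 0) x) A H b := by
  induction A using Finset.induction_on generalizing x b with
  | empty => simp
  | insert a A ha ih =>
    set r : (ι → Bool) → V → ℝ := fun y u => avg q (Qb u) (fun y => if e u y then 1 else 0) y
      with hr
    have ih' := ih fun u hu u' hu' => he u (mem_insert_of_mem hu) u' (mem_insert_of_mem hu')
    have hign : Ignores (e a) (A.biUnion Qb) := by
      intro y z hyz
      -- Change the blocks one at a time.
      suffices h : ∀ B ⊆ A, e a y = e a ((B.biUnion Qb).piecewise z y) by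
        rw [h A Subset.rfl]
        congr 1
        ext i
        by_cases hi : i ∈ A.biUnion Qb
        · rw [Finset.piecewise_eq_of_mem _ _ _ hi]
        · rw [Finset.piecewise_eq_of_notMem _ _ _ hi, hyz i hi]
      intro B
      induction B using Finset.induction_on with
      | empty =>
        intro _
        congr 1
      | insert c B hc ihB =>
        intro hB
        rw [ihB ((subset_insert _ _).trans hB)]
        have hcA : c ∈ A := hB (mem_insert_self _ _)
        refine he a (mem_insert_self _ _) c (mem_insert_of_mem hcA)
          (fun h => ha (h ▸ hcA)) _ _ fun i hi => ?_
        by_cases hiB : i ∈ B.biUnion Qb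
        · rw [Finset.piecewise_eq_of_mem _ _ _ hiB, Finset.piecewise_eq_of_mem]
          rw [biUnion_insert]; exact mem_union_right _ hiB
        · rw [Finset.piecewise_eq_of_notMem _ _ _ hiB, Finset.piecewise_eq_of_notMem]
          rw [biUnion_insert]; simp only [mem_union, not_or]; exact ⟨hi, hiB⟩
    have step : ∀ y, (∀ i, i ∉ Qb a → y i = x i) →
        avg q (A.biUnion Qb) (fun z => H (fun u => if u ∈ insert a A then e u z else b u)) y
          = avg (r x) A H (Function.update b a (e a y)) := by
      intro y hy
      have h1 := ih' (Function.update b a (e a y)) y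
      have h2 : avg (r y) A H (Function.update b a (e a y))
          = avg (r x) A H (Function.update b a (e a y)) := by
        refine avg_congr_prob fun u hu => ?_
        refine Ignores.avg (T := Qb a) ?_ _ _ hy
        intro y z hyz
        have h := he u (mem_insert_of_mem hu) a (mem_insert_self _ _) (fun h => ha (h ▸ hu)) y z hyz
        simp only [h]
      rw [← h2, ← h1]
      refine avg_congr fun z hz => ?_
      congr 1
      ext u
      by_cases hua : u = a
      · subst hua
        simp [ha, hign z y hz]
      · simp [hua]
    rw [biUnion_insert, ← avg_avg, avg_congr step, avg_insert]
    have h3 : ∀ c : Bool, avg (r x) A H (Function.update b a c)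
        = (if c then 1 else 0) * avg (r x) A H (Function.update b a true)
          + (1 - if c then 1 else 0) * avg (r x) A H (Function.update b a false) := by
      intro c; cases c <;> simp
    have h4 : ∀ c d : ℝ, avg q (Qb a) (fun y => (if e a y then 1 else 0) * c
        + (1 - if e a y then 1 else 0) * d) x = r x a * c + (1 - r x a) * d := by
      intro c d
      have : (fun y => (if e a y then (1 : ℝ) else 0) * c + (1 - if e a y then 1 else 0) * d)
          = fun y => (c - d) * (if e a y then 1 else 0) + d := by ext y; ring
      rw [this, avg_add, avg_const_mul, avg_const]
      simp only [hr]; ring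
    rw [avg_congr fun y _ => h3 (e a y), h4]

/-- The average as a sum over the set of `true` bits. -/
lemma avg_eq_sum_powerset :
    avg q S f x = ∑ T ∈ S.powerset, (∏ i ∈ T, q i) * (∏ i ∈ S \ T, (1 - q i)) *
      f (S.piecewise (fun i => decide (i ∈ T)) x) := by
  induction S using Finset.induction_on generalizing x with
  | empty => simp
  | insert a S ha ih =>
    rw [avg_insert, sum_powerset_insert ha, ih, ih, mul_sum, mul_sum, add_comm]
    congr 1
    · refine sum_congr rfl fun T hT => ?_
      have haT : a ∉ T := fun h => ha (mem_powerset.1 hT h)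
      rw [insert_sdiff_of_notMem _ haT, prod_insert (by simp [ha])]
      have : S.piecewise (fun i => decide (i ∈ T)) (Function.update x a false)
          = (insert a S).piecewise (fun i => decide (i ∈ T)) x := by
        ext i
        by_cases hi : i = a
        · subst hi; simp [ha, haT]
        · by_cases hiS : i ∈ S <;> simp [hi, hiS]
      rw [this]; ring
    · refine sum_congr rfl fun T hT => ?_
      have haT : a ∉ T := fun h => ha (mem_powerset.1 hT h)
      rw [prod_insert haT]
      have h1 : insert a S \ insert a T = S \ T := by
        ext i; simp only [mem_sdiff, mem_insert, not_or]
        constructor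
        · rintro ⟨h | h, h2, h3⟩
          · exact absurd h h2
          · exact ⟨h, h3⟩
        · rintro ⟨h, h2⟩
          exact ⟨Or.inr h, fun h' => ha (h' ▸ h), h2⟩
      have : S.piecewise (fun i => decide (i ∈ T)) (Function.update x a true)
          = (insert a S).piecewise (fun i => decide (i ∈ insert a T)) x := by
        ext i
        by_cases hi : i = a
        · subst hi; simp [ha]
        · by_cases hiS : i ∈ S <;> simp [hi, hiS]
      rw [this, h1]; ring

/-- The law of the number of `true` bits in `T` has an exponential tail. -/
lemma avg_card_ge_le (hq : IsProb q) {p : ℝ} (hT : T ⊆ S) (hp : ∀ i ∈ T, q i ≤ p) (t : ℝ) :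
    avg q S (fun y => if t ≤ ∑ i ∈ T, (if y i then (1 : ℝ) else 0) then 1 else 0) x
      ≤ Real.exp (2 * p * #T - t) := by
  have h1 : avg q S (fun y => if t ≤ ∑ i ∈ T, (if y i then (1 : ℝ) else 0) then 1 else 0) x
      ≤ avg q S (fun y => Real.exp (-t) * ∏ i ∈ T, (fun _ b => if b then Real.exp 1 else 1) i (y i))
        x := by
    refine avg_mono hq fun y _ => ?_
    have h2 : ∏ i ∈ T, (fun (_ : ι) b => if b then Real.exp 1 else 1) i (y i)
        = Real.exp (∑ i ∈ T, if y i then (1 : ℝ) else 0) := by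
      rw [Real.exp_sum]
      refine prod_congr rfl fun i _ => ?_
      by_cases h : y i <;> simp [h]
    rw [h2, ← Real.exp_add]
    split_ifs with h
    · exact Real.one_le_exp (by linarith)
    · positivity
  refine h1.trans ?_
  rw [avg_const_mul, avg_prod (fun (_ : ι) b => if b then Real.exp 1 else 1) hT, sub_eq_neg_add, Real.exp_add]
  refine mul_le_mul_of_nonneg_left ?_ (Real.exp_pos _).le
  have h3 : (2 * p * #T : ℝ) = ∑ i ∈ T, 2 * p := by simp [mul_comm]
  rw [h3, Real.exp_sum]
  refine prod_le_prod (fun i _ => ?_) fun i hi => ?_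
  · have := hq i
    have := Real.exp_pos 1
    simp only [if_true, Bool.false_eq_true, if_false]
    nlinarith [mul_nonneg (hq i).1 this.le]
  · have h4 := Real.exp_one_lt_d9
    have h5 := Real.add_one_le_exp (2 * p)
    have h6 := hp i hi
    have := (hq i).1
    simp only [if_true, Bool.false_eq_true, if_false]
    nlinarith

end Averaging

/-! ### Conditional covariance and the Efron–Stein inequality -/

section Variance

variable {ι : Type*} [Fintype ι] [DecidableEq ι] {q : ι → ℝ} {S T : Finset ι}
  {f g : (ι → Bool) → ℝ} {x : ι → Bool}

/-- The conditional covariance of `f` and `g` given the bits outside `S`. -/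
def covar (q : ι → ℝ) (S : Finset ι) (f g : (ι → Bool) → ℝ) (x : ι → Bool) : ℝ :=
  avg q S (fun y => f y * g y) x - avg q S f x * avg q S g x

lemma covar_eq (c d : ℝ) :
    covar q S f g x = avg q S (fun y => (f y - c) * (g y - d)) x
      - (avg q S f x - c) * (avg q S g x - d) := by
  have : (fun y => (f y - c) * (g y - d)) = fun y => (f y * g y - d * f y - c * g y) + c * d := by
    ext y; ring
  rw [this, avg_add, avg_sub, avg_sub, avg_const_mul, avg_const_mul, avg_const, covar]
  ring

lemma covar_self_nonneg (hq : IsProb q) : 0 ≤ covar q S f f x := by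
  rw [covar_eq (avg q S f x) (avg q S f x)]
  simp only [sub_self, mul_zero, sub_zero]
  exact const_le_avg hq fun y => mul_self_nonneg _

lemma covar_self_le (c : ℝ) :
    covar q S f f x ≤ avg q S (fun y => (f y - c) ^ 2) x := by
  rw [covar_eq c c]
  simp only [← pow_two]
  nlinarith [sq_nonneg (avg q S f x - c)]

lemma covar_le (hq : IsProb q) :
    covar q S f g x ≤ (covar q S f f x + covar q S g g x) / 2 := by
  have h := covar_self_nonneg (S := S) (f := fun y => f y - g y) (x := x) hq
  have : (fun y => (f y - g y) * (f y - g y))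
      = fun y => (f y * f y + g y * g y) - 2 * (f y * g y) := by
    ext y; ring
  rw [covar, this, avg_sub, avg_add, avg_const_mul, avg_sub] at h
  simp only [covar]
  nlinarith

lemma covar_add_self_le (hq : IsProb q) :
    covar q S (fun y => f y + g y) (fun y => f y + g y) x
      ≤ 2 * covar q S f f x + 2 * covar q S g g x := by
  have h := covar_self_nonneg (S := S) (f := fun y => f y - g y) (x := x) hq
  have h1 : (fun y => (f y - g y) * (f y - g y))
      = fun y => (f y * f y + g y * g y) - 2 * (f y * g y) := by
    ext y; ring
  have h2 : (fun y => (f y + g y) * (f y + g y))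
      = fun y => (f y * f y + g y * g y) + 2 * (f y * g y) := by
    ext y; ring
  rw [covar, h1, avg_sub, avg_add, avg_const_mul, avg_sub] at h
  rw [covar, h2, avg_add, avg_add, avg_const_mul, avg_add]
  simp only [covar]
  nlinarith

/-- The law of total covariance. -/
lemma covar_union (S T : Finset ι) :
    covar q (S ∪ T) f g x
      = avg q S (covar q T f g) x + covar q S (avg q T f) (avg q T g) x := by
  have : covar q T f g = fun y => avg q T (fun z => f z * g z) y - avg q T f y * avg q T g y := rfl
  rw [this, avg_sub, covar, covar, avg_avg, avg_avg, avg_avg]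
  ring

lemma sq_avg_le (hq : IsProb q) : (avg q S f x) ^ 2 ≤ avg q S (fun y => f y ^ 2) x := by
  have h := covar_self_nonneg (S := S) (f := f) (x := x) hq
  simp only [covar, ← pow_two] at h
  linarith

/-- The effect on `f` of switching bit `i` from `false` to `true`. -/
def influence (f : (ι → Bool) → ℝ) (i : ι) (x : ι → Bool) : ℝ :=
  f (Function.update x i true) - f (Function.update x i false)

lemma avg_influence (i : ι) (hi : i ∉ S) :
    influence (avg q S f) i x = avg q S (influence f i) x := by
  have h : ∀ b, avg q S f (Function.update x i b)
      = avg q S (fun y => f (Function.update y i b)) x := by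
    intro b
    refine sum_congr rfl fun y _ => ?_
    congr 2
    ext j
    by_cases hj : j = i
    · subst hj; simp [hi]
    · by_cases hjS : j ∈ S <;> simp [hj, hjS]
  rw [influence, h, h, ← avg_sub]
  rfl

/-- The Efron–Stein inequality for independent bits. -/
lemma covar_self_le_sum_influence (hq : IsProb q) (f : (ι → Bool) → ℝ) (S : Finset ι)
    (x : ι → Bool) :
    covar q S f f x ≤ ∑ i ∈ S, q i * avg q S (fun y => influence f i y ^ 2) x := by
  induction S using Finset.induction_on generalizing x with
  | empty => simp [covar]
  | insert i S hi ih =>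
    rw [insert_eq, covar_union, ← insert_eq, sum_insert hi]
    have h1 : avg q {i} (covar q S f f) x
        ≤ ∑ j ∈ S, q j * avg q (insert i S) (fun y => influence f j y ^ 2) x := by
      refine (avg_mono hq fun y _ => ih y).trans (le_of_eq ?_)
      rw [avg_sum]
      refine sum_congr rfl fun j _ => ?_
      rw [avg_const_mul, avg_avg, ← insert_eq]
    have h2 : covar q {i} (avg q S f) (avg q S f) x
        ≤ q i * avg q (insert i S) (fun y => influence f i y ^ 2) x := by
      have h3 : covar q {i} (avg q S f) (avg q S f) x
          = q i * (1 - q i) * (influence (avg q S f) i x) ^ 2 := by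
        simp only [covar, avg_singleton, influence]; ring
      have h4 : (influence (avg q S f) i x) ^ 2
          ≤ avg q (insert i S) (fun y => influence f i y ^ 2) x := by
        have h5 : ∀ y b, influence f i (Function.update y i b) = influence f i y := by
          intro y b; simp [influence]
        have h6 : ∀ b, avg q S (fun y => influence f i y ^ 2) (Function.update x i b)
            = avg q S (fun y => influence f i y ^ 2) x := by
          intro b
          refine Ignores.avg (T := {i}) ?_ _ _ ?_
          · intro y z hyz
            have : ∀ b, Function.update y i b = Function.update z i b := by
              intro b; ext j; by_cases hj : j = i
              · subst hj; simp
              · simp [hj, hyz j (by simpa using hj)]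
            simp [influence, this]
          · intro j hj
            have : j ≠ i := by simpa using hj
            simp [this]
        rw [avg_influence i hi, avg_insert, h6, h6]
        have := sq_avg_le (S := S) (f := influence f i) (x := x) hq
        linarith
      rw [h3]
      have := hq i
      have h7 : 0 ≤ (influence (avg q S f) i x) ^ 2 := sq_nonneg _
      have h8 := mul_le_mul_of_nonneg_left h4 this.1
      nlinarith [mul_nonneg (mul_nonneg this.1 this.1) h7]
    linarith

end Variance

/-! ### Anticoncentration of signed sums of independent bits -/

section Anticoncentration

variable {ι : Type*} [Fintype ι] [DecidableEq ι] {q q' : ι → ℝ} {S T : Finset ι}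
  {x : ι → Bool}

/-- The modulus of the characteristic function of a signed sum of independent bits decays like
that of a Gaussian with the same variance. -/
lemma avg_cos_le (s : ι → ℤ) (hs : ∀ i, s i = 1 ∨ s i = -1) (θ α : ℝ) :
    avg q S (fun y => Real.cos ((∑ i ∈ S, if y i then s i else 0 : ℤ) * θ + α)) x
      ≤ Real.exp (-(∑ i ∈ S, q i * (1 - q i)) * (1 - Real.cos θ)) := by
  induction S using Finset.induction_on generalizing x α with
  | empty => simp [Real.cos_le_one]
  | insert a S ha ih =>
    -- `z` is the characteristic function of the summand `a`, and multiplication by it shifts the phase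
    -- `α` by `z.arg` and scales by `‖z‖`.
    set z : ℂ := q a * Complex.exp ((s a * θ : ℝ) * Complex.I) + (1 - q a) with hz
    have hre : z.re = q a * Real.cos (s a * θ) + (1 - q a) := by
      rw [hz, Complex.add_re, Complex.re_ofReal_mul, Complex.exp_ofReal_mul_I_re]; simp
    have him : z.im = q a * Real.sin (s a * θ) := by
      rw [hz, Complex.add_im, Complex.im_ofReal_mul, Complex.exp_ofReal_mul_I_im]; simp
    have hcomb : ∀ φ : ℝ, q a * Real.cos (φ + s a * θ) + (1 - q a) * Real.cos φ
        = ‖z‖ * Real.cos (φ + z.arg) := by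
      intro φ
      have h1 : (z * Complex.exp (φ * Complex.I)).re
          = q a * Real.cos (φ + s a * θ) + (1 - q a) * Real.cos φ := by
        rw [Complex.mul_re, Complex.exp_ofReal_mul_I_re, Complex.exp_ofReal_mul_I_im, hre, him,
          Real.cos_add]
        ring
      have h2 : (z * Complex.exp (φ * Complex.I)).re = ‖z‖ * Real.cos (φ + z.arg) := by
        conv_lhs => rw [← Complex.norm_mul_exp_arg_mul_I z]
        rw [mul_assoc, ← Complex.exp_add, ← add_mul, ← Complex.ofReal_add, Complex.re_ofReal_mul,
          Complex.exp_ofReal_mul_I_re, add_comm z.arg]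
      rw [← h1, h2]
    have hcos : Real.cos (s a * θ) = Real.cos θ := by
      rcases hs a with h | h <;> simp [h]
    have hnorm : ‖z‖ ≤ Real.exp (-(q a * (1 - q a)) * (1 - Real.cos θ)) := by
      have h1 : ‖z‖ ^ 2 = 1 - 2 * (q a * (1 - q a)) * (1 - Real.cos θ) := by
        rw [← hcos, Complex.sq_norm, Complex.normSq_apply, hre, him]
        linear_combination q a ^ 2 * Real.sin_sq_add_cos_sq (s a * θ)
      have h2 : ‖z‖ ^ 2 ≤ Real.exp (-(q a * (1 - q a)) * (1 - Real.cos θ)) ^ 2 := by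
        rw [h1, ← Real.exp_nat_mul]
        have := Real.add_one_le_exp ((2 : ℕ) * (-(q a * (1 - q a)) * (1 - Real.cos θ)))
        push_cast at this ⊢
        linarith
      exact le_of_sq_le_sq h2 (Real.exp_pos _).le
    have hcastupd : ∀ (y : ι → Bool) (b : Bool), (∀ i, i ∉ S → y i = Function.update x a b i) →
        (∑ i ∈ insert a S, if y i then s i else 0)
          = (∑ i ∈ S, if y i then s i else 0) + if b then s a else 0 := by
      intro y b hy
      rw [sum_insert ha, hy a ha]
      simp [add_comm]
    have h1 : avg q S (fun y => Real.cos ((∑ i ∈ insert a S, if y i then s i else 0 : ℤ) * θ + α))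
        (Function.update x a true)
        = avg q S (fun y => Real.cos (((∑ i ∈ S, if y i then s i else 0 : ℤ) * θ + α) + s a * θ))
          x := by
      rw [avg_congr (g := fun y =>
        Real.cos (((∑ i ∈ S, if y i then s i else 0 : ℤ) * θ + α) + s a * θ))]
      · refine Ignores.avg (T := {a}) ?_ _ _ ?_
        · intro y z hyz
          have : ∀ i ∈ S, y i = z i := fun i hi => hyz i (by
            simp only [mem_singleton]; rintro rfl; exact ha hi)
          have h0 : (∑ i ∈ S, if y i then s i else 0) = ∑ i ∈ S, if z i then s i else 0 :=
            sum_congr rfl fun i hi => by rw [this i hi]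
          simp only [h0]
        · intro i hi; simp at hi; simp [hi]
      · intro y hy
        rw [hcastupd y true hy]
        simp only [if_true]
        congr 1; push_cast; ring
    have h2 : avg q S (fun y => Real.cos ((∑ i ∈ insert a S, if y i then s i else 0 : ℤ) * θ + α))
        (Function.update x a false)
        = avg q S (fun y => Real.cos ((∑ i ∈ S, if y i then s i else 0 : ℤ) * θ + α)) x := by
      rw [avg_congr (g := fun y => Real.cos ((∑ i ∈ S, if y i then s i else 0 : ℤ) * θ + α))]
      · refine Ignores.avg (T := {a}) ?_ _ _ ?_
        · intro y z hyz
          have : ∀ i ∈ S, y i = z i := fun i hi => hyz i (by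
            simp only [mem_singleton]; rintro rfl; exact ha hi)
          have h0 : (∑ i ∈ S, if y i then s i else 0) = ∑ i ∈ S, if z i then s i else 0 :=
            sum_congr rfl fun i hi => by rw [this i hi]
          simp only [h0]
        · intro i hi; simp at hi; simp [hi]
      · intro y hy
        rw [hcastupd y false hy]
        simp
    rw [avg_insert, h1, h2, ← avg_const_mul, ← avg_const_mul, ← avg_add]
    simp only [hcomb]
    simp only [add_assoc]
    rw [avg_const_mul, sum_insert ha, neg_add, add_mul, Real.exp_add]
    refine (mul_le_mul_of_nonneg_left (ih (α + z.arg)) (norm_nonneg z)).trans ?_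
    exact mul_le_mul_of_nonneg_right hnorm (Real.exp_pos _).le

lemma integral_cos_int_mul (k : ℤ) :
    ∫ θ in (-Real.pi)..Real.pi, Real.cos (k * θ) = if k = 0 then 2 * Real.pi else 0 := by
  split_ifs with h
  · simp [h]; ring
  · have hk : (k : ℝ) ≠ 0 := by exact_mod_cast h
    rw [intervalIntegral.integral_comp_mul_left (fun θ => Real.cos θ) hk, integral_cos]
    simp [Real.sin_int_mul_pi]

/-- A signed sum of independent bits with total variance at least `v` takes each value with
probability at most `1 / √v`. -/
lemma avg_signed_sum_eq_le (s : ι → ℤ) (hs : ∀ i, s i = 1 ∨ s i = -1) {v : ℝ}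
    (hv : 0 < v) (hvS : v ≤ ∑ i ∈ S, q i * (1 - q i)) (t : ℤ) :
    avg q S (fun y => if (∑ i ∈ S, if y i then s i else 0) = t then 1 else 0) x ≤ 1 / √v := by
  have hpi := Real.pi_pos
  set M : (ι → Bool) → ℤ := fun y => ∑ i ∈ S, if y i then s i else 0 with hM
  have h1 : ∀ y, (if M y = t then (1 : ℝ) else 0)
      = (2 * Real.pi)⁻¹ * ∫ θ in (-Real.pi)..Real.pi, Real.cos (M y * θ + -t * θ) := by
    intro y
    have : ∀ θ : ℝ, (M y * θ + -t * θ : ℝ) = ((M y - t : ℤ) : ℝ) * θ := by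
      intro θ; push_cast; ring
    simp only [this]
    rw [integral_cos_int_mul]
    by_cases h : M y = t
    · simp [h]; field_simp
    · simp [h, sub_eq_zero]
  have hint : ∀ y, IntervalIntegrable (fun θ : ℝ => Real.cos (M y * θ + -t * θ))
      MeasureTheory.volume (-Real.pi) Real.pi := fun y =>
    (by fun_prop : Continuous fun θ : ℝ => Real.cos (M y * θ + -t * θ)).intervalIntegrable _ _
  have h2 : avg q S (fun y => if M y = t then 1 else 0) x = (2 * Real.pi)⁻¹ *
      ∫ θ in (-Real.pi)..Real.pi, avg q S (fun y => Real.cos (M y * θ + -t * θ)) x := by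
    simp only [avg]
    rw [intervalIntegral.integral_finsetSum fun y _ => (hint _).const_mul _, mul_sum]
    refine sum_congr rfl fun y _ => ?_
    rw [intervalIntegral.integral_const_mul, h1]
    ring
  have hcont : Continuous fun θ : ℝ => avg q S (fun y => Real.cos (M y * θ + -t * θ)) x := by
    simp only [avg]; fun_prop
  set b : ℝ := 2 * v / Real.pi ^ 2 with hb
  have hbpos : 0 < b := by positivity
  have hgauss : Continuous fun θ : ℝ => Real.exp (-b * θ ^ 2) := by fun_prop
  have h3 : ∫ θ in (-Real.pi)..Real.pi, avg q S (fun y => Real.cos (M y * θ + -t * θ)) x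
      ≤ ∫ θ in (-Real.pi)..Real.pi, Real.exp (-b * θ ^ 2) := by
    refine intervalIntegral.integral_mono_on (by linarith) (hcont.intervalIntegrable _ _)
      (hgauss.intervalIntegrable _ _) fun θ hθ => ?_
    refine (avg_cos_le s hs θ (-t * θ)).trans (Real.exp_le_exp.2 ?_)
    have h4 := Real.cos_le_one_sub_mul_cos_sq (x := θ) (abs_le.2 ⟨hθ.1, hθ.2⟩)
    have h5 : v * (2 / Real.pi ^ 2 * θ ^ 2)
        ≤ (∑ i ∈ S, q i * (1 - q i)) * (1 - Real.cos θ) :=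
      mul_le_mul hvS (by linarith) (by positivity) (hv.le.trans hvS)
    have h6 : -b * θ ^ 2 = -(v * (2 / Real.pi ^ 2 * θ ^ 2)) := by rw [hb]; ring
    rw [h6]; linarith
  have h4 : ∫ θ in (-Real.pi)..Real.pi, Real.exp (-b * θ ^ 2) ≤ √(Real.pi / b) := by
    rw [intervalIntegral.integral_of_le (by linarith), ← integral_gaussian b]
    exact MeasureTheory.setIntegral_le_integral (integrable_exp_neg_mul_sq hbpos)
      (Filter.Eventually.of_forall fun θ => (Real.exp_pos _).le)
  rw [h2]
  refine (mul_le_mul_of_nonneg_left (h3.trans h4) (by positivity)).trans ?_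
  have h5 : √(Real.pi / b) = Real.pi * √(Real.pi / 2) / √v := by
    have : Real.pi / b = Real.pi ^ 2 * (Real.pi / 2) / v := by rw [hb]; field_simp
    rw [this, Real.sqrt_div (by positivity), Real.sqrt_mul (by positivity),
      Real.sqrt_sq hpi.le]
  have h6 : √(Real.pi / 2) ≤ 2 := by
    rw [Real.sqrt_le_left (by norm_num)]
    have := Real.pi_lt_four
    linarith
  rw [h5]
  have hsv : 0 < √v := Real.sqrt_pos.2 hv
  rw [← mul_div_assoc, div_le_div_iff_of_pos_right hsv]
  field_simp
  linarith

/-- The sign `±1` encoded by a bit. -/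
def sg (b : Bool) : ℤ := if b then 1 else -1

@[simp] lemma sg_true : sg true = 1 := rfl
@[simp] lemma sg_false : sg false = -1 := rfl

lemma sum_sg (A : Finset ι) (y : ι → Bool) :
    ∑ u ∈ A, sg (y u) = 2 * (∑ u ∈ A, if y u then 1 else 0) - #A := by
  rw [mul_sum, card_eq_sum_ones, Nat.cast_sum, ← sum_sub_distrib]
  refine sum_congr rfl fun u _ => ?_
  cases y u <;> simp

lemma avg_sum_sg_eq_le (hq : IsProb q) {v : ℝ} (hv : 0 < v)
    (hvS : v ≤ ∑ i ∈ S, q i * (1 - q i)) (t : ℤ) :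
    avg q S (fun y => if ∑ u ∈ S, sg (y u) = t then 1 else 0) x ≤ 1 / √v := by
  refine (avg_mono hq fun y _ => ?_).trans
    (avg_signed_sum_eq_le (x := x) (fun _ => 1) (fun _ => Or.inl rfl) hv hvS ((t + #S) / 2))
  have := sum_sg S y
  split_ifs with h1 h2
  · exact le_rfl
  · omega
  · norm_num
  · exact le_rfl

/-- The upper tail of a sum of independent signs. -/
def tail (q : ι → ℝ) (A : Finset ι) (τ : ℤ) : ℝ :=
  avg q A (fun y => if τ ≤ ∑ u ∈ A, sg (y u) then 1 else 0) (fun _ => false)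

lemma tail_nonneg (hq : IsProb q) (τ : ℤ) : 0 ≤ tail q S τ := avg_indicator_nonneg hq _

lemma tail_le_one (hq : IsProb q) (τ : ℤ) : tail q S τ ≤ 1 :=
  avg_le_const hq fun y => by split_ifs <;> norm_num

lemma avg_indicator_le_sub (hq : IsProb q) (N : (ι → Bool) → ℤ) {c : ℝ}
    (hc : ∀ t, avg q S (fun y => if N y = t then 1 else 0) x ≤ c) {τ τ' : ℤ} (h : τ ≤ τ') :
    |avg q S (fun y => if τ ≤ N y then 1 else 0) x
      - avg q S (fun y => if τ' ≤ N y then 1 else 0) x| ≤ (τ' - τ) * c := by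
  rw [← avg_sub]
  have h1 : (fun y => (if τ ≤ N y then (1 : ℝ) else 0) - if τ' ≤ N y then 1 else 0)
      = fun y => ∑ t ∈ Ico τ τ', if N y = t then 1 else 0 := by
    ext y
    rw [sum_ite_eq]
    simp only [mem_Ico]
    split_ifs <;> first | omega | norm_num
  rw [h1, abs_of_nonneg (const_le_avg hq fun y => sum_nonneg fun _ _ => by split_ifs <;> norm_num),
    avg_sum]
  refine (sum_le_card_nsmul _ _ c fun t _ => hc t).trans (le_of_eq ?_)
  have : ((τ' - τ).toNat : ℝ) = (τ' - τ : ℝ) := by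
    have : (((τ' - τ).toNat : ℤ) : ℝ) = ((τ' - τ : ℤ) : ℝ) := by rw [Int.toNat_of_nonneg (by omega)]
    push_cast at this; exact this
  rw [Int.card_Ico, nsmul_eq_mul, this]

lemma abs_tail_sub_le_of_var (hq : IsProb q) {v : ℝ} (hv : 0 < v)
    (hvS : v ≤ ∑ i ∈ S, q i * (1 - q i)) (τ τ' : ℤ) :
    |tail q S τ - tail q S τ'| ≤ |(τ : ℝ) - τ'| / √v := by
  have hc := fun t => avg_sum_sg_eq_le (x := fun _ => false) hq hv hvS t
  rcases le_total τ τ' with h | h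
  · have h1 := avg_indicator_le_sub hq _ hc h
    have h2 : (τ : ℝ) ≤ τ' := by exact_mod_cast h
    rw [abs_sub_comm (τ : ℝ), abs_of_nonneg (by linarith : (0 : ℝ) ≤ τ' - τ)]
    refine h1.trans (le_of_eq ?_); ring
  · have h1 := avg_indicator_le_sub hq _ hc h
    have h2 : (τ' : ℝ) ≤ τ := by exact_mod_cast h
    rw [abs_sub_comm, abs_of_nonneg (by linarith : (0 : ℝ) ≤ τ - τ')]
    refine h1.trans (le_of_eq ?_); ring

lemma tail_insert {a : ι} (ha : a ∉ S) (τ : ℤ) :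
    tail q (insert a S) τ = q a * tail q S (τ - 1) + (1 - q a) * tail q S (τ + 1) := by
  have h : ∀ b : Bool, avg q S (fun y => if τ ≤ ∑ u ∈ insert a S, sg (y u) then 1 else 0)
      (Function.update (fun _ => false) a b) = tail q S (τ - sg b) := by
    intro b
    rw [avg_congr (g := fun y => if τ - sg b ≤ ∑ u ∈ S, sg (y u) then 1 else 0)]
    · refine Ignores.avg (T := {a}) ?_ _ _ ?_
      · intro y z hyz
        have : ∀ i ∈ S, y i = z i := fun i hi => hyz i (by
          simp only [mem_singleton]; rintro rfl; exact ha hi)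
        have h0 : ∑ i ∈ S, sg (y i) = ∑ i ∈ S, sg (z i) :=
          sum_congr rfl fun i hi => by rw [this i hi]
        simp only [h0]
      · intro i hi; simp at hi; simp [hi]
    · intro y hy
      rw [sum_insert ha, hy a ha]
      simp only [Function.update_self]
      have : (τ ≤ sg b + ∑ u ∈ S, sg (y u)) ↔ (τ - sg b ≤ ∑ u ∈ S, sg (y u)) := by omega
      simp only [this]
  rw [tail, avg_insert, h, h]
  simp

lemma tail_congr (h : ∀ i ∈ S, q i = q' i) (τ : ℤ) : tail q S τ = tail q' S τ :=
  avg_congr_prob h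

/-- The tail of a sum of independent non-degenerate signs is Lipschitz in the probabilities of the
signs and in the threshold, with constants of order `1 / √#S`. -/
lemma abs_tail_sub_le (hq : IsProb q) (hq' : IsProb q') (hcard : 2 ≤ #S)
    (h1 : ∀ i ∈ S, 1 / 4 ≤ q i ∧ q i ≤ 3 / 4) (h2 : ∀ i ∈ S, 1 / 4 ≤ q' i ∧ q' i ≤ 3 / 4)
    (τ τ' : ℤ) :
    |tail q S τ - tail q' S τ'| ≤ (8 * ∑ i ∈ S, |q i - q' i| + 4 * |(τ : ℝ) - τ'|) / √(#S : ℝ) := by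
  have hcardR : (2 : ℝ) ≤ #S := by exact_mod_cast hcard
  have hpos : (0 : ℝ) < #S := by linarith
  have hvar : ∀ (r : ι → ℝ) (B : Finset ι), (∀ i ∈ B, 1 / 4 ≤ r i ∧ r i ≤ 3 / 4) →
      (#S : ℝ) - 1 ≤ #B → (#S : ℝ) / 16 ≤ ∑ i ∈ B, r i * (1 - r i) := by
    intro r B hr hB
    have : ∑ i ∈ B, (3 / 16 : ℝ) ≤ ∑ i ∈ B, r i * (1 - r i) :=
      sum_le_sum fun i hi => by nlinarith [hr i hi]
    simp only [sum_const, nsmul_eq_mul] at this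
    linarith
  have hsq : 1 / √((#S : ℝ) / 16) = 4 / √(#S : ℝ) := by
    rw [Real.sqrt_div hpos.le, show (16 : ℝ) = 4 ^ 2 by norm_num, Real.sqrt_sq (by norm_num)]
    field_simp
  have hT : ∀ T ⊆ S, |tail q S τ - tail (T.piecewise q' q) S τ|
      ≤ ∑ i ∈ T, |q i - q' i| * (8 / √(#S : ℝ)) := by
    intro T
    induction T using Finset.induction_on with
    | empty => simp
    | insert a T ha ih =>
      intro hTS
      have haS : a ∈ S := hTS (mem_insert_self _ _)
      set r := T.piecewise q' q with hr
      set r' := (insert a T).piecewise q' q with hr'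
      have hrprob : IsProb r := fun i => by
        by_cases hi : i ∈ T <;> simp only [hr, hi, Finset.piecewise_eq_of_mem,
          Finset.piecewise_eq_of_notMem, not_false_eq_true]
        exacts [hq' i, hq i]
      have hr4 : ∀ i ∈ S, 1 / 4 ≤ r i ∧ r i ≤ 3 / 4 := fun i hi => by
        by_cases hiT : i ∈ T <;> simp only [hr, hiT, Finset.piecewise_eq_of_mem,
          Finset.piecewise_eq_of_notMem, not_false_eq_true]
        exacts [h2 i hi, h1 i hi]
      have e1 : tail r S τ - tail r' S τ
          = (q a - q' a) * (tail r (S.erase a) (τ - 1) - tail r (S.erase a) (τ + 1)) := by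
        rw [← insert_erase haS, tail_insert (notMem_erase _ _), tail_insert (notMem_erase _ _)]
        have hrr : ∀ t, tail r' (S.erase a) t = tail r (S.erase a) t := fun t =>
          tail_congr (fun i hi => by
            have hia : i ≠ a := (mem_erase.1 hi).1
            by_cases hiT : i ∈ T <;> simp [hr, hr', hia, hiT]) t
        have ra : r a = q a := by simp [hr, ha]
        have ra' : r' a = q' a := by simp [hr']
        simp only [erase_insert_eq_erase, erase_idem]
        rw [hrr, hrr, ra, ra']
        ring
      have e2 : |tail r (S.erase a) (τ - 1) - tail r (S.erase a) (τ + 1)| ≤ 8 / √(#S : ℝ) := by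
        have := abs_tail_sub_le_of_var hrprob (by positivity : 0 < (#S : ℝ) / 16)
          (hvar r (S.erase a) (fun i hi => hr4 i (mem_of_mem_erase hi)) (by
            rw [card_erase_of_mem haS, Nat.cast_sub (by omega)]; simp)) (τ - 1) (τ + 1)
        refine this.trans (le_of_eq ?_)
        rw [div_eq_mul_one_div, hsq]
        push_cast
        rw [show ((τ : ℝ) - 1 - (τ + 1)) = -2 by ring]
        norm_num
        ring
      rw [sum_insert ha]
      have e3 := ih ((subset_insert _ _).trans hTS)
      have e4 : |tail r S τ - tail r' S τ| ≤ |q a - q' a| * (8 / √(#S : ℝ)) := by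
        rw [e1, abs_mul]
        exact mul_le_mul_of_nonneg_left e2 (abs_nonneg _)
      have := abs_sub_le (tail q S τ) (tail r S τ) (tail r' S τ)
      linarith
  have h3 := hT S Subset.rfl
  rw [tail_congr (q := S.piecewise q' q) (q' := q') (fun i hi => by simp [hi]), ← sum_mul] at h3
  have h4 := abs_tail_sub_le_of_var hq' (by positivity : 0 < (#S : ℝ) / 16)
    (hvar q' S h2 (by linarith)) τ τ'
  rw [div_eq_mul_one_div _ (√((#S : ℝ) / 16)), hsq] at h4
  have h5 := abs_sub_le (tail q S τ) (tail q' S τ) (tail q' S τ')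
  calc _ ≤ _ := h5
    _ ≤ _ := add_le_add h3 h4
    _ = _ := by ring

end Anticoncentration

/-! ### Central binomial coefficients -/

section Binomial

lemma sixteen_pow_le_centralBinom (n : ℕ) (hn : 1 ≤ n) :
    16 ^ n ≤ 4 * n * n.centralBinom ^ 2 := by
  induction n, hn using Nat.le_induction with
  | base => simp [Nat.centralBinom]
  | succ n hn ih =>
    have h := Nat.succ_mul_centralBinom_succ n
    have h2 : n * (n + 1) * (4 * (n + 1) * (n + 1).centralBinom ^ 2)
        = 16 * n * (2 * n + 1) ^ 2 * n.centralBinom ^ 2 := by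
      calc _ = 4 * n * ((n + 1) * (n + 1).centralBinom) ^ 2 := by ring
        _ = _ := by rw [h]; ring
    have h3 : n * (n + 1) * 16 ^ (n + 1)
        ≤ n * (n + 1) * (4 * (n + 1) * (n + 1).centralBinom ^ 2) := by
      rw [h2]
      calc n * (n + 1) * 16 ^ (n + 1) = 16 * (n * (n + 1)) * 16 ^ n := by ring
        _ ≤ 16 * (n * (n + 1)) * (4 * n * n.centralBinom ^ 2) := Nat.mul_le_mul_left _ ih
        _ = 16 * n * (4 * n ^ 2 + 4 * n) * n.centralBinom ^ 2 := by ring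
        _ ≤ _ := by gcongr; ring_nf; omega
    exact Nat.le_of_mul_le_mul_left h3 (by positivity)

lemma two_pow_le_choose_half (m : ℕ) (hm : 1 ≤ m) :
    (2 : ℝ) ^ m / (2 * √m) ≤ m.choose (m / 2) := by
  have hmR : (1 : ℝ) ≤ m := by exact_mod_cast hm
  have hs : 0 < √(m : ℝ) := Real.sqrt_pos.2 (by linarith)
  have key : (4 : ℝ) ^ m ≤ 4 * m * (m.choose (m / 2) : ℝ) ^ 2 := by
    rcases Nat.even_or_odd' m with ⟨n, rfl | rfl⟩
    · have h := sixteen_pow_le_centralBinom n (by omega)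
      rw [Nat.mul_div_cancel_left _ (by norm_num), ← Nat.centralBinom_eq_two_mul_choose]
      have h' : (16 : ℝ) ^ n ≤ 4 * n * (n.centralBinom : ℝ) ^ 2 := by exact_mod_cast h
      rw [pow_mul]
      norm_num
      have : (0 : ℝ) ≤ n * (n.centralBinom : ℝ) ^ 2 := by positivity
      nlinarith
    · have h := sixteen_pow_le_centralBinom (n + 1) (by omega)
      have h1 : (n + 1).centralBinom = 2 * (2 * n + 1).choose n := by
        rw [Nat.centralBinom_eq_two_mul_choose, show 2 * (n + 1) = 2 * n + 1 + 1 by ring,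
          Nat.choose_succ_succ, Nat.choose_symm_half]
        ring
      have h2 : (2 * n + 1) / 2 = n := by omega
      rw [h1] at h
      rw [h2]
      have h' : (16 : ℝ) ^ (n + 1) ≤ 4 * (n + 1) * (2 * ((2 * n + 1).choose n : ℝ)) ^ 2 := by
        exact_mod_cast h
      have h3 : (4 : ℝ) ^ (2 * n + 1) = 16 ^ (n + 1) / 4 := by
        rw [pow_succ, pow_mul, pow_succ]; norm_num
        ring
      rw [h3]
      push_cast
      have : (0 : ℝ) ≤ n * ((2 * n + 1).choose n : ℝ) ^ 2 := by positivity
      nlinarith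
  rw [div_le_iff₀ (by positivity)]
  refine le_of_sq_le_sq ?_ (by positivity)
  have h1 : ((2 : ℝ) ^ m) ^ 2 = 4 ^ m := by rw [← pow_mul, mul_comm, pow_mul]; norm_num
  have h2 : (√(m : ℝ)) ^ 2 = m := Real.sq_sqrt (by linarith)
  rw [h1, mul_pow, mul_pow, h2]
  linarith

/-- Binomial coefficients decay at most exponentially, in the square of the distance, away from the
middle one. -/
lemma choose_half_mul_le (m t s : ℕ) (hst : s ≤ t) (ht : 8 * t + 4 ≤ m) :
    (m.choose (m / 2) : ℝ) * (1 - (4 * t + 2) / m) ^ s ≤ m.choose (m / 2 + s) := by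
  have hm : (0 : ℝ) < m := by
    have : 0 < m := by omega
    exact_mod_cast this
  have htR : (8 * t + 4 : ℝ) ≤ m := by exact_mod_cast ht
  have hy : 0 ≤ 1 - (4 * t + 2 : ℝ) / m := by
    rw [sub_nonneg, div_le_one hm]; linarith
  induction s with
  | zero => simp
  | succ s ih =>
    have ih := ih (by omega)
    have h1 := Nat.choose_succ_right_eq m (m / 2 + s)
    have h2 : (m.choose (m / 2 + s + 1) : ℝ) * (m / 2 + s + 1 : ℕ)
        = m.choose (m / 2 + s) * ((m : ℝ) - (m / 2 + s : ℕ)) := by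
      rw [← Nat.cast_sub (by omega)]
      exact_mod_cast h1
    have h3 : ((m / 2 : ℕ) : ℝ) ≤ m / 2 := Nat.cast_div_le
    have hs : (s : ℝ) + 1 ≤ t := by exact_mod_cast hst
    have h4 : (1 - (4 * t + 2 : ℝ) / m) * (m / 2 + s + 1 : ℕ) ≤ (m : ℝ) - (m / 2 + s : ℕ) := by
      push_cast
      have h5 : (1 - (4 * t + 2 : ℝ) / m) * (m / 2 + s + 1) ≤ m / 2 - s := by
        have h6 : (4 * t + 2 : ℝ) / m * (m / 2) = 2 * t + 1 := by field_simp; ring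
        have h7 : 0 ≤ (4 * t + 2 : ℝ) / m * (s + 1) := by positivity
        nlinarith
      have h8 : (1 - (4 * t + 2 : ℝ) / m) * (((m / 2 : ℕ) : ℝ) + s + 1)
          ≤ (1 - (4 * t + 2 : ℝ) / m) * (m / 2 + s + 1) :=
        mul_le_mul_of_nonneg_left (by linarith) hy
      linarith
    have hpos : (0 : ℝ) < (m / 2 + s + 1 : ℕ) := by positivity
    rw [← add_assoc, pow_succ, ← mul_assoc]
    refine le_of_mul_le_mul_right ?_ hpos
    rw [h2, mul_assoc]
    exact mul_le_mul ih h4 (mul_nonneg hy hpos.le) (Nat.cast_nonneg _)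

/-- The local lower bound for the binomial distribution: within `O(√m)` of the middle every value
has probability of order `1 / √m`. -/
lemma exists_choose_lower (L : ℝ) (hL : 1 ≤ L) :
    ∃ c > 0, ∃ m₀ : ℝ, ∀ m : ℕ, m₀ ≤ m → ∀ i : ℕ, |2 * (i : ℝ) - m| ≤ L * √m →
      c / √m ≤ m.choose i / 2 ^ m := by
  refine ⟨Real.exp (-(8 * (2 * L) ^ 2 + 4 * (2 * L))) / 2, by positivity, (17 * L) ^ 2 + 40,
    fun m hm => ?_⟩
  have hm1 : (40 : ℝ) ≤ m := by nlinarith [sq_nonneg L]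
  have hmN : 40 ≤ m := by exact_mod_cast hm1
  set r := √(m : ℝ) with hr
  have hr2 : r ^ 2 = m := Real.sq_sqrt (by linarith)
  have hr0 : 0 < r := Real.sqrt_pos.2 (by linarith)
  have hrL : 17 * L ≤ r := Real.le_sqrt_of_sq_le (by linarith)
  have hr1 : 1 ≤ r := by linarith
  -- By symmetry it is enough to treat the upper half.
  have main : ∀ i : ℕ, m / 2 ≤ i → 2 * (i : ℝ) - m ≤ L * r →
      Real.exp (-(8 * (2 * L) ^ 2 + 4 * (2 * L))) / 2 / r ≤ m.choose i / 2 ^ m := by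
    intro i hi h
    obtain ⟨s, rfl⟩ := Nat.exists_eq_add_of_le hi
    have h1 : (m : ℝ) / 2 - 1 / 2 ≤ ((m / 2 : ℕ) : ℝ) := by
      have : m ≤ 2 * (m / 2) + 1 := by omega
      have : (m : ℝ) ≤ 2 * ((m / 2 : ℕ) : ℝ) + 1 := by exact_mod_cast this
      linarith
    push_cast at h
    have hs : (s : ℝ) ≤ 2 * L * r := by nlinarith
    have hs8 : 8 * s + 4 ≤ m := by
      have : (8 * s + 4 : ℝ) ≤ m := by nlinarith
      exact_mod_cast this
    have hc := choose_half_mul_le m s s le_rfl hs8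
    have hy : (4 * s + 2 : ℝ) / m ≤ 1 / 2 := by
      have : (8 * s + 4 : ℝ) ≤ m := by exact_mod_cast hs8
      rw [div_le_iff₀ (by linarith)]; linarith
    set y := (4 * s + 2 : ℝ) / m with hydef
    have hy0 : 0 ≤ y := by positivity
    have hexp : Real.exp (-(2 * y)) ≤ 1 - y := by
      have h2 := Real.one_sub_inv_le_log_of_pos (by linarith : 0 < 1 - y)
      have h3 : -(2 * y) ≤ Real.log (1 - y) := by
        refine le_trans ?_ h2
        have h4 : (1 - y)⁻¹ ≤ 1 + 2 * y := by
          rw [inv_le_comm₀ (by linarith) (by linarith), inv_le_iff_one_le_mul₀ (by linarith)]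
          nlinarith
        linarith
      calc Real.exp (-(2 * y)) ≤ Real.exp (Real.log (1 - y)) := Real.exp_le_exp.2 h3
        _ = 1 - y := Real.exp_log (by linarith)
    have hpow : Real.exp (-(8 * (2 * L) ^ 2 + 4 * (2 * L))) ≤ (1 - y) ^ s := by
      refine le_trans ?_ (pow_le_pow_left₀ (Real.exp_pos _).le hexp s)
      rw [← Real.exp_nat_mul, Real.exp_le_exp]
      have h5 : (s : ℝ) * y ≤ 4 * (2 * L) ^ 2 + 2 * (2 * L) := by
        rw [hydef, ← mul_div_assoc, div_le_iff₀ (by linarith), ← hr2]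
        have hs0 : (0 : ℝ) ≤ s := Nat.cast_nonneg _
        have h6 : (s : ℝ) * s ≤ (2 * L * r) * (2 * L * r) := mul_self_le_mul_self hs0 hs
        have h7 : 2 * L * r ≤ 2 * L * r * r := by nlinarith
        nlinarith
      linarith
    have hhalf := two_pow_le_choose_half m (by omega)
    rw [← hr] at hhalf
    have h2m : (0 : ℝ) < 2 ^ m := by positivity
    rw [le_div_iff₀ h2m]
    calc Real.exp (-(8 * (2 * L) ^ 2 + 4 * (2 * L))) / 2 / r * 2 ^ m
        = (2 : ℝ) ^ m / (2 * r) * Real.exp (-(8 * (2 * L) ^ 2 + 4 * (2 * L))) := by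
          field_simp
      _ ≤ m.choose (m / 2) * (1 - y) ^ s :=
          mul_le_mul hhalf hpow (Real.exp_pos _).le (Nat.cast_nonneg _)
      _ ≤ _ := hc
  intro i hi
  obtain ⟨h1, h2⟩ := abs_le.1 hi
  rcases le_total (m / 2) i with h | h
  · exact main i h h2
  · have him : i ≤ m := by omega
    rw [← Nat.choose_symm him]
    refine main (m - i) (by omega) ?_
    rw [Nat.cast_sub him]
    linarith

end Binomial

/-! ### Small ball probabilities of sums of independent signs -/

section SmallBall

variable {ι : Type*} [Fintype ι] [DecidableEq ι] {q q' : ι → ℝ} {S T : Finset ι}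
  {x : ι → Bool}

lemma isProb_half : IsProb (fun _ : ι => (1 / 2 : ℝ)) := fun _ => by norm_num

/-- A sum of fair signs is binomially distributed. -/
lemma avg_half_sum_eq (I : Finset ι) (i : ℕ) :
    avg (fun _ => 1 / 2) I (fun y => if ∑ u ∈ I, sg (y u) = 2 * i - #I then 1 else 0) x
      = (#I).choose i / 2 ^ #I := by
  rw [avg_eq_sum_powerset]
  have h1 : ∀ T ∈ I.powerset, (∏ i ∈ T, (1 / 2 : ℝ)) * (∏ i ∈ I \ T, (1 - 1 / 2 : ℝ)) *
      (if ∑ u ∈ I, sg (I.piecewise (fun i => decide (i ∈ T)) x u) = 2 * i - #I then 1 else 0)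
      = if #T = i then (1 / 2 : ℝ) ^ #I else 0 := by
    intro T hT
    have hTI := mem_powerset.1 hT
    have h2 : ∑ u ∈ I, sg (I.piecewise (fun i => decide (i ∈ T)) x u) = 2 * #T - #I := by
      rw [sum_sg]
      have : (∑ u ∈ I, if I.piecewise (fun i => decide (i ∈ T)) x u then (1 : ℤ) else 0) = #T := by
        rw [sum_congr rfl fun u hu => by rw [Finset.piecewise_eq_of_mem _ _ _ hu]]
        simp [inter_eq_right.2 hTI]
      rw [this]
    have h3 : #T + #(I \ T) = #I := by rw [add_comm, card_sdiff_add_card_eq_card hTI]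
    rw [h2, prod_const, prod_const, show (1 - 1 / 2 : ℝ) = 1 / 2 by norm_num, ← pow_add, h3]
    have h4 : (2 * (#T : ℤ) - #I = 2 * i - #I) ↔ #T = i := by omega
    simp only [h4]
    split_ifs <;> simp
  rw [sum_congr rfl h1, ← sum_filter, sum_const, ← powersetCard_eq_filter, card_powersetCard]
  rw [nsmul_eq_mul, one_div, inv_pow, ← div_eq_mul_inv]

/-- A random sign whose bias is at most `1 / 2` is, with probability `1 / 2`, a fair sign. -/
lemma avg_eq_avg_mixture (h : ∀ i ∈ S, q i = (1 / 2 + q' i) / 2) (f : (ι → Bool) → ℝ)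
    (x₀ : ι → Bool) :
    avg q S f x = avg (fun _ => 1 / 2) S
      (fun z => avg (fun i => if z i then 1 / 2 else q' i) S f x) x₀ := by
  induction S using Finset.induction_on generalizing x x₀ with
  | empty => simp
  | insert a S ha ih =>
    have ih' := fun x x₀ => ih (x := x) (fun i hi => h i (mem_insert_of_mem hi)) x₀
    have key : ∀ b : Bool, avg (fun _ => 1 / 2) S
        (fun z => avg (fun i => if z i then 1 / 2 else q' i) (insert a S) f x)
        (Function.update x₀ a b)
        = (if b then 1 / 2 else q' a) * avg q S f (Function.update x a true)
          + (1 - if b then 1 / 2 else q' a) * avg q S f (Function.update x a false) := by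
      intro b
      rw [ih' _ (Function.update x₀ a b), ih' (Function.update x a false) (Function.update x₀ a b),
        ← avg_const_mul, ← avg_const_mul, ← avg_add]
      refine avg_congr fun z hz => ?_
      have : z a = b := by rw [hz a ha]; simp
      rw [avg_insert, this]
    rw [avg_insert, avg_insert, key, key, h a (mem_insert_self _ _)]
    simp only [if_true, Bool.false_eq_true, if_false]
    ring

lemma avg_sg_half {i : ι} (hi : i ∈ S) :
    avg (fun _ => 1 / 2) S (fun y => (sg (y i) : ℝ)) x = 0 := by
  have h : (fun y : ι → Bool => (sg (y i) : ℝ)) = fun y => 2 * (if y i then 1 else 0) - 1 := by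
    ext y; cases y i <;> norm_num
  rw [h, avg_sub, avg_const_mul, avg_bit hi, avg_const]; norm_num

/-- A shifted sum of `m ≥ k / 4` fair signs hits a window of width `D` about the origin with
probability of order `D / √k`, if the shift is at most `M √k`. -/
lemma exists_fair_small_ball (M : ℝ) (hM : 1 ≤ M) :
    ∃ c > 0, ∃ k₀ : ℝ, ∀ {ι : Type} [Fintype ι] [DecidableEq ι] (I : Finset ι) (x : ι → Bool)
      (k D : ℝ) (R : ℤ), k₀ ≤ k → k / 4 ≤ #I → #I ≤ k → 2 ≤ D → D ≤ √k → |(R : ℝ)| ≤ M * √k →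
      c * D / √k ≤ avg (fun _ => 1 / 2) I
        (fun y => if |((R + ∑ u ∈ I, sg (y u) : ℤ) : ℝ)| ≤ D then 1 else 0) x := by
  obtain ⟨c, hc, m₀, h⟩ := exists_choose_lower (2 * (M + 1)) (by linarith)
  refine ⟨c / 2, by positivity, max (4 * m₀) (4 * (2 * (M + 1)) ^ 2 + 1), ?_⟩
  intro ι _ _ I x k D R hk hIk hIk' hD hDk hR
  have hk1 : 4 * m₀ ≤ k := (le_max_left _ _).trans hk
  have hk2 : 4 * (2 * (M + 1)) ^ 2 + 1 ≤ k := (le_max_right _ _).trans hk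
  have hkpos : 0 < k := by nlinarith [sq_nonneg (2 * (M + 1))]
  set m := #I with hm
  have hmpos : (0 : ℝ) < m := by linarith
  have hsk : √k ≤ 2 * √(m : ℝ) := by
    rw [show (2 : ℝ) = √4 by rw [show (4 : ℝ) = 2 ^ 2 by norm_num, Real.sqrt_sq (by norm_num)],
      ← Real.sqrt_mul (by norm_num)]
    exact Real.sqrt_le_sqrt (by linarith)
  have hsm : √(m : ℝ) ≤ √k := Real.sqrt_le_sqrt hIk'
  have hsm0 : 0 < √(m : ℝ) := Real.sqrt_pos.2 hmpos
  have hLm : 2 * (M + 1) * √(m : ℝ) ≤ m := by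
    have h1 : 2 * (M + 1) ≤ √(m : ℝ) := Real.le_sqrt_of_sq_le (by linarith)
    nlinarith [Real.mul_self_sqrt hmpos.le]
  -- The window contains the values `2 i - m - R` for `⌊D⌋` consecutive integers `i ≥ i₀`.
  set i₀ : ℤ := ⌈((m : ℝ) - R - D) / 2⌉ with hi₀
  have hi1 : ((m : ℝ) - R - D) / 2 ≤ i₀ := Int.le_ceil _
  have hi2 : (i₀ : ℝ) < ((m : ℝ) - R - D) / 2 + 1 := Int.ceil_lt_add_one _
  obtain ⟨hR1, hR2⟩ := abs_le.1 hR
  have hRD : (R : ℝ) + D ≤ m := by nlinarith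
  have hi0 : 0 ≤ i₀ := Int.ceil_nonneg (by linarith)
  obtain ⟨j₀, hj₀⟩ := Int.eq_ofNat_of_zero_le hi0
  have hj₀R : (i₀ : ℝ) = j₀ := by exact_mod_cast hj₀
  rw [hj₀R] at hi1 hi2
  set N := ⌊D⌋₊ with hN
  have hN1 : (N : ℝ) ≤ D := Nat.floor_le (by linarith)
  have hN2 : D / 2 ≤ N := by
    have := Nat.lt_floor_add_one D
    rw [← hN] at this
    linarith
  have hwin : ∀ a ∈ range N, |2 * ((j₀ + a : ℕ) : ℝ) - m + R| ≤ D := by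
    intro a ha
    have : (a : ℝ) + 1 ≤ N := by exact_mod_cast (mem_range.1 ha)
    push_cast
    rw [abs_le]
    constructor <;> linarith [(Nat.cast_nonneg a : (0 : ℝ) ≤ a)]
  have h1 : ∀ y : ι → Bool, (∑ a ∈ range N,
      if ∑ u ∈ I, sg (y u) = 2 * ((j₀ + a : ℕ) : ℤ) - m then (1 : ℝ) else 0)
      ≤ if |((R + ∑ u ∈ I, sg (y u) : ℤ) : ℝ)| ≤ D then 1 else 0 := by
    intro y
    by_cases hex : ∃ a ∈ range N, ∑ u ∈ I, sg (y u) = 2 * ((j₀ + a : ℕ) : ℤ) - m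
    · obtain ⟨a, ha, hay⟩ := hex
      have h2 : |((R + ∑ u ∈ I, sg (y u) : ℤ) : ℝ)| ≤ D := by
        rw [hay]
        have := hwin a ha
        push_cast at this ⊢
        rwa [add_comm]
      rw [if_pos h2, sum_eq_single a]
      · simp [hay]
      · intro b _ hba
        rw [if_neg]
        rw [hay]; push_cast; omega
      · intro h; exact absurd ha h
    · rw [sum_eq_zero]
      · split_ifs <;> norm_num
      · intro a ha
        rw [if_neg fun h => hex ⟨a, ha, h⟩]
  refine le_trans ?_ (avg_mono isProb_half fun y _ => h1 y)
  rw [avg_sum]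
  have h2 : ∀ a ∈ range N, c / √k ≤ avg (fun _ => 1 / 2) I
      (fun y => if ∑ u ∈ I, sg (y u) = 2 * ((j₀ + a : ℕ) : ℤ) - m then (1 : ℝ) else 0) x := by
    intro a ha
    rw [avg_half_sum_eq]
    refine le_trans ?_ (h m (by linarith) (j₀ + a) ?_)
    · exact div_le_div_of_nonneg_left hc.le hsm0 hsm
    · have h3 := abs_le.1 (hwin a ha)
      rw [abs_le]
      constructor <;> nlinarith
  calc c / 2 * D / √k = D / 2 * (c / √k) := by ring
    _ ≤ N * (c / √k) := mul_le_mul_of_nonneg_right hN2 (by positivity)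
    _ = ∑ a ∈ range N, c / √k := by simp
    _ ≤ _ := sum_le_sum h2

/-- A sum of `k` independent non-degenerate signs with second moment at most `M² k / 8`, say, lies
within `D` of the origin with probability of order `D / √k`. -/
lemma exists_small_ball (M : ℝ) (hM : 1 ≤ M) :
    ∃ c > 0, ∃ k₀ : ℝ, ∀ {ι : Type} [Fintype ι] [DecidableEq ι] (A : Finset ι) (q : ι → ℝ)
      (x : ι → Bool) (D : ℝ), k₀ ≤ #A → (∀ i ∈ A, 1 / 4 ≤ q i ∧ q i ≤ 3 / 4) → 2 ≤ D →
      D ≤ √(#A : ℝ) →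
      c * D / √(#A : ℝ) *
          (1 / 4 - avg q A (fun y => ((∑ u ∈ A, sg (y u) : ℤ) : ℝ) ^ 2) x / (M ^ 2 * #A))
        ≤ avg q A (fun y => if |((∑ u ∈ A, sg (y u) : ℤ) : ℝ)| ≤ D then 1 else 0) x := by
  obtain ⟨c, hc, k₀, h⟩ := exists_fair_small_ball M hM
  refine ⟨c, hc, max k₀ 1, ?_⟩
  intro ι _ _ A q x D hk hq hD hDk
  have hk1 : k₀ ≤ #A := (le_max_left _ _).trans hk
  have hk2 : (1 : ℝ) ≤ #A := (le_max_right _ _).trans hk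
  set k : ℝ := (#A : ℝ) with hkdef
  have hsk : 0 < √k := Real.sqrt_pos.2 (by linarith)
  have hMk : 0 < M ^ 2 * k := by positivity
  set q' : ι → ℝ := fun i => if i ∈ A then 2 * q i - 1 / 2 else 1 / 2 with hq'
  have hmix : ∀ i ∈ A, q i = (1 / 2 + q' i) / 2 := fun i hi => by simp [hq', hi]
  set W : (ι → Bool) → ℤ := fun y => ∑ u ∈ A, sg (y u) with hW
  set r : (ι → Bool) → ι → ℝ := fun z i => if z i then 1 / 2 else q' i with hr
  have hrprob : ∀ z, IsProb (r z) := by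
    intro z i
    simp only [hr, hq']
    split_ifs with h1 h2
    · norm_num
    · have := hq i h2
      constructor <;> linarith
    · norm_num
  set a : ℝ := c * D / √k with ha
  have ha0 : 0 ≤ a := by positivity
  -- Given which signs are fair, the fair ones smooth out the sum `R` of the others.
  have hz : ∀ z : ι → Bool,
      a * ((if k / 4 ≤ #{i ∈ A | z i} then 1 else 0)
        - avg (r z) A (fun y => ((W y : ℤ) : ℝ) ^ 2) x / (M ^ 2 * k))
      ≤ avg (r z) A (fun y => if |((W y : ℤ) : ℝ)| ≤ D then 1 else 0) x := by
    intro z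
    set I : Finset ι := {i ∈ A | z i} with hI
    have hIA : I ⊆ A := filter_subset _ _
    set R : (ι → Bool) → ℤ := fun y => ∑ u ∈ A \ I, sg (y u) with hR
    have hWR : ∀ y, W y = R y + ∑ u ∈ I, sg (y u) := fun y => (sum_sdiff hIA).symm
    have hRign : Ignores R I := by
      intro y y' hyy
      exact sum_congr rfl fun u hu => by rw [hyy u (mem_sdiff.1 hu).2]
    have hhalf : ∀ (f : (ι → Bool) → ℝ) y, avg (r z) I f y = avg (fun _ => 1 / 2) I f y := by
      intro f y
      exact avg_congr_prob fun i hi => by simp [hr, (mem_filter.1 hi).2]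
    have hsplit : ∀ f : (ι → Bool) → ℝ, avg (r z) A f x = avg (r z) A (avg (r z) I f) x :=
      fun f => (avg_avg_of_subset hIA).symm
    have hIcard : (#I : ℝ) ≤ k := by
      rw [hkdef]; exact_mod_cast card_le_card hIA
    have hsecond : ∀ y, (R y : ℝ) ^ 2 ≤ avg (r z) I (fun y => ((W y : ℤ) : ℝ) ^ 2) y := by
      intro y
      have h1 : avg (r z) I (fun y => ((W y : ℤ) : ℝ)) y = R y := by
        have : (fun y => ((W y : ℤ) : ℝ)) = fun y => (R y : ℝ) + ∑ u ∈ I, (sg (y u) : ℝ) := by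
          ext y; rw [hWR]; push_cast; rfl
        rw [this, avg_add, avg_sum, hhalf, avg_of_ignores (fun y y' hy => by rw [hRign y y' hy]),
          sum_eq_zero, add_zero]
        intro u hu
        rw [hhalf, avg_sg_half hu]
      have h2 := sq_avg_le (S := I) (f := fun y => ((W y : ℤ) : ℝ)) (x := y) (hrprob z)
      rwa [h1] at h2
    by_cases hIk : k / 4 ≤ #I
    · rw [if_pos hIk]
      have hinner : ∀ y, a * (1 - (R y : ℝ) ^ 2 / (M ^ 2 * k))
          ≤ avg (r z) I (fun y => if |((W y : ℤ) : ℝ)| ≤ D then 1 else 0) y := by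
        intro y
        by_cases hRy : |(R y : ℝ)| ≤ M * √k
        · have h1 := h I y k D (R y) hk1 hIk hIcard hD hDk hRy
          have h2 : avg (r z) I (fun y => if |((W y : ℤ) : ℝ)| ≤ D then 1 else 0) y
              = avg (fun _ => 1 / 2) I
                (fun y' => if |((R y + ∑ u ∈ I, sg (y' u) : ℤ) : ℝ)| ≤ D then 1 else 0) y := by
            rw [hhalf]
            refine avg_congr fun y' hy' => ?_
            rw [hWR, hRign y' y hy']
          rw [h2]
          refine le_trans ?_ h1
          have : 0 ≤ (R y : ℝ) ^ 2 / (M ^ 2 * k) := by positivity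
          nlinarith
        · have h1 : 1 ≤ (R y : ℝ) ^ 2 / (M ^ 2 * k) := by
            rw [le_div_iff₀ hMk, one_mul, ← sq_abs (R y : ℝ)]
            have h2 : M * √k ≤ |(R y : ℝ)| := (not_le.1 hRy).le
            have h3 := pow_le_pow_left₀ (by positivity) h2 2
            rwa [mul_pow, Real.sq_sqrt (by linarith)] at h3
          have h2 := avg_indicator_nonneg (S := I) (x := y) (hrprob z)
            (fun y => |((W y : ℤ) : ℝ)| ≤ D)
          nlinarith
      rw [hsplit, hsplit (fun y => if |((W y : ℤ) : ℝ)| ≤ D then 1 else 0)]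
      refine le_trans ?_ (avg_mono (hrprob z) fun y _ => hinner y)
      rw [avg_const_mul, avg_sub, avg_const]
      refine mul_le_mul_of_nonneg_left ?_ ha0
      have : (fun y => (R y : ℝ) ^ 2 / (M ^ 2 * k)) = fun y => (M ^ 2 * k)⁻¹ * (R y : ℝ) ^ 2 := by
        ext y; ring
      rw [this, avg_const_mul, div_eq_inv_mul]
      have h1 := avg_mono (S := A) (x := x) (hrprob z) fun y _ => hsecond y
      have h2 := mul_le_mul_of_nonneg_left h1 (inv_nonneg.2 hMk.le)
      linarith
    · rw [if_neg hIk]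
      have h1 : 0 ≤ avg (r z) A (fun y => ((W y : ℤ) : ℝ) ^ 2) x / (M ^ 2 * k) :=
        div_nonneg (const_le_avg (hrprob z) fun y => sq_nonneg _) hMk.le
      have h2 := avg_indicator_nonneg (S := A) (x := x) (hrprob z)
        (fun y => |((W y : ℤ) : ℝ)| ≤ D)
      nlinarith
  -- At least a quarter of the signs are fair with probability at least `1 / 4`.
  have hfair : (1 / 4 : ℝ) ≤ avg (fun _ => 1 / 2) A
      (fun z => if k / 4 ≤ #{i ∈ A | z i} then 1 else 0) x := by
    have h1 : avg (fun _ => 1 / 2) A (fun z => ∑ i ∈ A, if z i then (1 : ℝ) else 0) x = k / 2 := by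
      rw [avg_sum, sum_congr rfl fun i hi => avg_bit hi]
      simp [hkdef]; ring
    have h2 : avg (fun _ => 1 / 2) A (fun z => ∑ i ∈ A, if z i then (1 : ℝ) else 0) x
        ≤ avg (fun _ => 1 / 2) A
          (fun z => k * (if k / 4 ≤ #{i ∈ A | z i} then 1 else 0) + k / 4) x := by
      refine avg_mono isProb_half fun z _ => ?_
      have h3 : (∑ i ∈ A, if z i then (1 : ℝ) else 0) = #{i ∈ A | z i} := by simp
      rw [h3]
      split_ifs with h4
      · have : (#{i ∈ A | z i} : ℝ) ≤ k := by
          rw [hkdef]; exact_mod_cast card_le_card (filter_subset _ _)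
        linarith
      · linarith
    rw [h1, avg_add, avg_const_mul, avg_const] at h2
    nlinarith
  rw [avg_eq_avg_mixture hmix _ x, avg_eq_avg_mixture hmix _ x]
  refine le_trans ?_ (avg_mono isProb_half fun z _ => hz z)
  rw [avg_const_mul, avg_sub]
  refine mul_le_mul_of_nonneg_left ?_ ha0
  have : (fun z => avg (r z) A (fun y => ((W y : ℤ) : ℝ) ^ 2) x / (M ^ 2 * k))
      = fun z => (M ^ 2 * k)⁻¹ * avg (r z) A (fun y => ((W y : ℤ) : ℝ) ^ 2) x := by
    ext y; ring
  rw [this, avg_const_mul, ← div_eq_inv_mul]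
  exact sub_le_sub_right hfair _

end SmallBall

/-! ### Majority dynamics in terms of edge bits -/

section Bits

variable {V : Type} [Fintype V] [DecidableEq V] {ℓ : Coloring V} {x y : Sym2 V → Bool}

/-- The neighbours of `v` in the graph whose edges are the `true` bits of `x`. The bits on the
diagonal of `Sym2 V` play no role. -/
def nbr (x : Sym2 V → Bool) (v : V) : Finset V := {u | u ≠ v ∧ x s(v, u) = true}

/-- The sum of the day `0` colors of the neighbours of `u` that lie in `Y`. -/
def colorSum (ℓ : Coloring V) (x : Sym2 V → Bool) (u : V) (Y : Finset V) : ℤ :=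
  ∑ y ∈ Y, if y ∈ nbr x u then (ℓ y : ℤ) else 0

/-- The least value of the neighbour sum at which `u` is Red on day `1`: a tie keeps the color. -/
def redThreshold (ℓ : Coloring V) (u : V) : ℤ := if ℓ u = 1 then 0 else 1

/-- Whether `u` is Red on day `1`. -/
def redNext (ℓ : Coloring V) (x : Sym2 V → Bool) (u : V) : Bool :=
  decide (redThreshold ℓ u ≤ colorSum ℓ x u univ)

/-- The sum of the day `1` colors of the neighbours of `v`. -/
def nextSum (ℓ : Coloring V) (x : Sym2 V → Bool) (v : V) : ℤ :=
  ∑ u ∈ nbr x v, sg (redNext ℓ x u)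

/-- The potential edges between `u` and `O`. -/
def spokes (u : V) (O : Finset V) : Finset (Sym2 V) := O.image fun o => s(u, o)

/-- The potential edges between `A` and `O`. -/
def cut (A O : Finset V) : Finset (Sym2 V) := A.biUnion fun u => spokes u O

lemma mem_nbr {u v : V} : u ∈ nbr x v ↔ u ≠ v ∧ x s(v, u) = true := by simp [nbr]

lemma mem_nbr_comm {u v : V} : u ∈ nbr x v ↔ v ∈ nbr x u := by
  rw [mem_nbr, mem_nbr, Sym2.eq_swap, ne_comm]

lemma mem_spokes {u : V} {O : Finset V} {e : Sym2 V} : e ∈ spokes u O ↔ ∃ o ∈ O, s(u, o) = e := by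
  simp [spokes]

lemma mem_cut {A O : Finset V} {e : Sym2 V} : e ∈ cut A O ↔ ∃ u ∈ A, ∃ o ∈ O, s(u, o) = e := by
  simp [cut, mem_spokes]

lemma abs_color (u : V) : |((ℓ u : ℤ) : ℝ)| = 1 := by
  rcases Int.units_eq_one_or (ℓ u) with h | h <;> simp [h]

lemma color_eq (u : V) : (ℓ u : ℤ) = 1 ∨ (ℓ u : ℤ) = -1 := by
  rcases Int.units_eq_one_or (ℓ u) with h | h <;> simp [h]

lemma redThreshold_mem (u : V) : redThreshold ℓ u = 0 ∨ redThreshold ℓ u = 1 := by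
  unfold redThreshold; split_ifs <;> simp

lemma nbr_congr {u : V} (h : ∀ w, w ≠ u → x s(u, w) = y s(u, w)) : nbr x u = nbr y u := by
  ext w
  rw [mem_nbr, mem_nbr]
  refine and_congr_right fun hw => ?_
  rw [h w hw]

lemma colorSum_congr {u : V} {Y : Finset V} (h : ∀ w ∈ Y, w ≠ u → x s(u, w) = y s(u, w)) :
    colorSum ℓ x u Y = colorSum ℓ y u Y := by
  refine sum_congr rfl fun w hw => ?_
  have : w ∈ nbr x u ↔ w ∈ nbr y u := by
    rw [mem_nbr, mem_nbr]
    refine and_congr_right fun hwu => ?_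
    rw [h w hw hwu]
  simp only [this]

lemma redNext_congr {u : V} (h : ∀ w, w ≠ u → x s(u, w) = y s(u, w)) :
    redNext ℓ x u = redNext ℓ y u := by
  rw [redNext, redNext, colorSum_congr fun w _ => h w]

lemma colorSum_union {u : V} {Y Y' : Finset V} (h : Disjoint Y Y') :
    colorSum ℓ x u (Y ∪ Y') = colorSum ℓ x u Y + colorSum ℓ x u Y' := sum_union h

lemma colorSum_compl (u : V) (O : Finset V) :
    colorSum ℓ x u univ = colorSum ℓ x u O + colorSum ℓ x u Oᶜ :=
  (sum_add_sum_compl O _).symm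

lemma abs_colorSum_le (u : V) (Y : Finset V) :
    |(colorSum ℓ x u Y : ℝ)| ≤ #(Y ∩ nbr x u) := by
  unfold colorSum
  push_cast
  refine (abs_sum_le_sum_abs _ _).trans ?_
  rw [← filter_mem_eq_inter, card_filter]
  push_cast
  refine sum_le_sum fun w _ => ?_
  split_ifs
  · exact (abs_color w).le
  · simp

lemma ignores_redNext {u u' : V} {O : Finset V} (hu : u ≠ u') (huO : u ∉ O) :
    Ignores (fun x => redNext ℓ x u) (spokes u' O) := by
  intro x y h
  refine redNext_congr fun w _ => h _ fun hmem => ?_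
  obtain ⟨o, ho, he⟩ := mem_spokes.1 hmem
  rw [Sym2.eq_iff] at he
  rcases he with ⟨h1, -⟩ | ⟨-, h2⟩
  · exact hu h1.symm
  · exact huO (h2 ▸ ho)

end Bits

/-! ### Resampling the edges to a balanced set of vertices -/

section FreshVertices

variable {V : Type} [Fintype V] [DecidableEq V] {ℓ : Coloring V} {x y : Sym2 V → Bool}
  {O : Finset V} {p s : ℝ}

/-- The sum of the colors of a random subset of `O`, which contains each vertex with probability
`p`, is at least `t` with this probability. -/
def colorTail (p : ℝ) (ℓ : Coloring V) (O : Finset V) (t : ℤ) : ℝ :=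
  avg (fun _ : V => p) O (fun y => if t ≤ ∑ o ∈ O, if y o then (ℓ o : ℤ) else 0 then 1 else 0)
    (fun _ => false)

lemma colorTail_mem (hp : 0 ≤ p) (hp1 : p ≤ 1) (t : ℤ) :
    0 ≤ colorTail p ℓ O t ∧ colorTail p ℓ O t ≤ 1 :=
  ⟨avg_indicator_nonneg (fun _ => ⟨hp, hp1⟩) _,
    avg_le_const (fun _ => ⟨hp, hp1⟩) fun y => by split_ifs <;> norm_num⟩

/-- If the edges from `u` to `O` are resampled, then the probability that `u` is Red on day `1` only
depends on the color sum of its neighbours outside `O`. -/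
lemma avg_redNext {u : V} (hu : u ∉ O) (x : Sym2 V → Bool) :
    avg (fun _ => p) (spokes u O) (fun y => if redNext ℓ y u then 1 else 0) x
      = colorTail p ℓ O (redThreshold ℓ u - colorSum ℓ x u Oᶜ) := by
  set t := redThreshold ℓ u - colorSum ℓ x u Oᶜ with ht
  have hinj : Set.InjOn (fun o => s(u, o)) (O : Set V) := by
    intro a _ b _ hab
    exact Sym2.congr_right.1 hab
  have hf : Ignores (fun y : V → Bool =>
      if t ≤ ∑ o ∈ O, if y o then (ℓ o : ℤ) else 0 then (1 : ℝ) else 0) Oᶜ := by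
    intro y z hyz
    have : (∑ o ∈ O, if y o then (ℓ o : ℤ) else 0) = ∑ o ∈ O, if z o then (ℓ o : ℤ) else 0 :=
      sum_congr rfl fun o ho => by rw [hyz o (by simpa using ho)]
    simp only [this]
  have h := avg_image hinj (fun _ => p) hf Subset.rfl x (fun o => x s(u, o)) fun _ _ => rfl
  rw [spokes, colorTail]
  rw [← avg_congr (f := fun y : Sym2 V → Bool =>
    if t ≤ ∑ o ∈ O, if y s(u, o) then (ℓ o : ℤ) else 0 then (1 : ℝ) else 0)]
  · rw [h]
    rw [avg, avg]
    refine sum_congr rfl fun z _ => ?_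
    congr 1
    refine hf _ _ fun i hi => ?_
    have hi : i ∈ O := by simpa using hi
    simp [hi]
  · intro y hy
    have h1 : colorSum ℓ y u Oᶜ = colorSum ℓ x u Oᶜ := by
      refine colorSum_congr fun w hw _ => hy _ fun hmem => ?_
      obtain ⟨o, ho, he⟩ := mem_image.1 hmem
      exact (mem_compl.1 hw) (Sym2.congr_right.1 he ▸ ho)
    have h2 : colorSum ℓ y u O = ∑ o ∈ O, if y s(u, o) then (ℓ o : ℤ) else 0 := by
      refine sum_congr rfl fun o ho => ?_
      have : o ≠ u := fun h => hu (h ▸ ho)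
      simp [mem_nbr, this]
    have h3 : redNext ℓ y u = true ↔ t ≤ ∑ o ∈ O, if y s(u, o) then (ℓ o : ℤ) else 0 := by
      rw [redNext, decide_eq_true_iff, colorSum_compl u O, h1, h2, ht]
      omega
    simp only [h3]

lemma colorTail_conc (hs : 0 < s) (hsO : s ^ 2 / 4 ≤ #O * (p * (1 - p))) (t : ℤ) :
    avg (fun _ : V => p) O
      (fun y => if (∑ o ∈ O, if y o then (ℓ o : ℤ) else 0) = t then 1 else 0) (fun _ => false)
      ≤ 2 / s := by
  have h := avg_signed_sum_eq_le (q := fun _ : V => p) (S := O) (x := fun _ => false)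
    (fun o => (ℓ o : ℤ)) (fun o => color_eq o) (v := s ^ 2 / 4) (by positivity) (by simpa using hsO) t
  refine h.trans (le_of_eq ?_)
  rw [Real.sqrt_div (by positivity), Real.sqrt_sq hs.le, show (4 : ℝ) = 2 ^ 2 by norm_num,
    Real.sqrt_sq (by norm_num)]
  field_simp

lemma abs_colorTail_sub_le (hp : 0 ≤ p) (hp1 : p ≤ 1) (hs : 0 < s)
    (hsO : s ^ 2 / 4 ≤ #O * (p * (1 - p))) (t t' : ℤ) :
    |colorTail p ℓ O t - colorTail p ℓ O t'| ≤ 2 * |(t : ℝ) - t'| / s := by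
  have hc := colorTail_conc (ℓ := ℓ) hs hsO
  have hq : IsProb (fun _ : V => p) := fun _ => ⟨hp, hp1⟩
  rcases le_total t t' with h | h
  · have h1 := avg_indicator_le_sub hq _ hc h
    have h2 : (t : ℝ) ≤ t' := by exact_mod_cast h
    rw [abs_sub_comm (t : ℝ), abs_of_nonneg (by linarith : (0 : ℝ) ≤ t' - t)]
    refine h1.trans (le_of_eq ?_); ring
  · have h1 := avg_indicator_le_sub hq _ hc h
    have h2 : (t' : ℝ) ≤ t := by exact_mod_cast h
    rw [abs_sub_comm, abs_of_nonneg (by linarith : (0 : ℝ) ≤ t - t')]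
    refine h1.trans (le_of_eq ?_); ring

/-- A set with equally many Red and Blue vertices can be mapped to itself exchanging the colors. -/
lemma exists_color_swap (hO : ∑ o ∈ O, (ℓ o : ℤ) = 0) :
    ∃ φ : V → V, Set.InjOn φ O ∧ O.image φ = O ∧ ∀ o ∈ O, (ℓ (φ o) : ℤ) = -(ℓ o : ℤ) := by
  set P : Finset V := {o ∈ O | ℓ o = 1} with hP
  set N : Finset V := {o ∈ O | ¬ ℓ o = 1} with hN
  have hcard : #P = #N := by
    rw [← sum_filter_add_sum_filter_not O (fun o => ℓ o = 1)] at hO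
    have h1 : ∑ o ∈ P, (ℓ o : ℤ) = #P := by
      rw [sum_congr rfl fun o ho => by rw [(mem_filter.1 ho).2]]; simp
    have h2 : ∑ o ∈ N, (ℓ o : ℤ) = -#N := by
      rw [sum_congr rfl fun o ho => by
        rw [(Int.units_eq_one_or (ℓ o)).resolve_left (mem_filter.1 ho).2]]
      simp
    rw [← hP, ← hN, h1, h2] at hO
    omega
  set e : P ≃ N := Finset.equivOfCardEq hcard with he
  set φ : V → V := fun u => if h : u ∈ P then (e ⟨u, h⟩ : V) else
    if h : u ∈ N then (e.symm ⟨u, h⟩ : V) else u with hφ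
  have hφP : ∀ u (h : u ∈ P), φ u = e ⟨u, h⟩ := fun u h => by simp [hφ, h]
  have hdisj : ∀ u, u ∈ N → u ∉ P := fun u h h' => (mem_filter.1 h).2 (mem_filter.1 h').2
  have hφN : ∀ u (h : u ∈ N), φ u = e.symm ⟨u, h⟩ := fun u h => by simp [hφ, h, hdisj u h]
  have hcases : ∀ u ∈ O, u ∈ P ∨ u ∈ N := fun u hu => by
    by_cases h : ℓ u = 1
    · exact Or.inl (mem_filter.2 ⟨hu, h⟩)
    · exact Or.inr (mem_filter.2 ⟨hu, h⟩)
  have hinv : ∀ u ∈ O, φ (φ u) = u := by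
    intro u hu
    rcases hcases u hu with h | h
    · rw [hφP u h, hφN _ (e ⟨u, h⟩).2]; simp
    · rw [hφN u h, hφP _ (e.symm ⟨u, h⟩).2]; simp
  have hmaps : ∀ u ∈ O, φ u ∈ O := by
    intro u hu
    rcases hcases u hu with h | h
    · rw [hφP u h]; exact (mem_filter.1 (e ⟨u, h⟩).2).1
    · rw [hφN u h]; exact (mem_filter.1 (e.symm ⟨u, h⟩).2).1
  refine ⟨φ, ?_, ?_, ?_⟩
  · intro a ha b hb hab
    rw [← hinv a ha, ← hinv b hb, hab]
  · ext u
    rw [mem_image]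
    constructor
    · rintro ⟨a, ha, rfl⟩; exact hmaps a ha
    · intro hu; exact ⟨φ u, hmaps u hu, hinv u hu⟩
  · intro o ho
    have hP1 : ∀ u ∈ P, ℓ u = 1 := fun u hu => (mem_filter.1 hu).2
    have hN1 : ∀ u ∈ N, ℓ u = -1 := fun u hu =>
      (Int.units_eq_one_or (ℓ u)).resolve_left (mem_filter.1 hu).2
    rcases hcases o ho with h | h
    · rw [hφP o h, hP1 o h, hN1 _ (e ⟨o, h⟩).2]; simp
    · rw [hφN o h, hN1 o h, hP1 _ (e.symm ⟨o, h⟩).2]; simp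

/-- For a balanced set the color sum of a random subset is symmetric, hence nearly unbiased. -/
lemma abs_two_mul_colorTail_sub_one_le (hp : 0 ≤ p) (hp1 : p ≤ 1) (hs : 0 < s)
    (hsO : s ^ 2 / 4 ≤ #O * (p * (1 - p))) (hO : ∑ o ∈ O, (ℓ o : ℤ) = 0) (t : ℤ) :
    |2 * colorTail p ℓ O t - 1| ≤ 2 * (2 * |(t : ℝ)| + 1) / s := by
  obtain ⟨φ, hinj, himg, hneg⟩ := exists_color_swap hO
  have hf : Ignores (fun y : V → Bool =>
      if t ≤ ∑ o ∈ O, if y o then (ℓ o : ℤ) else 0 then (1 : ℝ) else 0) Oᶜ := by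
    intro y z hyz
    have : (∑ o ∈ O, if y o then (ℓ o : ℤ) else 0) = ∑ o ∈ O, if z o then (ℓ o : ℤ) else 0 :=
      sum_congr rfl fun o ho => by rw [hyz o (by simpa using ho)]
    simp only [this]
  have h := avg_image hinj (fun _ => p) hf Subset.rfl (fun _ => false) (fun _ => false)
    fun _ _ => rfl
  rw [himg] at h
  have hN : ∀ y : V → Bool, (∑ o ∈ O, if y (φ o) then (ℓ o : ℤ) else 0)
      = -∑ o ∈ O, if y o then (ℓ o : ℤ) else 0 := by
    intro y
    conv_rhs => rw [← himg, sum_image hinj]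
    rw [← sum_neg_distrib]
    refine sum_congr rfl fun o ho => ?_
    rw [hneg o ho]
    split_ifs <;> simp
  have h2 : colorTail p ℓ O t = 1 - colorTail p ℓ O (1 - t) := by
    rw [colorTail, ← h, colorTail]
    rw [eq_sub_iff_add_eq, ← avg_add]
    rw [avg_congr (g := fun _ => 1), avg_const]
    intro y _
    rw [hN]
    split_ifs <;> first | omega | norm_num
  have h3 := abs_colorTail_sub_le (ℓ := ℓ) hp hp1 hs hsO t (1 - t)
  have h4 : 2 * colorTail p ℓ O t - 1 = colorTail p ℓ O t - colorTail p ℓ O (1 - t) := by linarith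
  rw [h4]
  refine h3.trans ?_
  refine div_le_div_of_nonneg_right ?_ hs.le
  refine mul_le_mul_of_nonneg_left ?_ (by norm_num)
  push_cast
  calc |(t : ℝ) - (1 - t)| = |2 * (t : ℝ) - 1| := by ring_nf
    _ ≤ |2 * (t : ℝ)| + |1| := abs_sub _ _
    _ = _ := by rw [abs_mul]; norm_num

/-- The conditional probability that `u` is Red on day `1`, given that the neighbours of `u` outside
the fresh set `O` have color sum `z u`. -/
def redProb (p : ℝ) (ℓ : Coloring V) (O : Finset V) (z : V → ℤ) (u : V) : ℝ :=
  colorTail p ℓ O (redThreshold ℓ u - z u)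

lemma isProb_redProb (hp : 0 ≤ p) (hp1 : p ≤ 1) (z : V → ℤ) : IsProb (redProb p ℓ O z) :=
  fun _ => colorTail_mem hp hp1 _

lemma redProb_mem (hp : 0 ≤ p) (hp1 : p ≤ 1) (hs : 200 ≤ s)
    (hsO : s ^ 2 / 4 ≤ #O * (p * (1 - p))) (hO : ∑ o ∈ O, (ℓ o : ℤ) = 0) {z : V → ℤ} {u : V}
    (hz : |(z u : ℝ)| ≤ s / 10 + 1) :
    1 / 4 ≤ redProb p ℓ O z u ∧ redProb p ℓ O z u ≤ 3 / 4 := by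
  have h := abs_two_mul_colorTail_sub_one_le (ℓ := ℓ) hp hp1 (by linarith) hsO hO
    (redThreshold ℓ u - z u)
  have h1 : |((redThreshold ℓ u - z u : ℤ) : ℝ)| ≤ s / 10 + 2 := by
    push_cast
    rw [abs_le] at hz ⊢
    rcases redThreshold_mem (ℓ := ℓ) u with h0 | h0 <;> rw [h0] <;> push_cast <;>
      constructor <;> linarith
  have h2 : 2 * (2 * |((redThreshold ℓ u - z u : ℤ) : ℝ)| + 1) / s ≤ 1 / 2 := by
    rw [div_le_iff₀ (by linarith)]; linarith
  have h3 := abs_le.1 (h.trans h2)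
  unfold redProb
  constructor <;> linarith [h3.1, h3.2]

lemma abs_redProb_sub_le (hp : 0 ≤ p) (hp1 : p ≤ 1) (hs : 0 < s)
    (hsO : s ^ 2 / 4 ≤ #O * (p * (1 - p))) (z z' : V → ℤ) (u : V) :
    |redProb p ℓ O z u - redProb p ℓ O z' u| ≤ 2 * |(z u : ℝ) - z' u| / s := by
  have h := abs_colorTail_sub_le (ℓ := ℓ) hp hp1 hs hsO (redThreshold ℓ u - z u)
    (redThreshold ℓ u - z' u)
  refine h.trans (le_of_eq ?_)
  push_cast
  rw [show ((redThreshold ℓ u : ℝ) - z u - (redThreshold ℓ u - z' u)) = -((z u : ℝ) - z' u) by ring,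
    abs_neg]

/-- The tail of the sum of the day `1` colors over `A` is Lipschitz in the color sums outside the
fresh set and in the threshold. -/
lemma abs_tail_redProb_sub_le (hp : 0 ≤ p) (hp1 : p ≤ 1) (hs : 200 ≤ s)
    (hsO : s ^ 2 / 4 ≤ #O * (p * (1 - p))) (hO : ∑ o ∈ O, (ℓ o : ℤ) = 0) {A : Finset V}
    (hA : s ^ 2 / 4 ≤ #A) {z z' : V → ℤ} (hz : ∀ u ∈ A, |(z u : ℝ)| ≤ s / 10 + 1)
    (hz' : ∀ u ∈ A, |(z' u : ℝ)| ≤ s / 10 + 1) (τ τ' : ℤ) :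
    |tail (redProb p ℓ O z) A τ - tail (redProb p ℓ O z') A τ'|
      ≤ 32 / s ^ 2 * ∑ u ∈ A, |(z u : ℝ) - z' u| + 8 / s * |(τ : ℝ) - τ'| := by
  have hs0 : 0 < s := by linarith
  have hA2 : (2 : ℝ) ≤ #A := by nlinarith
  have h := abs_tail_sub_le (isProb_redProb (O := O) hp hp1 z) (isProb_redProb (ℓ := ℓ) hp hp1 z')
    (by exact_mod_cast hA2) (fun u hu => redProb_mem hp hp1 hs hsO hO (hz u hu))
    (fun u hu => redProb_mem hp hp1 hs hsO hO (hz' u hu)) τ τ'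
  have hsqrt : s / 2 ≤ √(#A : ℝ) := by
    apply Real.le_sqrt_of_sq_le
    rw [div_pow]; norm_num; exact hA
  have hsum : ∑ u ∈ A, |redProb p ℓ O z u - redProb p ℓ O z' u|
      ≤ ∑ u ∈ A, 2 * |(z u : ℝ) - z' u| / s :=
    sum_le_sum fun u _ => abs_redProb_sub_le hp hp1 hs0 hsO z z' u
  have hnn : 0 ≤ 8 * ∑ u ∈ A, |redProb p ℓ O z u - redProb p ℓ O z' u| + 4 * |(τ : ℝ) - τ'| := by
    have := sum_nonneg fun u (_ : u ∈ A) => abs_nonneg (redProb p ℓ O z u - redProb p ℓ O z' u)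
    positivity
  refine h.trans ((div_le_div_of_nonneg_left hnn (by linarith) hsqrt).trans ?_)
  rw [← sum_div, ← mul_sum] at hsum
  have e : 32 / s ^ 2 * ∑ u ∈ A, |(z u : ℝ) - z' u| + 8 / s * |(τ : ℝ) - τ'|
      = (8 * (2 * (∑ u ∈ A, |(z u : ℝ) - z' u|) / s) + 4 * |(τ : ℝ) - τ'|) / (s / 2) := by
    field_simp
    ring
  rw [e]
  refine div_le_div_of_nonneg_right ?_ (by linarith)
  linarith

/-- If the edges between `A` and the fresh set `O` are resampled, then the day `1` colors on `A` are
independent. -/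
lemma avg_cut {A : Finset V} (hA : Disjoint A O) (H : (V → Bool) → ℝ)
    (hH : Ignores H Aᶜ) (x : Sym2 V → Bool) :
    avg (fun _ => p) (cut A O) (fun y => H (fun u => redNext ℓ y u)) x
      = avg (redProb p ℓ O fun u => colorSum ℓ x u Oᶜ) A H (fun _ => false) := by
  have h := avg_blocks (q := fun _ : Sym2 V => p) (fun u => spokes u O) (fun u y => redNext ℓ y u) A
    (fun u hu u' _ huu => ignores_redNext huu (disjoint_left.1 hA hu)) H (fun _ => false) x
  have h1 : ∀ y : Sym2 V → Bool, H (fun u => redNext ℓ y u)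
      = H (fun u => if u ∈ A then redNext ℓ y u else false) := by
    intro y
    refine hH _ _ fun u hu => ?_
    have : u ∈ A := by simpa using hu
    simp [this]
  rw [avg_congr fun y _ => h1 y]
  rw [cut, h]
  refine avg_congr_prob fun u hu => ?_
  exact avg_redNext (disjoint_left.1 hA hu) x

lemma avg_cut_tail {A : Finset V} (hA : Disjoint A O) (τ : ℤ) (x : Sym2 V → Bool) :
    avg (fun _ => p) (cut A O)
        (fun y => if τ ≤ ∑ u ∈ A, sg (redNext ℓ y u) then 1 else 0) x
      = tail (redProb p ℓ O fun u => colorSum ℓ x u Oᶜ) A τ := by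
  refine avg_cut hA (fun b => if τ ≤ ∑ u ∈ A, sg (b u) then 1 else 0) ?_ x
  intro b b' hb
  have : ∑ u ∈ A, sg (b u) = ∑ u ∈ A, sg (b' u) :=
    sum_congr rfl fun u hu => by rw [hb u (by simpa using hu)]
  simp only [this]

/-- If the two colors are almost equally frequent, then every set of vertices avoids a balanced set
that misses few vertices. -/
lemma exists_balanced (hR : (red ℓ).ncard = ⌈(Fintype.card V : ℝ) / 2⌉₊) (W : Finset V) :
    ∃ O : Finset V, Disjoint W O ∧ ∑ o ∈ O, (ℓ o : ℤ) = 0 ∧ #Oᶜ ≤ 2 * #W + 1 := by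
  set n := Fintype.card V with hn
  set Rd : Finset V := {u | ℓ u = 1} with hRd
  set Bl : Finset V := {u | ¬ ℓ u = 1} with hBl
  have hRc : #Rd = ⌈(n : ℝ) / 2⌉₊ := by
    rw [← hR, ← Set.ncard_coe_finset]
    congr 1
    ext u; simp [hRd, red]
  have hsum : #Rd + #Bl = n := by
    rw [hRd, hBl, card_filter_add_card_filter_not]; simp [hn]
  have hceil : n ≤ 2 * #Rd ∧ 2 * #Rd ≤ n + 1 := by
    have h1 : (n : ℝ) / 2 ≤ ⌈(n : ℝ) / 2⌉₊ := Nat.le_ceil _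
    have h2 : (⌈(n : ℝ) / 2⌉₊ : ℝ) < (n : ℝ) / 2 + 1 := Nat.ceil_lt_add_one (by positivity)
    rw [← hRc] at h1 h2
    constructor
    · have : (n : ℝ) ≤ 2 * #Rd := by linarith
      exact_mod_cast this
    · have : (2 * #Rd : ℝ) < n + 2 := by linarith
      have : 2 * #Rd < n + 2 := by exact_mod_cast this
      omega
  set k := #Bl - #W with hk
  have h1 : k ≤ #(Rd \ W) := by
    have := le_card_sdiff W Rd
    omega
  have h2 : k ≤ #(Bl \ W) := by
    have := le_card_sdiff W Bl
    omega
  obtain ⟨R', hR', hR'c⟩ := exists_subset_card_eq h1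
  obtain ⟨B', hB', hB'c⟩ := exists_subset_card_eq h2
  have hR1 : ∀ u ∈ R', ℓ u = 1 := fun u hu => (mem_filter.1 (mem_sdiff.1 (hR' hu)).1).2
  have hB1 : ∀ u ∈ B', ℓ u = -1 := fun u hu =>
    (Int.units_eq_one_or (ℓ u)).resolve_left (mem_filter.1 (mem_sdiff.1 (hB' hu)).1).2
  have hdisj : Disjoint R' B' := by
    rw [disjoint_left]
    intro u hu hu'
    have := (hR1 u hu).symm.trans (hB1 u hu')
    exact absurd this (by decide)
  refine ⟨R' ∪ B', ?_, ?_, ?_⟩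
  · rw [disjoint_union_right]
    exact ⟨(disjoint_sdiff.mono_right hR'), (disjoint_sdiff.mono_right hB')⟩
  · rw [sum_union hdisj, sum_congr rfl fun u hu => by rw [hR1 u hu],
      sum_congr (s₁ := B') rfl fun u hu => by rw [hB1 u hu]]
    simp [hR'c, hB'c]
  · rw [card_compl, card_union_of_disjoint hdisj, ← hn]
    omega

end FreshVertices

/-! ### The range of parameters, and degrees into small sets -/

section Regime

variable {V : Type} [Fintype V] [DecidableEq V] {ℓ : Coloring V} {x y : Sym2 V → Bool}
  {O A K W : Finset V} {p s L : ℝ}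

/-- The range of parameters: `s = √(p n)` is at least a large multiple of `L ≥ log n`, while `p² n` is
at most `√L`. -/
structure Regime (V : Type) [Fintype V] (p s L : ℝ) : Prop where
  p_pos : 0 < p
  p_le : p ≤ 1 / 1000
  sq_s : s ^ 2 = p * Fintype.card V
  one_le : 1 ≤ L
  le_s : 1000 * L ≤ s
  codeg : (p * s ^ 2) ^ 2 ≤ L
  card_le : (Fintype.card V : ℝ) ≤ Real.exp L

namespace Regime

variable (h : Regime V p s L)
include h

lemma s_ge : 1000 ≤ s := by linarith [h.le_s, h.one_le]

lemma isProb {κ : Type*} : IsProb (fun _ : κ => p) :=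
  fun _ => ⟨h.p_pos.le, by linarith [h.p_le]⟩

lemma codeg_le : p * s ^ 2 ≤ L := by
  have h1 := h.codeg
  have h2 := h.one_le
  have h3 : 0 ≤ p * s ^ 2 := by have := h.p_pos; positivity
  nlinarith

lemma sq_le_card : 1000 * s ^ 2 ≤ Fintype.card V := by
  rw [h.sq_s]
  have := h.p_le
  have h1 : (0 : ℝ) ≤ Fintype.card V := Nat.cast_nonneg _
  nlinarith

lemma exp_mul_pow_le : Real.exp (-(60 * L)) * s ^ 8 ≤ 1 := by
  have h1 : s ^ 2 ≤ Real.exp L := by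
    have := h.sq_le_card
    have := h.card_le
    nlinarith [sq_nonneg s]
  have h2 : s ^ 8 ≤ Real.exp (4 * L) := by
    have : s ^ 8 = (s ^ 2) ^ 4 := by ring
    rw [this, show (4 * L : ℝ) = (4 : ℕ) * L by norm_num, Real.exp_nat_mul]
    exact pow_le_pow_left₀ (sq_nonneg s) h1 4
  calc Real.exp (-(60 * L)) * s ^ 8 ≤ Real.exp (-(60 * L)) * Real.exp (4 * L) :=
        mul_le_mul_of_nonneg_left h2 (Real.exp_pos _).le
    _ = Real.exp (-(56 * L)) := by rw [← Real.exp_add]; ring_nf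
    _ ≤ 1 := Real.exp_le_one_iff.2 (by linarith [h.one_le])

lemma variance_le (hO : (#Oᶜ : ℝ) ≤ 9 * s ^ 2) : s ^ 2 / 4 ≤ #O * (p * (1 - p)) := by
  have h1 : (#O : ℝ) + #Oᶜ = Fintype.card V := by
    exact_mod_cast card_add_card_compl O
  have h2 := h.sq_le_card
  have h3 := h.p_pos
  have h4 := h.p_le
  have h5 : (Fintype.card V : ℝ) / 2 ≤ #O := by nlinarith [sq_nonneg s]
  rw [h.sq_s]
  have h6 : p / 2 ≤ p * (1 - p) := by nlinarith
  calc p * Fintype.card V / 4 = (Fintype.card V : ℝ) / 2 * (p / 2) := by ring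
    _ ≤ _ := mul_le_mul h5 h6 (by positivity) (Nat.cast_nonneg _)

end Regime

/-- The potential edges that avoid `W`. -/
def away (W : Finset V) : Finset (Sym2 V) := {e | ∀ u ∈ W, u ∉ e}

lemma mem_away {e : Sym2 V} : e ∈ away W ↔ ∀ u ∈ W, u ∉ e := by simp [away]

lemma mk_mem_away {a b : V} : s(a, b) ∈ away W ↔ a ∉ W ∧ b ∉ W := by
  rw [mem_away]
  constructor
  · intro h
    exact ⟨fun ha => h a ha (Sym2.mem_mk_left a b), fun hb => h b hb (Sym2.mem_mk_right a b)⟩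
  · rintro ⟨ha, hb⟩ u hu hmem
    rcases Sym2.mem_iff.1 hmem with rfl | rfl
    exacts [ha hu, hb hu]

lemma cut_subset_away (hA : Disjoint A W) (hO : Disjoint O W) : cut A O ⊆ away W := by
  intro e he
  obtain ⟨u, hu, o, ho, rfl⟩ := mem_cut.1 he
  exact mk_mem_away.2 ⟨disjoint_left.1 hA hu, disjoint_left.1 hO ho⟩

/-- No vertex of `U` has more than `s / 10` neighbours in `Y`. -/
def FewNbrs (s : ℝ) (U Y : Finset V) (y : Sym2 V → Bool) : Prop :=
  ∀ u ∈ U, (#(Y ∩ nbr y u) : ℝ) ≤ s / 10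

open Classical in
/-- A set of order `p n` vertices contains few neighbours of each vertex, with overwhelming
probability. -/
lemma avg_not_fewNbrs_le (h : Regime V p s L) {U Y : Finset V} (hU : Disjoint U W) (hW : #W ≤ 2)
    (hY : (#Y : ℝ) ≤ 9 * s ^ 2) (x : Sym2 V → Bool) :
    avg (fun _ => p) (away W) (fun y => if FewNbrs s U Y y then 0 else 1) x
      ≤ Real.exp (-(60 * L)) := by
  set T : V → Finset (Sym2 V) := fun u => spokes u (Y \ W) with hT
  have h1 : ∀ y : Sym2 V → Bool, (if FewNbrs s U Y y then (0 : ℝ) else 1)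
      ≤ ∑ u ∈ U, if s / 10 - 2 ≤ ∑ e ∈ T u, (if y e then (1 : ℝ) else 0) then 1 else 0 := by
    intro y
    split_ifs with hy
    · exact sum_nonneg fun _ _ => by split_ifs <;> norm_num
    · unfold FewNbrs at hy
      push Not at hy
      obtain ⟨u, hu, hlt⟩ := hy
      have h2 : (#(Y ∩ nbr y u) : ℝ) ≤ 2 + ∑ e ∈ T u, (if y e then (1 : ℝ) else 0) := by
        have h3 : #(Y ∩ nbr y u) ≤ #W + #((Y \ W) ∩ nbr y u) := by
          rw [← card_sdiff_add_card_inter (Y ∩ nbr y u) W, add_comm]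
          refine add_le_add (card_le_card inter_subset_right) (card_le_card ?_)
          intro a ha
          simp only [mem_sdiff, mem_inter] at ha ⊢
          tauto
        have h4 : (#((Y \ W) ∩ nbr y u) : ℝ) ≤ ∑ e ∈ T u, (if y e then (1 : ℝ) else 0) := by
          have hTu : T u = (Y \ W).image fun o => s(u, o) := rfl
          rw [hTu, sum_image fun a _ b _ hab => Sym2.congr_right.1 hab,
            ← filter_mem_eq_inter, card_filter]
          push_cast
          refine sum_le_sum fun a _ => ?_
          have hmem : a ∈ nbr y u → y s(u, a) = true := fun h => (mem_nbr.1 h).2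
          split_ifs with h1 h2 <;>
            first | exact le_rfl | exact zero_le_one | exact absurd (hmem h1) h2
        have h5 : (#(Y ∩ nbr y u) : ℝ) ≤ #W + #((Y \ W) ∩ nbr y u) := by exact_mod_cast h3
        have h6 : (#W : ℝ) ≤ 2 := by exact_mod_cast hW
        linarith
      refine le_trans ?_ (single_le_sum (fun _ _ => by split_ifs <;> norm_num) hu)
      rw [if_pos (by linarith)]
  refine (avg_mono h.isProb fun y _ => h1 y).trans ?_
  rw [avg_sum]
  have hcT : ∀ u, (#(T u) : ℝ) ≤ 9 * s ^ 2 := fun u => by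
    refine le_trans ?_ hY
    exact_mod_cast card_image_le.trans (card_le_card sdiff_subset)
  have h2 : ∀ u ∈ U, avg (fun _ => p) (away W)
      (fun y => if s / 10 - 2 ≤ ∑ e ∈ T u, (if y e then (1 : ℝ) else 0) then 1 else 0) x
      ≤ Real.exp (-(61 * L)) := by
    intro u hu
    have hsub : T u ⊆ away W := by
      intro e he
      obtain ⟨o, ho, rfl⟩ := mem_spokes.1 he
      exact mk_mem_away.2 ⟨disjoint_left.1 hU hu, (mem_sdiff.1 ho).2⟩
    refine (avg_card_ge_le h.isProb hsub (fun _ _ => le_rfl) _).trans (Real.exp_le_exp.2 ?_)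
    have h3 := h.codeg_le
    have h4 := h.le_s
    have h5 := h.one_le
    have h6 := mul_le_mul_of_nonneg_left (hcT u) h.p_pos.le
    nlinarith
  refine (sum_le_card_nsmul _ _ _ h2).trans ?_
  rw [nsmul_eq_mul]
  have h3 : (#U : ℝ) ≤ Real.exp L := le_trans (by exact_mod_cast card_le_univ U) h.card_le
  calc #U * Real.exp (-(61 * L)) ≤ Real.exp L * Real.exp (-(61 * L)) :=
        mul_le_mul_of_nonneg_right h3 (Real.exp_pos _).le
    _ = _ := by rw [← Real.exp_add]; ring_nf

lemma abs_colorSum_sub_le (u : V) (Y : Finset V) :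
    |(colorSum ℓ x u Y : ℝ) - colorSum ℓ y u Y| ≤ #{w ∈ Y | x s(u, w) ≠ y s(u, w)} := by
  unfold colorSum
  push_cast
  rw [← sum_sub_distrib, card_filter]
  push_cast
  refine (abs_sum_le_sum_abs _ _).trans (sum_le_sum fun w _ => ?_)
  have h1 := abs_color (ℓ := ℓ) w
  by_cases hxy : x s(u, w) = y s(u, w)
  · have : w ∈ nbr x u ↔ w ∈ nbr y u := by rw [mem_nbr, mem_nbr, hxy]
    simp [this, hxy]
  · rw [if_pos hxy]
    split_ifs <;> simp [h1]

lemma FewNbrs.abs_colorSum_le {U Y Y' : Finset V} (hy : FewNbrs s U Y y) (hY : Y' ⊆ Y) {u : V}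
    (hu : u ∈ U) : |(colorSum ℓ y u Y' : ℝ)| ≤ s / 10 := by
  refine (MajorityDynamics.abs_colorSum_le u Y').trans (le_trans ?_ (hy u hu))
  exact_mod_cast card_le_card (inter_subset_inter_right hY)

end Regime

/-! ### The variance of conditional tail probabilities -/

section CondVariance

variable {V : Type} [Fintype V] [DecidableEq V] {ℓ : Coloring V} {x y : Sym2 V → Bool}
  {O A K W : Finset V} {p s L : ℝ}

/-- Switching one potential edge changes the color sums of its two ends only. -/
lemma sum_card_update_le (A Y : Finset V) (e : Sym2 V) (y : Sym2 V → Bool) (b b' : Bool) :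
    ∑ u ∈ A, #{w ∈ Y | Function.update y e b s(u, w) ≠ Function.update y e b' s(u, w)} ≤ 2 := by
  have h1 : ∀ u, #{w ∈ Y | Function.update y e b s(u, w) ≠ Function.update y e b' s(u, w)}
      ≤ if u ∈ e then 1 else 0 := by
    intro u
    have h2 : ∀ w, Function.update y e b s(u, w) ≠ Function.update y e b' s(u, w) → s(u, w) = e := by
      intro w hw
      by_contra hne
      simp [hne] at hw
    split_ifs with hu
    · refine card_le_one.2 fun a ha c hc => ?_
      have ha' := h2 a (mem_filter.1 ha).2
      have hc' := h2 c (mem_filter.1 hc).2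
      exact Sym2.congr_right.1 (ha'.trans hc'.symm)
    · rw [Nat.le_zero, card_eq_zero, filter_eq_empty_iff]
      intro w _ hw
      exact hu (h2 w hw ▸ Sym2.mem_mk_left u w)
  refine (sum_le_sum fun u _ => h1 u).trans ?_
  rw [← card_filter]
  induction e using Sym2.ind with
  | _ a c =>
    refine (card_le_card (t := {a, c}) ?_).trans card_le_two
    intro u hu
    simpa using (mem_filter.1 hu).2

lemma sum_card_inter_nbr_comm (A K : Finset V) (y : Sym2 V → Bool) :
    ∑ u ∈ A, #(K ∩ nbr y u) = ∑ k ∈ K, #(A ∩ nbr y k) := by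
  have h1 : ∀ (B : Finset V) (u : V), #(B ∩ nbr y u) = ∑ k ∈ B, if k ∈ nbr y u then 1 else 0 := by
    intro B u
    rw [← filter_mem_eq_inter, card_filter]
  simp only [h1]
  rw [sum_comm]
  refine sum_congr rfl fun k _ => sum_congr rfl fun u _ => ?_
  simp only [mem_nbr_comm (u := u) (v := k)]

open Classical in
/-- The probability that the day `1` colors on `A` have sum at least `τ`, given the edges between `A`
and the complement of the fresh set `O`, has variance of order `p`. -/
lemma covar_tail_self_le (h : Regime V p s L) (hOcol : ∑ o ∈ O, (ℓ o : ℤ) = 0)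
    (hOc : (#Oᶜ : ℝ) ≤ 9 * s ^ 2) (hAW : Disjoint A W)
    (hW : #W ≤ 2) (hA1 : s ^ 2 / 4 ≤ #A) (hA2 : (#A : ℝ) ≤ 2 * s ^ 2) {Y : Finset V}
    (hY : Y ⊆ Oᶜ) (τ : ℤ) (x : Sym2 V → Bool) :
    covar (fun _ => p) (away W) (fun y => tail (redProb p ℓ O fun u => colorSum ℓ y u Y) A τ)
      (fun y => tail (redProb p ℓ O fun u => colorSum ℓ y u Y) A τ) x ≤ 74000 * p := by
  set f : (Sym2 V → Bool) → ℝ := fun y => tail (redProb p ℓ O fun u => colorSum ℓ y u Y) A τ with hf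
  have hs := h.s_ge
  have hp := h.p_pos
  have hp1 : p ≤ 1 := by linarith [h.p_le]
  have hvar := h.variance_le hOc
  have hf01 : ∀ y, 0 ≤ f y ∧ f y ≤ 1 := fun y =>
    ⟨tail_nonneg (isProb_redProb hp.le hp1 _) τ, tail_le_one (isProb_redProb hp.le hp1 _) τ⟩
  set η := Real.exp (-(60 * L)) with hη
  have hbad := avg_not_fewNbrs_le h (U := A) (Y := Oᶜ) hAW hW hOc x
  refine (covar_self_le_sum_influence h.isProb f (away W) x).trans ?_
  -- Edges that do not join `A` to `Oᶜ` have no influence.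
  have hzero : ∀ e, e ∉ cut A Oᶜ → ∀ y, influence f e y = 0 := by
    intro e he y
    have hz : ∀ u ∈ A, colorSum ℓ (Function.update y e true) u Y
        = colorSum ℓ (Function.update y e false) u Y := by
      intro u hu
      refine colorSum_congr fun w hw _ => ?_
      have : s(u, w) ≠ e := fun heq => he (mem_cut.2 ⟨u, hu, w, hY hw, heq⟩)
      simp [this]
    have : f (Function.update y e true) = f (Function.update y e false) :=
      tail_congr (fun u hu => by simp only [redProb, hz u hu]) τ
    rw [influence, this, sub_self]
  have hinf : ∀ e y, influence f e y ^ 2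
      ≤ 4096 / s ^ 4 + if FewNbrs s A Oᶜ y then 0 else 1 := by
    intro e y
    split_ifs with hy
    · have hz : ∀ b : Bool, ∀ u ∈ A,
          |((fun u => colorSum ℓ (Function.update y e b) u Y) u : ℝ)| ≤ s / 10 + 1 := by
        intro b u hu
        have h1 := abs_colorSum_sub_le (ℓ := ℓ) (x := Function.update y e b) (y := y) u Y
        have h2 := hy.abs_colorSum_le (ℓ := ℓ) hY hu
        have h3 : #{w ∈ Y | Function.update y e b s(u, w) ≠ y s(u, w)} ≤ 1 := by
          refine card_le_one.2 fun a ha c hc => ?_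
          have key : ∀ w, Function.update y e b s(u, w) ≠ y s(u, w) → s(u, w) = e := by
            intro w hw
            by_contra hne
            simp [hne] at hw
          exact Sym2.congr_right.1
            ((key a (mem_filter.1 ha).2).trans (key c (mem_filter.1 hc).2).symm)
        have h4 : (#{w ∈ Y | Function.update y e b s(u, w) ≠ y s(u, w)} : ℝ) ≤ 1 := by
          exact_mod_cast h3
        have h5 := abs_sub_abs_le_abs_sub (colorSum ℓ (Function.update y e b) u Y : ℝ)
          (colorSum ℓ y u Y)
        simp only
        linarith
      have h1 := abs_tail_redProb_sub_le hp.le hp1 (by linarith) hvar hOcol hA1 (hz true) (hz false)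
        τ τ
      have h2 : ∑ u ∈ A, |(colorSum ℓ (Function.update y e true) u Y : ℝ)
          - colorSum ℓ (Function.update y e false) u Y| ≤ 2 := by
        refine (sum_le_sum fun u _ => abs_colorSum_sub_le u Y).trans ?_
        exact_mod_cast sum_card_update_le A Y e y true false
      have h3 : |influence f e y| ≤ 64 / s ^ 2 := by
        refine h1.trans ?_
        simp only [sub_self, abs_zero, mul_zero, add_zero]
        calc _ ≤ 32 / s ^ 2 * 2 := mul_le_mul_of_nonneg_left h2 (by positivity)
          _ = _ := by ring
      rw [← sq_abs, add_zero]
      calc |influence f e y| ^ 2 ≤ (64 / s ^ 2) ^ 2 := pow_le_pow_left₀ (abs_nonneg _) h3 2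
        _ = _ := by ring
    · have h1 := hf01 (Function.update y e true)
      have h2 := hf01 (Function.update y e false)
      have h3 : influence f e y ^ 2 ≤ 1 := by
        rw [influence, sq_le_one_iff_abs_le_one, abs_le]
        constructor <;> linarith [h1.1, h1.2, h2.1, h2.2]
      have : (0 : ℝ) ≤ 4096 / s ^ 4 := by positivity
      linarith
  have hterm : ∀ e ∈ away W, p * avg (fun _ => p) (away W) (fun y => influence f e y ^ 2) x
      ≤ if e ∈ cut A Oᶜ then p * (4096 / s ^ 4 + η) else 0 := by
    intro e _
    split_ifs with he
    · refine mul_le_mul_of_nonneg_left ?_ hp.le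
      refine (avg_mono h.isProb fun y _ => hinf e y).trans ?_
      rw [avg_add, avg_const]
      linarith
    · have : (fun y => influence f e y ^ 2) = fun _ => (0 : ℝ) := by
        ext y; rw [hzero e he]; norm_num
      rw [this, avg_const, mul_zero]
  refine (sum_le_sum hterm).trans ?_
  have hcard : (#(cut A Oᶜ) : ℝ) ≤ 18 * s ^ 4 := by
    have h1 : #(cut A Oᶜ) ≤ #A * #Oᶜ := card_biUnion_le_card_mul _ _ _ fun u _ => card_image_le
    calc (#(cut A Oᶜ) : ℝ) ≤ #A * #Oᶜ := by exact_mod_cast h1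
      _ ≤ (2 * s ^ 2) * (9 * s ^ 2) := mul_le_mul hA2 hOc (Nat.cast_nonneg _) (by positivity)
      _ = _ := by ring
  have hη0 : 0 ≤ η := (Real.exp_pos _).le
  have hη8 : η * s ^ 8 ≤ 1 := h.exp_mul_pow_le
  rw [← sum_filter]
  have h2 : ∑ e ∈ (away W).filter (· ∈ cut A Oᶜ), p * (4096 / s ^ 4 + η)
      ≤ 18 * s ^ 4 * (p * (4096 / s ^ 4 + η)) := by
    rw [sum_const, nsmul_eq_mul]
    refine mul_le_mul_of_nonneg_right (le_trans ?_ hcard) (by positivity)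
    exact_mod_cast card_le_card (by intro e he; exact (mem_filter.1 he).2)
  refine h2.trans ?_
  have h3 : s ^ 4 * η ≤ 1 := by
    have : (1 : ℝ) ≤ s ^ 4 := one_le_pow₀ (by linarith)
    have h4 : 0 ≤ s ^ 4 * η := by positivity
    nlinarith
  have h5 : 18 * s ^ 4 * (p * (4096 / s ^ 4 + η)) = p * (73728 + 18 * (s ^ 4 * η)) := by
    field_simp
    ring
  rw [h5]
  nlinarith

open Classical in
/-- The conditional probability that the day `1` colors on `A ∪ K` have sum at least `τ`, given all
edges except those between `A` and the fresh set `O`, has small variance if `K` is small. -/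
lemma covar_avg_cut_self_le (h : Regime V p s L) (hOcol : ∑ o ∈ O, (ℓ o : ℤ) = 0)
    (hOc : (#Oᶜ : ℝ) ≤ 9 * s ^ 2) (hAW : Disjoint A W) (hKW : Disjoint K W)
    (hAO : Disjoint A O) (hKO : Disjoint K O) (hAK : Disjoint A K)
    (hW : #W ≤ 2) (hA1 : s ^ 2 / 4 ≤ #A) (hA2 : (#A : ℝ) ≤ 2 * s ^ 2) (τ : ℤ) (x : Sym2 V → Bool) :
    covar (fun _ => p) (away W)
      (avg (fun _ => p) (cut A O)
        fun y => if τ ≤ ∑ u ∈ A ∪ K, sg (redNext ℓ y u) then 1 else 0)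
      (avg (fun _ => p) (cut A O)
        fun y => if τ ≤ ∑ u ∈ A ∪ K, sg (redNext ℓ y u) then 1 else 0) x
      ≤ 288 * (#K : ℝ) ^ 2 / s ^ 2 + 148000 * p + 1 / s ^ 2 := by
  set T : (Sym2 V → Bool) → ℤ := fun y => ∑ u ∈ K, sg (redNext ℓ y u) with hT
  set F : (Sym2 V → Bool) → ℝ := avg (fun _ => p) (cut A O)
        fun y => if τ ≤ ∑ u ∈ A ∪ K, sg (redNext ℓ y u) then 1 else 0 with hF
  set g : (Sym2 V → Bool) → ℝ :=
    fun y => tail (redProb p ℓ O fun u => colorSum ℓ y u (Oᶜ \ K)) A τ with hg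
  have hs := h.s_ge
  have hp := h.p_pos
  have hp1 : p ≤ 1 := by linarith [h.p_le]
  have hvar := h.variance_le hOc
  set η := Real.exp (-(60 * L)) with hη
  have hη0 : 0 ≤ η := (Real.exp_pos _).le
  have hη8 : η * s ^ 8 ≤ 1 := h.exp_mul_pow_le
  have hTle : ∀ y, |(T y : ℝ)| ≤ #K := by
    intro y
    simp only [hT]
    push_cast
    refine (abs_sum_le_sum_abs _ _).trans (le_of_eq ?_)
    rw [sum_congr rfl (g := fun _ => (1 : ℝ)) fun u _ => by cases redNext ℓ y u <;> norm_num]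
    simp
  have hTcut : Ignores T (cut A O) := by
    intro y z hyz
    refine sum_congr rfl fun u hu => ?_
    congr 1
    refine redNext_congr fun w _ => hyz _ fun hmem => ?_
    obtain ⟨a, ha, o, ho, he⟩ := mem_cut.1 hmem
    rw [Sym2.eq_iff] at he
    rcases he with ⟨h1, -⟩ | ⟨-, h2⟩
    · exact disjoint_left.1 hAK ha (h1 ▸ hu)
    · exact disjoint_left.1 hKO hu (h2 ▸ ho)
  have hFeq : ∀ y, F y = tail (redProb p ℓ O fun u => colorSum ℓ y u Oᶜ) A (τ - T y) := by
    intro y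
    rw [hF, ← avg_cut_tail hAO]
    refine avg_congr fun z hz => ?_
    have h1 : T z = T y := hTcut z y hz
    rw [sum_union hAK]
    have h2 : (τ ≤ ∑ u ∈ A, sg (redNext ℓ z u) + ∑ u ∈ K, sg (redNext ℓ z u))
        ↔ (τ - T y ≤ ∑ u ∈ A, sg (redNext ℓ z u)) := by
      rw [← h1]; simp only [hT]; omega
    simp only [h2]
  have hF01 : ∀ y, 0 ≤ F y ∧ F y ≤ 1 := fun y => by
    rw [hFeq]
    exact ⟨tail_nonneg (isProb_redProb hp.le hp1 _) _, tail_le_one (isProb_redProb hp.le hp1 _) _⟩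
  have hg01 : ∀ y, 0 ≤ g y ∧ g y ≤ 1 := fun y =>
    ⟨tail_nonneg (isProb_redProb hp.le hp1 _) _, tail_le_one (isProb_redProb hp.le hp1 _) _⟩
  have hsplit : F = fun y => (F y - g y) + g y := by ext y; ring
  have hAO' : A ⊆ Oᶜ := fun u hu => mem_compl.2 (disjoint_left.1 hAO hu)
  have hKO' : K ⊆ Oᶜ := fun u hu => mem_compl.2 (disjoint_left.1 hKO hu)
  -- Ignoring the edges to `K` and the colors on `K` changes the conditional probability by
  -- `O(#K / s)`, since each vertex of `K` has at most `s / 10` neighbours in `A`.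
  have hdiff : ∀ y, (F y - g y - 0) ^ 2
      ≤ 144 * (#K : ℝ) ^ 2 / s ^ 2 + if FewNbrs s (A ∪ K) Oᶜ y then 0 else 1 := by
    intro y
    split_ifs with hy
    · have hz : ∀ Y ⊆ Oᶜ, ∀ u ∈ A, |((fun u => colorSum ℓ y u Y) u : ℝ)| ≤ s / 10 + 1 := by
        intro Y hY u hu
        have := hy.abs_colorSum_le (ℓ := ℓ) hY (mem_union_left _ hu)
        simp only
        linarith
      have h1 := abs_tail_redProb_sub_le hp.le hp1 (by linarith) hvar hOcol hA1
        (hz Oᶜ Subset.rfl) (hz (Oᶜ \ K) sdiff_subset) (τ - T y) τ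
      have h2 : ∑ u ∈ A, |(colorSum ℓ y u Oᶜ : ℝ) - colorSum ℓ y u (Oᶜ \ K)| ≤ #K * (s / 10) := by
        have h3 : ∀ u ∈ A, |(colorSum ℓ y u Oᶜ : ℝ) - colorSum ℓ y u (Oᶜ \ K)| ≤ #(K ∩ nbr y u) := by
          intro u _
          have h4 : colorSum ℓ y u Oᶜ = colorSum ℓ y u (Oᶜ \ K) + colorSum ℓ y u K := by
            rw [← colorSum_union sdiff_disjoint, sdiff_union_of_subset hKO']
          rw [h4]
          push_cast
          rw [add_sub_cancel_left]
          exact abs_colorSum_le u K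
        refine (sum_le_sum h3).trans ?_
        have h5 := sum_card_inter_nbr_comm A K y
        have h6 : ∑ u ∈ A, (#(K ∩ nbr y u) : ℝ) = ∑ k ∈ K, (#(A ∩ nbr y k) : ℝ) := by
          exact_mod_cast h5
        rw [h6]
        have h7 : ∀ k ∈ K, (#(A ∩ nbr y k) : ℝ) ≤ s / 10 := by
          intro k hk
          refine le_trans ?_ (hy k (mem_union_right _ hk))
          exact_mod_cast card_le_card (inter_subset_inter_right hAO')
        refine (sum_le_card_nsmul _ _ _ h7).trans (le_of_eq ?_)
        rw [nsmul_eq_mul]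
      have h3 : |F y - g y| ≤ 12 * #K / s := by
        rw [hFeq]
        refine h1.trans ?_
        push_cast
        rw [sub_sub_cancel_left, abs_neg]
        have h4 := hTle y
        have h5 : 32 / s ^ 2 * (#K * (s / 10)) + 8 / s * #K = (112 / 10) * #K / s := by
          field_simp
          ring
        have h6 : (112 / 10) * (#K : ℝ) / s ≤ 12 * #K / s := by
          refine div_le_div_of_nonneg_right ?_ (by linarith)
          have : (0 : ℝ) ≤ #K := Nat.cast_nonneg _
          linarith
        refine le_trans ?_ h6
        rw [← h5]
        exact add_le_add (mul_le_mul_of_nonneg_left h2 (by positivity))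
          (mul_le_mul_of_nonneg_left h4 (by positivity))
      rw [sub_zero, ← sq_abs, add_zero]
      calc |F y - g y| ^ 2 ≤ (12 * #K / s) ^ 2 := pow_le_pow_left₀ (abs_nonneg _) h3 2
        _ = _ := by ring
    · have h1 := hF01 y
      have h2 := hg01 y
      have h3 : (F y - g y - 0) ^ 2 ≤ 1 := by
        rw [sq_le_one_iff_abs_le_one, abs_le]
        constructor <;> linarith [h1.1, h1.2, h2.1, h2.2]
      have : (0 : ℝ) ≤ 144 * (#K : ℝ) ^ 2 / s ^ 2 := by positivity
      linarith
  have hbad := avg_not_fewNbrs_le h (U := A ∪ K) (Y := Oᶜ)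
    (disjoint_union_left.2 ⟨hAW, hKW⟩) hW hOc x
  have h1 : covar (fun _ => p) (away W) (fun y => F y - g y) (fun y => F y - g y) x
      ≤ 144 * (#K : ℝ) ^ 2 / s ^ 2 + η := by
    refine (covar_self_le 0).trans ((avg_mono h.isProb fun y _ => hdiff y).trans ?_)
    rw [avg_add, avg_const]
    linarith
  have h2 := covar_tail_self_le h hOcol hOc hAW hW hA1 hA2 (Y := Oᶜ \ K) sdiff_subset τ x
  have h3 := covar_add_self_le (S := away W) (f := fun y => F y - g y) (g := g) (x := x)
    (h.isProb (κ := Sym2 V))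
  rw [← hsplit] at h3
  have h4 : η ≤ 1 / (2 * s ^ 2) := by
    rw [le_div_iff₀ (by positivity)]
    have h5 : 2 * s ^ 2 ≤ s ^ 8 := by
      have : (2 : ℝ) ≤ s ^ 6 := le_trans (by linarith) (le_self_pow₀ (by linarith : (1 : ℝ) ≤ s) (by norm_num : 6 ≠ 0))
      nlinarith [sq_nonneg s]
    nlinarith
  have h5 : 2 * (1 / (2 * s ^ 2)) = 1 / s ^ 2 := by field_simp
  have h6 : 2 * (144 * (#K : ℝ) ^ 2 / s ^ 2) = 288 * (#K : ℝ) ^ 2 / s ^ 2 := by ring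
  linarith

end CondVariance

/-! ### Auxiliary moment bounds -/

section Moments

variable {ι : Type*} [Fintype ι] [DecidableEq ι] {q : ι → ℝ} {S T : Finset ι}
  {f g φ ψ : (ι → Bool) → ℝ} {x : ι → Bool}

lemma avg_eq_avg_piecewise (q : ι → ℝ) (S : Finset ι) (f : (ι → Bool) → ℝ) (x x₀ : ι → Bool) :
    avg q S f x₀ = avg q S (fun y => f (S.piecewise y x₀)) x := by
  refine sum_congr rfl fun y _ => ?_
  congr 2
  ext i
  by_cases hi : i ∈ S <;> simp [hi]

lemma covar_congr {f' g' : (ι → Bool) → ℝ} (hf : ∀ y, (∀ i, i ∉ S → y i = x i) → f y = f' y)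
    (hg : ∀ y, (∀ i, i ∉ S → y i = x i) → g y = g' y) : covar q S f g x = covar q S f' g' x := by
  rw [covar, covar, avg_congr hf, avg_congr hg, avg_congr fun y hy => by rw [hf y hy, hg y hy]]

lemma covar_le_one (hq : IsProb q) (hf : ∀ y, 0 ≤ f y ∧ f y ≤ 1) (hg : ∀ y, 0 ≤ g y ∧ g y ≤ 1) :
    covar q S f g x ≤ 1 := by
  have h1 : avg q S (fun y => f y * g y) x ≤ 1 :=
    avg_le_const hq fun y => mul_le_one₀ (hf y).2 (hg y).1 (hg y).2
  have h2 : 0 ≤ avg q S f x * avg q S g x :=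
    mul_nonneg (const_le_avg hq fun y => (hf y).1) (const_le_avg hq fun y => (hg y).1)
  rw [covar]; linarith

/-- The covariance of `[0, 1]`-valued functions is stable under small changes in `L¹`. -/
lemma covar_le_covar_add (hq : IsProb q) (hf : ∀ y, 0 ≤ f y ∧ f y ≤ 1)
    (hg : ∀ y, 0 ≤ g y ∧ g y ≤ 1) (hφ : ∀ y, 0 ≤ φ y ∧ φ y ≤ 1) (hψ : ∀ y, 0 ≤ ψ y ∧ ψ y ≤ 1) :
    covar q S f g x ≤ covar q S φ ψ x + 2 * avg q S (fun y => |f y - φ y|) x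
      + 2 * avg q S (fun y => |g y - ψ y|) x := by
  have h1 : avg q S (fun y => f y * g y) x ≤ avg q S (fun y => φ y * ψ y) x
      + avg q S (fun y => |f y - φ y|) x + avg q S (fun y => |g y - ψ y|) x := by
    rw [← avg_add, ← avg_add]
    refine avg_mono hq fun y _ => ?_
    have e : f y * g y = φ y * ψ y + (f y - φ y) * g y + φ y * (g y - ψ y) := by ring
    have e1 : (f y - φ y) * g y ≤ |f y - φ y| := by
      calc (f y - φ y) * g y ≤ |f y - φ y| * g y :=
            mul_le_mul_of_nonneg_right (le_abs_self _) (hg y).1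
        _ ≤ |f y - φ y| := mul_le_of_le_one_right (abs_nonneg _) (hg y).2
    have e2 : φ y * (g y - ψ y) ≤ |g y - ψ y| := by
      calc φ y * (g y - ψ y) ≤ φ y * |g y - ψ y| :=
            mul_le_mul_of_nonneg_left (le_abs_self _) (hφ y).1
        _ ≤ |g y - ψ y| := mul_le_of_le_one_left (abs_nonneg _) (hφ y).2
    linarith
  have h01 : ∀ {h : (ι → Bool) → ℝ}, (∀ y, 0 ≤ h y ∧ h y ≤ 1) →
      0 ≤ avg q S h x ∧ avg q S h x ≤ 1 := fun hh =>
    ⟨const_le_avg hq fun y => (hh y).1, avg_le_const hq fun y => (hh y).2⟩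
  have h2 : |avg q S f x - avg q S φ x| ≤ avg q S (fun y => |f y - φ y|) x := by
    rw [← avg_sub]; exact abs_avg_le hq
  have h3 : |avg q S g x - avg q S ψ x| ≤ avg q S (fun y => |g y - ψ y|) x := by
    rw [← avg_sub]; exact abs_avg_le hq
  have h4 : avg q S φ x * avg q S ψ x - avg q S f x * avg q S g x
      ≤ |avg q S f x - avg q S φ x| + |avg q S g x - avg q S ψ x| := by
    obtain ⟨a1, a2⟩ := h01 hψ
    obtain ⟨b1, b2⟩ := h01 hf
    have e : avg q S φ x * avg q S ψ x - avg q S f x * avg q S g x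
        = -(avg q S f x - avg q S φ x) * avg q S ψ x
          + avg q S f x * -(avg q S g x - avg q S ψ x) := by ring
    have e1 : -(avg q S f x - avg q S φ x) * avg q S ψ x ≤ |avg q S f x - avg q S φ x| := by
      calc _ ≤ |avg q S f x - avg q S φ x| * avg q S ψ x :=
            mul_le_mul_of_nonneg_right (neg_le_abs _) a1
        _ ≤ _ := mul_le_of_le_one_right (abs_nonneg _) a2
    have e2 : avg q S f x * -(avg q S g x - avg q S ψ x) ≤ |avg q S g x - avg q S ψ x| := by
      calc _ ≤ avg q S f x * |avg q S g x - avg q S ψ x| :=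
            mul_le_mul_of_nonneg_left (neg_le_abs _) b1
        _ ≤ _ := mul_le_of_le_one_left (abs_nonneg _) b2
    linarith
  rw [covar, covar]
  linarith

lemma avg_sq_sum_bits_sub_le {p : ℝ} (hp : 0 ≤ p) (hp1 : p ≤ 1) (T : Finset ι) (x : ι → Bool) :
    avg (fun _ => p) univ (fun y => (∑ i ∈ T, (if y i then (1 : ℝ) else 0) - p * #T) ^ 2) x
      ≤ p * #T := by
  have hq : IsProb (fun _ : ι => p) := fun _ => ⟨hp, hp1⟩
  set f : (ι → Bool) → ℝ := fun y => ∑ i ∈ T, if y i then (1 : ℝ) else 0 with hf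
  have h1 := covar_self_le_sum_influence hq f univ x
  have hmean : avg (fun _ => p) univ f x = p * #T := by
    rw [hf, avg_sum, sum_congr rfl fun i _ => avg_bit (mem_univ i)]
    simp [mul_comm]
  have hinf : ∀ i y, influence f i y = if i ∈ T then 1 else 0 := by
    intro i y
    rw [influence, hf]
    simp only
    rw [← sum_sub_distrib]
    have : ∀ j ∈ T, (if Function.update y i true j = true then (1 : ℝ) else 0)
        - (if Function.update y i false j = true then 1 else 0) = if j = i then 1 else 0 := by
      intro j _
      by_cases hj : j = i
      · subst hj; simp
      · simp [hj]
    rw [sum_congr rfl this, sum_ite_eq']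
  rw [covar_eq (p * #T) (p * #T), hmean] at h1
  simp only [sub_self, mul_zero, sub_zero] at h1
  simp only [← pow_two] at h1
  refine h1.trans (le_of_eq ?_)
  simp only [hinf]
  simp [mul_comm]

end Moments

/-! ### The covariance of the events at two vertices -/

section Covariance

variable {V : Type} [Fintype V] [DecidableEq V] {ℓ : Coloring V} {x y : Sym2 V → Bool}
  {p s L : ℝ} {v w : V}

/-- The indicator that the day `1` colors of the neighbours of `v` have sum at least `τ`. -/
def sumGe (ℓ : Coloring V) (τ : ℤ) (v : V) (y : Sym2 V → Bool) : ℝ :=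
  if τ ≤ nextSum ℓ y v then 1 else 0

lemma sumGe_mem (τ : ℤ) (v : V) (y : Sym2 V → Bool) : 0 ≤ sumGe ℓ τ v y ∧ sumGe ℓ τ v y ≤ 1 := by
  unfold sumGe; split_ifs <;> norm_num

lemma nbr_eq_of_away {W : Finset V} {u : V} (hu : u ∈ W) (h : ∀ e, e ∉ away W → y e = x e) :
    nbr y u = nbr x u :=
  nbr_congr fun _ _ => h _ fun hm => (mk_mem_away.1 hm).1 hu

lemma notMem_nbr_self (v : V) : v ∉ nbr x v := fun h => (mem_nbr.1 h).1 rfl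

/-- The neighbourhoods of `v` and `w` have typical sizes and a small intersection, and `v` and `w`
are not adjacent. -/
structure Typical (s : ℝ) (v w : V) (x : Sym2 V → Bool) : Prop where
  nonadj : w ∉ nbr x v
  ge_left : s ^ 2 / 2 ≤ #(nbr x v)
  le_left : #(nbr x v) ≤ 2 * s ^ 2
  ge_right : s ^ 2 / 2 ≤ #(nbr x w)
  le_right : #(nbr x w) ≤ 2 * s ^ 2
  inter_le : #(nbr x v ∩ nbr x w) ≤ s ^ 2 / 4

lemma Typical.symm (hx : Typical s v w x) : Typical s w v x where
  nonadj h := hx.nonadj (mem_nbr_comm.1 h)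
  ge_left := hx.ge_right
  le_left := hx.le_right
  ge_right := hx.ge_left
  le_right := hx.le_left
  inter_le := by rw [inter_comm]; exact hx.inter_le

lemma Typical.exists_fresh (h : Regime V p s L) (hx : Typical s v w x)
    (hR : (red ℓ).ncard = ⌈(Fintype.card V : ℝ) / 2⌉₊) :
    ∃ O : Finset V, Disjoint (nbr x v) O ∧ Disjoint (nbr x w) O ∧ Disjoint {v, w} O ∧
      ∑ o ∈ O, (ℓ o : ℤ) = 0 ∧ (#Oᶜ : ℝ) ≤ 9 * s ^ 2 := by
  obtain ⟨O, hd, hO, hc⟩ := exists_balanced hR (nbr x v ∪ nbr x w ∪ {v, w})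
  rw [disjoint_union_left, disjoint_union_left] at hd
  refine ⟨O, hd.1.1, hd.1.2, hd.2, hO, ?_⟩
  have h1 : #(nbr x v ∪ nbr x w ∪ {v, w}) ≤ #(nbr x v) + #(nbr x w) + 2 :=
    (card_union_le _ _).trans (add_le_add (card_union_le _ _) card_le_two)
  have h2 : #Oᶜ ≤ 2 * (#(nbr x v) + #(nbr x w) + 2) + 1 := by omega
  have h3 : (#Oᶜ : ℝ) ≤ 2 * (#(nbr x v) + #(nbr x w) + 2) + 1 := by exact_mod_cast h2
  have := hx.le_left
  have := hx.le_right
  have := h.s_ge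
  nlinarith

lemma Typical.disjoint_left (hx : Typical s v w x) : Disjoint (nbr x v) {v, w} := by
  rw [disjoint_insert_right, disjoint_singleton_right]
  exact ⟨notMem_nbr_self v, hx.nonadj⟩

lemma Typical.disjoint_right (hx : Typical s v w x) : Disjoint (nbr x w) {v, w} := by
  rw [disjoint_insert_right, disjoint_singleton_right]
  exact ⟨hx.symm.nonadj, notMem_nbr_self w⟩

/-- Given the neighbourhoods of `v` and `w`, the two events interact through the edges near both
neighbourhoods only, and their covariance is small. -/
lemma covar_sumGe_away_le (h : Regime V p s L) (hx : Typical s v w x)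
    (hR : (red ℓ).ncard = ⌈(Fintype.card V : ℝ) / 2⌉₊) (τ : ℤ) :
    covar (fun _ => p) (away {v, w}) (sumGe ℓ τ v) (sumGe ℓ τ w) x
      ≤ 288 * (#(nbr x v ∩ nbr x w) : ℝ) ^ 2 / s ^ 2 + 148000 * p + 1 / s ^ 2 := by
  obtain ⟨O, hAO, hBO, hWO, hOcol, hOc⟩ := hx.exists_fresh h hR
  have hAW := hx.disjoint_left
  have hBW := hx.disjoint_right
  set A := nbr x v with hA
  set B := nbr x w with hB
  set W : Finset V := {v, w} with hW
  set K := A ∩ B with hK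
  have hWc : #W ≤ 2 := card_le_two
  set F : Finset V → (Sym2 V → Bool) → ℝ :=
    fun C y => if τ ≤ ∑ u ∈ C, sg (redNext ℓ y u) then 1 else 0 with hF
  have h1 : covar (fun _ => p) (away W) (sumGe ℓ τ v) (sumGe ℓ τ w) x
      = covar (fun _ => p) (away W) (F A) (F B) x := by
    refine covar_congr (fun y hy => ?_) (fun y hy => ?_)
    · rw [sumGe, nextSum, nbr_eq_of_away (by simp [hW] : v ∈ W) hy]
    · rw [sumGe, nextSum, nbr_eq_of_away (by simp [hW] : w ∈ W) hy]
  -- Colors on `C` do not depend on edges from vertices outside `C` to the fresh set.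
  have hign : ∀ C D : Finset V, Disjoint C O → Disjoint C D → Ignores (F C) (cut D O) := by
    intro C D hCO hCD y z hyz
    have : ∀ u ∈ C, redNext ℓ y u = redNext ℓ z u := by
      intro u hu
      refine redNext_congr fun b _ => hyz _ fun hmem => ?_
      obtain ⟨a, ha, o, ho, he⟩ := mem_cut.1 hmem
      rw [Sym2.eq_iff] at he
      rcases he with ⟨h1, -⟩ | ⟨-, h2⟩
      · exact Finset.disjoint_left.1 hCD (h1 ▸ hu) ha
      · exact Finset.disjoint_left.1 hCO hu (h2 ▸ ho)
    simp only [hF]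
    rw [sum_congr rfl fun u hu => by rw [this u hu]]
  have hFA : Ignores (F A) (cut (B \ A) O) := hign A (B \ A) hAO disjoint_sdiff
  have hFB : Ignores (F B) (cut (A \ B) O) := hign B (A \ B) hBO disjoint_sdiff
  have hA'W : Disjoint (A \ B) W := hAW.mono_left sdiff_subset
  have hB'W : Disjoint (B \ A) W := hBW.mono_left sdiff_subset
  have hOW : Disjoint O W := hWO.symm
  have hsub : cut (A \ B) O ∪ cut (B \ A) O ⊆ away W :=
    union_subset (cut_subset_away hA'W hOW) (cut_subset_away hB'W hOW)
  have h2 : covar (fun _ => p) (away W) (F A) (F B) x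
      = covar (fun _ => p) (away W) (avg (fun _ => p) (cut (A \ B) O) (F A))
        (avg (fun _ => p) (cut (B \ A) O) (F B)) x := by
    rw [← union_eq_left.2 hsub, covar_union, union_eq_left.2 hsub]
    have h3 : covar (fun _ => p) (cut (A \ B) O ∪ cut (B \ A) O) (F A) (F B) = fun _ => 0 := by
      ext y
      rw [covar, avg_mul_of_ignores_of_ignores hFA hFB, sub_self]
    have h4 : avg (fun _ => p) (cut (A \ B) O ∪ cut (B \ A) O) (F A)
        = avg (fun _ => p) (cut (A \ B) O) (F A) := by
      ext y; rw [union_comm, avg_union_of_ignores hFA]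
    have h5 : avg (fun _ => p) (cut (A \ B) O ∪ cut (B \ A) O) (F B)
        = avg (fun _ => p) (cut (B \ A) O) (F B) := by
      ext y; rw [avg_union_of_ignores hFB]
    rw [h3, h4, h5, avg_const, zero_add]
  have hKA : A \ B ∪ K = A := sdiff_union_inter A B
  have hKB : B \ A ∪ K = B := by rw [hK, inter_comm]; exact sdiff_union_inter B A
  have hcardA : (#(A \ B) : ℝ) + #K = #A := by exact_mod_cast card_sdiff_add_card_inter A B
  have hcardB : (#(B \ A) : ℝ) + #K = #B := by
    rw [hK, inter_comm]; exact_mod_cast card_sdiff_add_card_inter B A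
  have hK0 : (0 : ℝ) ≤ #K := Nat.cast_nonneg _
  have hKW : Disjoint K W := hAW.mono_left inter_subset_left
  have hKO : Disjoint K O := hAO.mono_left inter_subset_left
  have hx1 := hx.ge_left
  have hx2 := hx.le_left
  have hx3 := hx.ge_right
  have hx4 := hx.le_right
  have hx5 := hx.inter_le
  have h3 := covar_avg_cut_self_le h hOcol hOc hA'W hKW (hAO.mono_left sdiff_subset) hKO
    (disjoint_sdiff_inter A B) hWc (by linarith) (by linarith) τ x
  have h4 := covar_avg_cut_self_le h hOcol hOc hB'W hKW (hBO.mono_left sdiff_subset) hKO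
    (by rw [hK, inter_comm]; exact disjoint_sdiff_inter B A) hWc (by linarith) (by linarith) τ x
  rw [hKA] at h3
  rw [hKB] at h4
  rw [h1, h2]
  refine (covar_le h.isProb).trans ?_
  linarith

/-- The configuration `x` with all edges at `w` removed. -/
def isolate (w : V) (x : Sym2 V → Bool) : Sym2 V → Bool :=
  (spokes w univ).piecewise (fun _ => false) x

lemma mk_mem_spokes_univ {a b w : V} : s(a, b) ∈ spokes w univ ↔ a = w ∨ b = w := by
  rw [mem_spokes]
  constructor
  · rintro ⟨o, -, ho⟩
    rcases Sym2.eq_iff.1 ho with ⟨h1, -⟩ | ⟨h1, -⟩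
    · exact Or.inl h1.symm
    · exact Or.inr h1.symm
  · rintro (rfl | rfl)
    · exact ⟨b, mem_univ _, rfl⟩
    · exact ⟨a, mem_univ _, Sym2.eq_swap⟩

lemma isolate_of_ne {a b w : V} (ha : a ≠ w) (hb : b ≠ w) : isolate w x s(a, b) = x s(a, b) := by
  rw [isolate, Finset.piecewise_eq_of_notMem]
  rw [mk_mem_spokes_univ]
  tauto

open Classical in
/-- The conditional probability of the event at `v` hardly depends on the edges at `w`. -/
lemma abs_avg_sumGe_sub_isolate_le (h : Regime V p s L) (hvw : v ≠ w) (hx : Typical s v w x)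
    (hR : (red ℓ).ncard = ⌈(Fintype.card V : ℝ) / 2⌉₊) (τ : ℤ) :
    |avg (fun _ => p) (away {v, w}) (sumGe ℓ τ v) x
      - avg (fun _ => p) (away {v, w}) (sumGe ℓ τ v) (isolate w x)|
      ≤ 32 * #(nbr x v ∩ nbr x w) / s ^ 2 + Real.exp (-(60 * L)) := by
  obtain ⟨O, hAO, hBO, hWO, hOcol, hOc⟩ := hx.exists_fresh h hR
  have hAW := hx.disjoint_left
  set A := nbr x v with hA
  set W : Finset V := {v, w} with hW
  have hvW : v ∈ W := by simp [hW]
  have hwW : w ∈ W := by simp [hW]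
  have hWc : #W ≤ 2 := card_le_two
  have hs := h.s_ge
  have hp := h.p_pos
  have hp1 : p ≤ 1 := by linarith [h.p_le]
  have hvar := h.variance_le hOc
  have hvO : v ∉ O := Finset.disjoint_left.1 hWO hvW
  have hsub : cut A O ⊆ away W := cut_subset_away hAW hWO.symm
  have hA2 : s ^ 2 / 4 ≤ #A := by have := hx.ge_left; nlinarith
  set f : (Sym2 V → Bool) → ℝ := fun y => tail (redProb p ℓ O fun u => colorSum ℓ y u Oᶜ) A τ with hf
  have key : ∀ y, nbr y v = A → avg (fun _ => p) (cut A O) (sumGe ℓ τ v) y = f y := by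
    intro y hy
    simp only [hf]
    rw [← avg_cut_tail hAO]
    refine avg_congr fun z hz => ?_
    have : nbr z v = A := by
      rw [← hy]
      refine nbr_congr fun u _ => hz _ fun hm => ?_
      obtain ⟨a, ha, o, ho, he⟩ := mem_cut.1 hm
      rcases Sym2.eq_iff.1 he with ⟨h1, -⟩ | ⟨-, h1⟩
      · exact notMem_nbr_self v (h1 ▸ ha)
      · exact hvO (h1 ▸ ho)
    rw [sumGe, nextSum, this]
  have hiso : nbr (isolate w x) v = A := by
    ext u
    rw [mem_nbr, hA, mem_nbr]
    refine and_congr_right fun huv => ?_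
    by_cases huw : u = w
    · subst huw
      have h1 : isolate u x s(v, u) = false := by
        rw [isolate, Finset.piecewise_eq_of_mem]
        exact mk_mem_spokes_univ.2 (Or.inr rfl)
      have h2 : ¬ x s(v, u) = true := fun h2 => hx.nonadj (mem_nbr.2 ⟨huv, h2⟩)
      simp [h1, h2]
    · rw [isolate_of_ne hvw huw]
  rw [← avg_avg_of_subset hsub, ← avg_avg_of_subset (x := isolate w x) hsub,
    avg_eq_avg_piecewise _ _ _ x (isolate w x), ← avg_sub]
  refine (abs_avg_le h.isProb).trans ?_
  have hbad := avg_not_fewNbrs_le h (U := A) (Y := Oᶜ) hAW hWc hOc x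
  refine le_trans ?_ (add_le_add_right hbad _)
  rw [← avg_const (q := fun _ : Sym2 V => p) (S := away W) (x := x)
    (32 * #(A ∩ nbr x w) / s ^ 2), ← avg_add]
  refine avg_mono h.isProb fun y hy => ?_
  set y' := (away W).piecewise y (isolate w x) with hy'
  have hyA : nbr y v = A := nbr_eq_of_away hvW hy
  have hyA' : nbr y' v = A := by
    rw [← hiso]
    exact nbr_eq_of_away hvW fun e he => by simp [hy', he]
  rw [key y hyA, key y' hyA']
  -- For `u ∈ A` the two configurations differ at the edge from `u` to `w` only.
  have hyy : ∀ u ∈ A, ∀ b, b ≠ w → y' s(u, b) = y s(u, b) := by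
    intro u hu b hb
    have huW : u ∉ W := Finset.disjoint_left.1 hAW hu
    have huw : u ≠ w := fun h => huW (h ▸ hwW)
    by_cases hm : s(u, b) ∈ away W
    · simp [hy', hm]
    · rw [hy', Finset.piecewise_eq_of_notMem _ _ _ hm, isolate_of_ne huw hb, hy _ hm]
  have hyw : ∀ u ∈ A, y' s(u, w) = false := by
    intro u hu
    have hm : s(u, w) ∉ away W := fun hm => (mk_mem_away.1 hm).2 hwW
    rw [hy', Finset.piecewise_eq_of_notMem _ _ _ hm, isolate, Finset.piecewise_eq_of_mem]
    exact mk_mem_spokes_univ.2 (Or.inr rfl)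
  have hnbr : ∀ u ∈ A, nbr y' u ⊆ nbr y u := by
    intro u hu b hb
    rw [mem_nbr] at hb ⊢
    refine ⟨hb.1, ?_⟩
    by_cases hbw : b = w
    · subst hbw; rw [hyw u hu] at hb; exact absurd hb.2 (by simp)
    · rw [← hyy u hu b hbw]; exact hb.2
  split_ifs with hfew
  · have hfew' : FewNbrs s A Oᶜ y' := fun u hu => le_trans
      (by exact_mod_cast card_le_card (inter_subset_inter_left (hnbr u hu))) (hfew u hu)
    have h1 := abs_tail_redProb_sub_le (z := fun u => colorSum ℓ y u Oᶜ)
      (z' := fun u => colorSum ℓ y' u Oᶜ) hp.le hp1 (by linarith) hvar hOcol hA2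
      (fun u hu => (hfew.abs_colorSum_le Subset.rfl hu).trans (by linarith))
      (fun u hu => (hfew'.abs_colorSum_le Subset.rfl hu).trans (by linarith)) τ τ
    refine h1.trans ?_
    simp only [sub_self, abs_zero, mul_zero, add_zero]
    have h2 : ∑ u ∈ A, |(colorSum ℓ y u Oᶜ : ℝ) - colorSum ℓ y' u Oᶜ| ≤ #(A ∩ nbr x w) := by
      rw [← filter_mem_eq_inter, card_filter]
      push_cast
      refine sum_le_sum fun u hu => (abs_colorSum_sub_le u Oᶜ).trans ?_
      have huW : u ∉ W := Finset.disjoint_left.1 hAW hu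
      have huw : u ≠ w := fun h => huW (h ▸ hwW)
      have h3 : ∀ b, y s(u, b) ≠ y' s(u, b) → b = w ∧ u ∈ nbr x w := by
        intro b hb
        have hbw : b = w := by
          by_contra hbw
          exact hb (hyy u hu b hbw).symm
        subst hbw
        refine ⟨rfl, mem_nbr.2 ⟨huw, ?_⟩⟩
        rw [hyw u hu] at hb
        have hm : s(u, b) ∉ away W := fun hm => (mk_mem_away.1 hm).2 hwW
        rw [hy _ hm] at hb
        rw [Sym2.eq_swap]
        simpa using hb
      split_ifs with huB
      · have : #{b ∈ Oᶜ | y s(u, b) ≠ y' s(u, b)} ≤ 1 :=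
          card_le_one.2 fun a ha c hc =>
            (h3 a (mem_filter.1 ha).2).1.trans (h3 c (mem_filter.1 hc).2).1.symm
        exact_mod_cast this
      · have : #{b ∈ Oᶜ | y s(u, b) ≠ y' s(u, b)} = 0 := by
          rw [card_eq_zero, filter_eq_empty_iff]
          intro b _ hb
          exact huB (h3 b hb).2
        rw [this]; simp
    calc _ ≤ 32 / s ^ 2 * #(A ∩ nbr x w) := mul_le_mul_of_nonneg_left h2 (by positivity)
      _ = _ := by ring
  · have h01 : ∀ y, 0 ≤ f y ∧ f y ≤ 1 := fun y =>
      ⟨tail_nonneg (isProb_redProb hp.le hp1 _) τ, tail_le_one (isProb_redProb hp.le hp1 _) τ⟩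
    have h2 := h01 y
    have h3 := h01 y'
    have h4 : |f y - f y'| ≤ 1 := by
      rw [abs_le]; constructor <;> linarith [h2.1, h2.2, h3.1, h3.2]
    have : (0 : ℝ) ≤ 32 * #(A ∩ nbr x w) / s ^ 2 := by positivity
    linarith

lemma card_nbr_eq_sum (y : Sym2 V → Bool) (v : V) :
    (#(nbr y v) : ℝ) = ∑ e ∈ spokes v (univ.erase v), if y e then (1 : ℝ) else 0 := by
  rw [spokes, sum_image fun a _ b _ hab => Sym2.congr_right.1 hab]
  have : nbr y v = (univ.erase v).filter fun u => y s(v, u) = true := by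
    ext u; simp [mem_nbr]
  rw [this, card_filter]
  push_cast
  rfl

lemma card_spokes_erase (v : V) : (#(spokes v (univ.erase v)) : ℝ) = Fintype.card V - 1 := by
  have hpos : 1 ≤ Fintype.card V := Fintype.card_pos_iff.2 ⟨v⟩
  rw [spokes, card_image_of_injective _ fun a b hab => Sym2.congr_right.1 hab, card_erase_of_mem
    (mem_univ v), card_univ, Nat.cast_sub hpos, Nat.cast_one]

lemma avg_sq_card_nbr_sub_le (h : Regime V p s L) (v : V) (x : Sym2 V → Bool) :
    avg (fun _ => p) univ (fun y => (#(nbr y v) - (s ^ 2 - p)) ^ 2) x ≤ s ^ 2 := by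
  have hp1 : p ≤ 1 := by linarith [h.p_le]
  have h1 := avg_sq_sum_bits_sub_le h.p_pos.le hp1 (spokes v (univ.erase v)) x
  rw [card_spokes_erase] at h1
  have h2 : p * ((Fintype.card V : ℝ) - 1) = s ^ 2 - p := by rw [h.sq_s]; ring
  rw [h2] at h1
  simp only [card_nbr_eq_sum]
  linarith [h.p_pos]

/-- The second moment of the number of common neighbours. -/
lemma avg_sq_card_inter_le (h : Regime V p s L) (hvw : v ≠ w) (x : Sym2 V → Bool) :
    avg (fun _ => p) univ (fun y => (#(nbr y v ∩ nbr y w) : ℝ) ^ 2) x ≤ 2 * L := by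
  set U : Finset V := univ \ {v, w} with hU
  have hUv : ∀ u ∈ U, u ≠ v ∧ u ≠ w := by
    intro u hu
    simpa [hU, not_or] using hu
  set b : V → (Sym2 V → Bool) → ℝ := fun u y => if y s(v, u) = true ∧ y s(w, u) = true then 1 else 0
    with hb
  have hcard : ∀ y, (#(nbr y v ∩ nbr y w) : ℝ) = ∑ u ∈ U, b u y := by
    intro y
    have : nbr y v ∩ nbr y w = U.filter fun u => y s(v, u) = true ∧ y s(w, u) = true := by
      ext u
      simp only [mem_inter, mem_nbr, mem_filter, hU, mem_sdiff, mem_univ, mem_insert,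
        mem_singleton, true_and, not_or]
      tauto
    rw [this, card_filter]
    push_cast
    rfl
  have hsq : ∀ y, (#(nbr y v ∩ nbr y w) : ℝ) ^ 2 = ∑ u ∈ U, ∑ u' ∈ U, b u y * b u' y := by
    intro y
    rw [hcard, pow_two, sum_mul_sum]
  have hprod : ∀ (T : Finset (Sym2 V)), avg (fun _ => p) univ
      (fun y => if ∀ e ∈ T, y e = true then 1 else 0) x = p ^ #T := by
    intro T
    have := avg_prod (q := fun _ : Sym2 V => p) (x := x) (S := univ) (T := T)
      (fun _ b => if b then 1 else 0) (subset_univ T)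
    rw [avg_congr (g := fun y => ∏ e ∈ T, if y e then (1 : ℝ) else 0), this]
    · simp
    · intro y _
      rw [prod_boole]
      congr
  have hdiag : ∀ u ∈ U, avg (fun _ => p) univ (fun y => b u y * b u y) x = p ^ 2 := by
    intro u hu
    have h1 : #({s(v, u), s(w, u)} : Finset (Sym2 V)) = 2 := by
      rw [card_pair]
      intro he
      rw [Sym2.eq_iff] at he
      rcases he with ⟨h1, -⟩ | ⟨h1, h2⟩
      · exact hvw h1
      · exact (hUv u hu).1 h1.symm
    rw [← h1, ← hprod]
    refine avg_congr fun y _ => ?_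
    simp only [hb, mem_insert, mem_singleton, forall_eq_or_imp, forall_eq]
    split_ifs <;> norm_num
  have hoff : ∀ u ∈ U, ∀ u' ∈ U, u ≠ u' →
      avg (fun _ => p) univ (fun y => b u y * b u' y) x = p ^ 4 := by
    intro u hu u' hu' huu
    obtain ⟨a1, a2⟩ := hUv u hu
    obtain ⟨a3, a4⟩ := hUv u' hu'
    have h1 : #({s(v, u), s(w, u), s(v, u'), s(w, u')} : Finset (Sym2 V)) = 4 := by
      rw [card_insert_of_notMem, card_insert_of_notMem, card_pair]
      · simp [hvw, a3.symm]
      · simp [huu, hvw.symm, a2, a4.symm]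
      · simp [huu, hvw, a1, a1.symm, a3.symm]
    rw [← h1, ← hprod]
    refine avg_congr fun y _ => ?_
    simp only [hb, mem_insert, mem_singleton, forall_eq_or_imp, forall_eq]
    by_cases e1 : y s(v, u) = true <;> by_cases e2 : y s(w, u) = true <;>
      by_cases e3 : y s(v, u') = true <;> by_cases e4 : y s(w, u') = true <;> simp [e1, e2, e3, e4]
  simp only [hsq]
  rw [avg_sum]
  simp only [avg_sum]
  have hp := h.p_pos
  have hterm : ∀ u ∈ U, ∀ u' ∈ U, avg (fun _ => p) univ (fun y => b u y * b u' y) x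
      ≤ (if u = u' then p ^ 2 else 0) + p ^ 4 := by
    intro u hu u' hu'
    split_ifs with huu
    · subst huu; rw [hdiag u hu]; linarith [pow_pos hp 4]
    · rw [hoff u hu u' hu' huu]; linarith
  refine (sum_le_sum fun u hu => sum_le_sum fun u' hu' => hterm u hu u' hu').trans ?_
  have hUc : (#U : ℝ) ≤ Fintype.card V := by exact_mod_cast card_le_univ U
  have h1 : ∑ u ∈ U, ∑ u' ∈ U, ((if u = u' then p ^ 2 else 0) + p ^ 4)
      = #U * p ^ 2 + #U * #U * p ^ 4 := by
    simp only [sum_add_distrib, sum_ite_eq, sum_const, nsmul_eq_mul]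
    rw [sum_congr rfl (g := fun _ => p ^ 2) fun u hu => by rw [if_pos hu]]
    rw [sum_const, nsmul_eq_mul]; ring
  rw [h1]
  have hU0 : (0 : ℝ) ≤ #U := Nat.cast_nonneg _
  have h2 : (#U : ℝ) * p ^ 2 ≤ p * s ^ 2 := by
    rw [h.sq_s]; nlinarith [mul_le_mul_of_nonneg_right hUc (sq_nonneg p)]
  have h3 : (#U : ℝ) * #U * p ^ 4 ≤ (p * s ^ 2) ^ 2 := by
    have := pow_le_pow_left₀ (by positivity) h2 2
    nlinarith
  linarith [h.codeg_le, h.codeg]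

open Classical in
lemma avg_not_typical_le (h : Regime V p s L) (hvw : v ≠ w) (x : Sym2 V → Bool) :
    avg (fun _ => p) univ (fun y => if Typical s v w y then 0 else 1) x ≤ 20 * L / s ^ 2 := by
  have hs := h.s_ge
  have hp := h.p_pos
  have hL := h.one_le
  have hs2 : (1000000 : ℝ) ≤ s ^ 2 := by nlinarith
  have key : ∀ y : Sym2 V → Bool, (if Typical s v w y then (0 : ℝ) else 1)
      ≤ (if y s(v, w) then 1 else 0) + 9 / s ^ 4 * (#(nbr y v) - (s ^ 2 - p)) ^ 2
        + 9 / s ^ 4 * (#(nbr y w) - (s ^ 2 - p)) ^ 2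
        + 16 / s ^ 4 * (#(nbr y v ∩ nbr y w) : ℝ) ^ 2 := by
    intro y
    have n1 : (0 : ℝ) ≤ if y s(v, w) then 1 else 0 := by split_ifs <;> norm_num
    have n2 : 0 ≤ 9 / s ^ 4 * (#(nbr y v) - (s ^ 2 - p)) ^ 2 := by positivity
    have n3 : 0 ≤ 9 / s ^ 4 * (#(nbr y w) - (s ^ 2 - p)) ^ 2 := by positivity
    have n4 : 0 ≤ 16 / s ^ 4 * (#(nbr y v ∩ nbr y w) : ℝ) ^ 2 := by positivity
    have hdev : ∀ a : ℝ, ¬ |a - (s ^ 2 - p)| ≤ s ^ 2 / 3 → 1 ≤ 9 / s ^ 4 * (a - (s ^ 2 - p)) ^ 2 := by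
      intro a ha
      rw [div_mul_eq_mul_div, le_div_iff₀ (by positivity), ← sq_abs]
      have h1 := pow_le_pow_left₀ (by positivity) (not_le.1 ha).le 2
      nlinarith
    by_cases e1 : y s(v, w) = true
    · rw [if_pos e1] at n1 ⊢
      split_ifs <;> linarith
    by_cases e2 : |(#(nbr y v) : ℝ) - (s ^ 2 - p)| ≤ s ^ 2 / 3
    swap
    · have := hdev _ e2
      split_ifs <;> linarith
    by_cases e3 : |(#(nbr y w) : ℝ) - (s ^ 2 - p)| ≤ s ^ 2 / 3
    swap
    · have := hdev _ e3
      split_ifs <;> linarith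
    by_cases e4 : (#(nbr y v ∩ nbr y w) : ℝ) ≤ s ^ 2 / 4
    swap
    · have : 1 ≤ 16 / s ^ 4 * (#(nbr y v ∩ nbr y w) : ℝ) ^ 2 := by
        rw [div_mul_eq_mul_div, le_div_iff₀ (by positivity)]
        have h1 := pow_le_pow_left₀ (by positivity) (not_le.1 e4).le 2
        nlinarith
      split_ifs <;> linarith
    have e2' := abs_le.1 e2
    have e3' := abs_le.1 e3
    have hp1 := h.p_le
    rw [if_pos]
    · linarith
    · exact ⟨fun hm => e1 (mem_nbr.1 hm).2, by linarith [e2'.1], by linarith [e2'.2],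
        by linarith [e3'.1], by linarith [e3'.2], e4⟩
  refine (avg_mono h.isProb fun y _ => key y).trans ?_
  rw [avg_add, avg_add, avg_add, avg_const_mul, avg_const_mul, avg_const_mul,
    avg_bit (mem_univ _)]
  have h1 := avg_sq_card_nbr_sub_le h v x
  have h2 := avg_sq_card_nbr_sub_le h w x
  have h3 := avg_sq_card_inter_le h hvw x
  have c1 : (0 : ℝ) ≤ 9 / s ^ 4 := by positivity
  have c2 : (0 : ℝ) ≤ 16 / s ^ 4 := by positivity
  have g1 := mul_le_mul_of_nonneg_left h1 c1
  have g2 := mul_le_mul_of_nonneg_left h2 c1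
  have g3 := mul_le_mul_of_nonneg_left h3 c2
  have g4 : 9 / s ^ 4 * s ^ 2 = 9 / s ^ 2 := by field_simp
  have g5 : 16 / s ^ 4 * (2 * L) ≤ L / s ^ 2 := by
    rw [div_mul_eq_mul_div, div_le_div_iff₀ (by positivity) (by positivity)]
    nlinarith [mul_nonneg (mul_nonneg (by linarith : (0 : ℝ) ≤ L) (sq_nonneg s))
      (by linarith : (0 : ℝ) ≤ s ^ 2 - 32)]
  have g6 : p ≤ L / s ^ 2 := by
    rw [le_div_iff₀ (by positivity)]; exact h.codeg_le
  have g7 : 18 / s ^ 2 ≤ 18 * (L / s ^ 2) := by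
    rw [← mul_div_assoc]; exact div_le_div_of_nonneg_right (by linarith) (by positivity)
  have g8 : 20 * L / s ^ 2 = 20 * (L / s ^ 2) := by ring
  have g9 : 9 / s ^ 2 + 9 / s ^ 2 = 18 / s ^ 2 := by ring
  linarith

open Classical in
/-- The events that the day `1` colors around two vertices have sum at least `τ` are nearly
uncorrelated. -/
lemma covar_sumGe_le (h : Regime V p s L) (hvw : v ≠ w)
    (hR : (red ℓ).ncard = ⌈(Fintype.card V : ℝ) / 2⌉₊) (τ : ℤ) (x : Sym2 V → Bool) :
    covar (fun _ => p) univ (sumGe ℓ τ v) (sumGe ℓ τ w) x ≤ 150000 * L / s ^ 2 := by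
  have hs := h.s_ge
  have hp := h.p_pos
  have hL := h.one_le
  set W : Finset V := {v, w} with hW
  set η := Real.exp (-(60 * L)) with hη
  set β := avg (fun _ => p) univ (fun y => if Typical s v w y then (0 : ℝ) else 1) x with hβ
  have hβle : β ≤ 20 * L / s ^ 2 := avg_not_typical_le h hvw x
  set f := avg (fun _ => p) (away W) (sumGe ℓ τ v) with hf
  set g := avg (fun _ => p) (away W) (sumGe ℓ τ w) with hg
  have hf01 : ∀ y, 0 ≤ f y ∧ f y ≤ 1 := fun y =>
    ⟨const_le_avg h.isProb fun z => (sumGe_mem τ v z).1,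
      avg_le_const h.isProb fun z => (sumGe_mem τ v z).2⟩
  have hg01 : ∀ y, 0 ≤ g y ∧ g y ≤ 1 := fun y =>
    ⟨const_le_avg h.isProb fun z => (sumGe_mem τ w z).1,
      avg_le_const h.isProb fun z => (sumGe_mem τ w z).2⟩
  set κ := avg (fun _ => p) univ (fun y => (#(nbr y v ∩ nbr y w) : ℝ) ^ 2) x with hκ
  have hκle : κ ≤ 2 * L := avg_sq_card_inter_le h hvw x
  -- The part of the covariance coming from the edges away from `v` and `w`.
  have h1 : avg (fun _ => p) univ (covar (fun _ => p) (away W) (sumGe ℓ τ v) (sumGe ℓ τ w)) x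
      ≤ 288 / s ^ 2 * κ + (148000 * p + 1 / s ^ 2) + β := by
    rw [hκ, ← avg_const_mul, ← avg_const (q := fun _ : Sym2 V => p) (S := univ) (x := x)
      (148000 * p + 1 / s ^ 2), ← avg_add, hβ, ← avg_add]
    refine avg_mono h.isProb fun y _ => ?_
    split_ifs with hy
    · refine (covar_sumGe_away_le h hy hR τ).trans (le_of_eq ?_)
      ring
    · refine (covar_le_one h.isProb (sumGe_mem τ v) (sumGe_mem τ w)).trans ?_
      have : 0 ≤ 288 / s ^ 2 * (#(nbr y v ∩ nbr y w) : ℝ) ^ 2 + (148000 * p + 1 / s ^ 2) := by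
        positivity
      linarith
  -- The part coming from the edges at `v` and `w`.
  have hδ : ∀ a b : V, a ≠ b → ({a, b} : Finset V) = W →
      (∀ y, Typical s v w y → Typical s a b y) →
      (∀ y, #(nbr y a ∩ nbr y b) = #(nbr y v ∩ nbr y w)) →
      avg (fun _ => p) univ (fun y => |avg (fun _ => p) (away W) (sumGe ℓ τ a) y
        - avg (fun _ => p) (away W) (sumGe ℓ τ a) (isolate b y)|) x
        ≤ 32 / s ^ 2 * κ + η + β := by
    intro a b hab habW htyp hint
    rw [hκ, ← avg_const_mul, ← avg_const (q := fun _ : Sym2 V => p) (S := univ) (x := x) η,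
      ← avg_add, hβ, ← avg_add]
    refine avg_mono h.isProb fun y _ => ?_
    split_ifs with hy
    · have h2 := abs_avg_sumGe_sub_isolate_le h hab (htyp y hy) hR τ
      rw [habW, hint] at h2
      refine h2.trans ?_
      have h3 : (#(nbr y v ∩ nbr y w) : ℝ) ≤ (#(nbr y v ∩ nbr y w) : ℝ) ^ 2 := by
        exact_mod_cast Nat.le_self_pow (by norm_num) _
      have h4 : 32 * (#(nbr y v ∩ nbr y w) : ℝ) / s ^ 2
          ≤ 32 / s ^ 2 * (#(nbr y v ∩ nbr y w) : ℝ) ^ 2 := by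
        rw [div_mul_eq_mul_div]
        exact div_le_div_of_nonneg_right (by linarith) (by positivity)
      linarith
    · have e1 : ∀ z, 0 ≤ avg (fun _ => p) (away W) (sumGe ℓ τ a) z ∧
          avg (fun _ => p) (away W) (sumGe ℓ τ a) z ≤ 1 := fun y =>
        ⟨const_le_avg h.isProb fun z => (sumGe_mem τ a z).1,
          avg_le_const h.isProb fun z => (sumGe_mem τ a z).2⟩
      have e2 := e1 y
      have e3 := e1 (isolate b y)
      have e4 : |avg (fun _ => p) (away W) (sumGe ℓ τ a) y
          - avg (fun _ => p) (away W) (sumGe ℓ τ a) (isolate b y)| ≤ 1 := by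
        rw [abs_le]; constructor <;> linarith [e2.1, e2.2, e3.1, e3.2]
      have : 0 ≤ 32 / s ^ 2 * (#(nbr y v ∩ nbr y w) : ℝ) ^ 2 + η := by positivity
      linarith
  have hδv := hδ v w hvw rfl (fun _ hy => hy) fun _ => rfl
  have hδw := hδ w v hvw.symm (pair_comm _ _) (fun _ hy => hy.symm) fun _ => by rw [inter_comm]
  have hindep : covar (fun _ => p) univ (fun y => f (isolate w y)) (fun y => g (isolate v y)) x
      = 0 := by
    have i1 : Ignores (fun y => f (isolate w y)) (spokes w univ) := by
      intro y z hyz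
      have : isolate w y = isolate w z := by
        ext e
        by_cases he : e ∈ spokes w univ
        · simp [isolate, he]
        · simp [isolate, he, hyz e he]
      simp only [this]
    have i2 : Ignores (fun y => g (isolate v y)) (univ \ spokes w univ) := by
      intro y z hyz
      refine ignores_avg _ _ _ _ _ fun e he => ?_
      by_cases hev : e ∈ spokes v univ
      · simp [isolate, hev]
      · have hew : e ∈ spokes w univ := by
          rw [mem_away] at he
          push Not at he
          obtain ⟨u, hu, hue⟩ := he
          rw [hW, mem_insert, mem_singleton] at hu
          have : ∀ a : V, a ∈ e → e ∈ spokes a univ := by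
            intro a ha
            obtain ⟨b, rfl⟩ := Sym2.mem_iff_exists.1 ha
            exact mk_mem_spokes_univ.2 (Or.inl rfl)
          rcases hu with rfl | rfl
          · exact absurd (this _ hue) hev
          · exact this _ hue
        simp [isolate, hev, hyz e (by simp [hew])]
    have huniv : (univ : Finset (Sym2 V)) = (univ \ spokes w univ) ∪ spokes w univ :=
      (sdiff_union_of_subset (subset_univ _)).symm
    rw [covar, huniv]
    rw [avg_mul_of_ignores_of_ignores i1 i2, sub_self]
  have h2 := covar_le_covar_add (S := univ) (x := x) (f := f) (g := g)
    (φ := fun y => f (isolate w y)) (ψ := fun y => g (isolate v y)) (h.isProb (κ := Sym2 V)) hf01 hg01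
    (fun y => hf01 _) (fun y => hg01 _)
  rw [hindep] at h2
  have h3 := covar_union (q := fun _ : Sym2 V => p) (f := sumGe ℓ τ v) (g := sumGe ℓ τ w) (x := x)
    univ (away W)
  rw [union_eq_left.2 (subset_univ _)] at h3
  rw [h3]
  have hη1 : η ≤ L / s ^ 2 := by
    rw [le_div_iff₀ (by positivity)]
    have hη0 : 0 ≤ η := (Real.exp_pos _).le
    have hη8 : η * s ^ 8 ≤ 1 := h.exp_mul_pow_le
    have h5 : s ^ 2 ≤ s ^ 8 := pow_le_pow_right₀ (by linarith) (by norm_num)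
    nlinarith
  have hp' : p ≤ L / s ^ 2 := by
    rw [le_div_iff₀ (by positivity)]; exact h.codeg_le
  have hκ1 : 288 / s ^ 2 * κ ≤ 576 * (L / s ^ 2) := by
    calc 288 / s ^ 2 * κ ≤ 288 / s ^ 2 * (2 * L) := mul_le_mul_of_nonneg_left hκle (by positivity)
      _ = _ := by ring
  have hκ2 : 32 / s ^ 2 * κ ≤ 64 * (L / s ^ 2) := by
    calc 32 / s ^ 2 * κ ≤ 32 / s ^ 2 * (2 * L) := mul_le_mul_of_nonneg_left hκle (by positivity)
      _ = _ := by ring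
  have h1s : 1 / s ^ 2 ≤ L / s ^ 2 := div_le_div_of_nonneg_right hL (by positivity)
  have hβ' : β ≤ 20 * (L / s ^ 2) := by rw [← mul_div_assoc]; exact hβle
  have hfin : 150000 * L / s ^ 2 = 150000 * (L / s ^ 2) := by ring
  have hLs : 0 ≤ L / s ^ 2 := by positivity
  linarith

end Covariance

/-! ### The small ball probability of the sum of the day `1` colors around a vertex -/

section NextSumSmallBall

variable {V : Type} [Fintype V] [DecidableEq V] {ℓ : Coloring V} {x y : Sym2 V → Bool}
  {p s L : ℝ} {v : V}

lemma ignores_sg_redNext {u u' : V} {O : Finset V} (hu : u ≠ u') (huO : u ∉ O) :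
    Ignores (fun x => (sg (redNext ℓ x u) : ℝ)) (spokes u' O) := by
  intro x y h
  have := ignores_redNext (ℓ := ℓ) hu huO x y h
  simp only at this
  simp only [this]

/-- The day `1` color of `u` is nearly unbiased given the edges outside a balanced set that misses
only a few vertices. -/
lemma abs_avg_sg_redNext_le (h : Regime V p s L) {O : Finset V} {u : V} (huO : u ∉ O)
    (hO : ∑ o ∈ O, (ℓ o : ℤ) = 0) (hOc : #Oᶜ ≤ 7) (x : Sym2 V → Bool) :
    |avg (fun _ => p) (spokes u O) (fun y => (sg (redNext ℓ y u) : ℝ)) x| ≤ 34 / s := by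
  have hs := h.s_ge
  have hp1 : p ≤ 1 := by linarith [h.p_le]
  have hOc' : (#Oᶜ : ℝ) ≤ 7 := by exact_mod_cast hOc
  have h1 : (fun y : Sym2 V → Bool => (sg (redNext ℓ y u) : ℝ))
      = fun y => 2 * (if redNext ℓ y u then 1 else 0) - 1 := by
    ext y; cases redNext ℓ y u <;> norm_num
  rw [h1, avg_sub, avg_const_mul, avg_const, avg_redNext huO]
  have h2 := abs_two_mul_colorTail_sub_one_le (ℓ := ℓ) h.p_pos.le hp1 (by linarith)
    (h.variance_le (by nlinarith)) hO (redThreshold ℓ u - colorSum ℓ x u Oᶜ)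
  refine h2.trans (div_le_div_of_nonneg_right ?_ (by linarith))
  have h3 : |(colorSum ℓ x u Oᶜ : ℝ)| ≤ 7 := by
    refine (abs_colorSum_le u Oᶜ).trans (le_trans ?_ hOc')
    exact_mod_cast card_le_card inter_subset_left
  have h4 : |((redThreshold ℓ u - colorSum ℓ x u Oᶜ : ℤ) : ℝ)| ≤ 8 := by
    push_cast
    rw [abs_le] at h3 ⊢
    rcases redThreshold_mem (ℓ := ℓ) u with h0 | h0 <;> rw [h0] <;> push_cast <;>
      constructor <;> linarith [h3.1, h3.2]
  linarith

/-- The day `1` colors of two vertices are nearly uncorrelated. -/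
lemma abs_avg_sg_mul_sg_le (h : Regime V p s L)
    (hR : (red ℓ).ncard = ⌈(Fintype.card V : ℝ) / 2⌉₊) {u u' : V} (huv : u ≠ v) (hu'v : u' ≠ v)
    (huu : u ≠ u') (x : Sym2 V → Bool) :
    |avg (fun _ => p) (away {v})
      (fun y => (sg (redNext ℓ y u) : ℝ) * (sg (redNext ℓ y u') : ℝ)) x| ≤ 1156 / s ^ 2 := by
  have hs := h.s_ge
  obtain ⟨O, hWO, hO, hOc⟩ := exists_balanced hR {u, u', v}
  have hc : #({u, u', v} : Finset V) ≤ 3 := card_le_three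
  have hOc : #Oᶜ ≤ 7 := by omega
  have huO : u ∉ O := disjoint_left.1 hWO (by simp)
  have hu'O : u' ∉ O := disjoint_left.1 hWO (by simp)
  have hvO : v ∉ O := disjoint_left.1 hWO (by simp)
  have hsub : ∀ a, a ≠ v → spokes a O ⊆ away {v} := by
    intro a ha e he
    obtain ⟨o, ho, rfl⟩ := mem_spokes.1 he
    rw [mk_mem_away, mem_singleton, mem_singleton]
    exact ⟨ha, fun h => hvO (h ▸ ho)⟩
  rw [← avg_avg_of_subset (union_subset (hsub u huv) (hsub u' hu'v))]
  refine (abs_avg_le h.isProb).trans (avg_le_const h.isProb fun y => ?_)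
  have i1 := ignores_sg_redNext (ℓ := ℓ) huu huO
  have i2 := ignores_sg_redNext (ℓ := ℓ) huu.symm hu'O
  rw [avg_mul_of_ignores_of_ignores i1 i2, avg_union_of_ignores i2, union_comm,
    avg_union_of_ignores i1, abs_mul]
  calc _ ≤ 34 / s * (34 / s) := mul_le_mul (abs_avg_sg_redNext_le h huO hO hOc y)
        (abs_avg_sg_redNext_le h hu'O hO hOc y) (abs_nonneg _) (by positivity)
    _ = _ := by ring

lemma avg_sq_sum_sg_le (h : Regime V p s L) (hR : (red ℓ).ncard = ⌈(Fintype.card V : ℝ) / 2⌉₊)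
    {A : Finset V} (hvA : v ∉ A) (hA : (#A : ℝ) ≤ 2 * s ^ 2) (x : Sym2 V → Bool) :
    avg (fun _ => p) (away {v}) (fun y => ((∑ u ∈ A, sg (redNext ℓ y u) : ℤ) : ℝ) ^ 2) x
      ≤ 2313 * #A := by
  have hs := h.s_ge
  have h1 : (fun y : Sym2 V → Bool => ((∑ u ∈ A, sg (redNext ℓ y u) : ℤ) : ℝ) ^ 2)
      = fun y => ∑ u ∈ A, ∑ u' ∈ A, (sg (redNext ℓ y u) : ℝ) * (sg (redNext ℓ y u') : ℝ) := by
    ext y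
    push_cast
    rw [pow_two, sum_mul_sum]
  rw [h1, avg_sum]
  simp only [avg_sum]
  have hterm : ∀ u ∈ A, ∀ u' ∈ A, avg (fun _ => p) (away {v})
      (fun y => (sg (redNext ℓ y u) : ℝ) * (sg (redNext ℓ y u') : ℝ)) x
      ≤ (if u = u' then 1 else 0) + 1156 / s ^ 2 := by
    intro u hu u' hu'
    have hne : ∀ a ∈ A, a ≠ v := fun a ha h => hvA (h ▸ ha)
    split_ifs with huu
    · subst huu
      have : (0 : ℝ) ≤ 1156 / s ^ 2 := by positivity
      refine (avg_le_const h.isProb (c := 1) fun y => ?_).trans (by linarith)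
      cases redNext ℓ y u <;> norm_num
    · rw [zero_add]
      exact (le_abs_self _).trans (abs_avg_sg_mul_sg_le h hR (hne u hu) (hne u' hu') huu x)
  refine (sum_le_sum fun u hu => sum_le_sum fun u' hu' => hterm u hu u' hu').trans ?_
  have h2 : ∑ u ∈ A, ∑ u' ∈ A, ((if u = u' then (1 : ℝ) else 0) + 1156 / s ^ 2)
      = #A + #A * (#A * (1156 / s ^ 2)) := by
    simp only [sum_add_distrib, sum_ite_eq, sum_const, nsmul_eq_mul]
    rw [sum_congr rfl (g := fun _ => (1 : ℝ)) fun u hu => by rw [if_pos hu]]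
    simp
  rw [h2]
  have h3 : (#A : ℝ) * (1156 / s ^ 2) ≤ 2312 := by
    rw [← mul_div_assoc, div_le_iff₀ (by positivity)]; linarith
  have h4 : (0 : ℝ) ≤ #A := Nat.cast_nonneg _
  nlinarith

open Classical in
/-- The sum of the day `1` colors around a vertex lies within `D` of the origin with probability of
order `D / √(p n)`. -/
lemma exists_nextSum_small_ball :
    ∃ c > 0, ∃ s₀ : ℝ, ∀ {V : Type} [Fintype V] [DecidableEq V] (ℓ : Coloring V) (p s L D : ℝ)
      (v : V) (x : Sym2 V → Bool), Regime V p s L → s₀ ≤ s →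
      (red ℓ).ncard = ⌈(Fintype.card V : ℝ) / 2⌉₊ → 2 ≤ D → D ≤ s / 2 →
      c * D / s ≤ avg (fun _ => p) univ (fun y => if |(nextSum ℓ y v : ℝ)| ≤ D then 1 else 0) x := by
  obtain ⟨c, hc, k₀, hball⟩ := exists_small_ball 200 (by norm_num)
  refine ⟨c / 32, by positivity, 2 * k₀, ?_⟩
  intro V _ _ ℓ p s L D v x h hs₀ hR hD hDs
  have hs := h.s_ge
  have hp := h.p_pos
  have hp1 : p ≤ 1 := by linarith [h.p_le]
  have hs2 : s ≤ s ^ 2 := by nlinarith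
  set η := Real.exp (-(60 * L)) with hη
  have hη1 : η ≤ 1 / 8 := by
    have h8 : η * s ^ 8 ≤ 1 := h.exp_mul_pow_le
    have h9 : (8 : ℝ) ≤ s ^ 8 :=
      le_trans (by linarith) (le_self_pow₀ (by linarith : (1 : ℝ) ≤ s) (by norm_num : 8 ≠ 0))
    have : 0 < η := Real.exp_pos _
    nlinarith
  have main : ∀ y : Sym2 V → Bool, s ^ 2 / 2 ≤ #(nbr y v) → (#(nbr y v) : ℝ) ≤ 2 * s ^ 2 →
      c * D / (16 * s)
        ≤ avg (fun _ => p) (away {v}) (fun y => if |(nextSum ℓ y v : ℝ)| ≤ D then 1 else 0) y := by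
    intro x hx1 hx2
    set A := nbr x v with hA
    have hvA : v ∉ A := notMem_nbr_self v
    obtain ⟨O, hd, hO, hOc⟩ := exists_balanced hR (A ∪ {v})
    rw [disjoint_union_left, disjoint_singleton_left] at hd
    obtain ⟨hAO, hvO⟩ := hd
    have hOc' : (#Oᶜ : ℝ) ≤ 9 * s ^ 2 := by
      have h1 : #(A ∪ {v}) ≤ #A + 1 := (card_union_le _ _).trans (by simp)
      have h2 : #Oᶜ ≤ 2 * (#A + 1) + 1 := by omega
      have h3 : (#Oᶜ : ℝ) ≤ 2 * (#A + 1) + 1 := by exact_mod_cast h2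
      nlinarith
    have hAW : Disjoint A {v} := disjoint_singleton_right.2 hvA
    have hOW : Disjoint O {v} := disjoint_singleton_right.2 hvO
    have hsub := cut_subset_away hAW hOW
    set k : ℝ := ((#A : ℕ) : ℝ) with hk
    have hk0 : 0 < k := by nlinarith
    have hsk : s / 2 ≤ √k := by
      apply Real.le_sqrt_of_sq_le
      nlinarith
    have hsk' : √k ≤ 2 * s := by
      rw [Real.sqrt_le_left (by linarith)]
      nlinarith
    have hskpos : 0 < √k := by linarith
    set a := c * D / √k with ha
    have ha0 : 0 ≤ a := by positivity
    set S : (Sym2 V → Bool) → ℤ := fun y => ∑ u ∈ A, sg (redNext ℓ y u) with hS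
    have hbad := avg_not_fewNbrs_le h (U := A) (Y := Oᶜ) hAW (by simp) hOc' x
    have hsecond := avg_sq_sum_sg_le h hR hvA hx2 x
    have e1 : avg (fun _ => p) (away {v}) (fun y => if |(nextSum ℓ y v : ℝ)| ≤ D then 1 else 0) x
        = avg (fun _ => p) (away {v}) (fun y => if |(S y : ℝ)| ≤ D then 1 else 0) x := by
      refine avg_congr fun y hy => ?_
      rw [nextSum, nbr_eq_of_away (mem_singleton_self v) hy]
    have hign : ∀ G : ℤ → ℝ, Ignores (fun b : V → Bool => G (∑ u ∈ A, sg (b u))) Aᶜ := by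
      intro G b b' hb
      have : ∑ u ∈ A, sg (b u) = ∑ u ∈ A, sg (b' u) :=
        sum_congr rfl fun u hu => by rw [hb u (by simpa using hu)]
      simp only [this]
    have hlaw : ∀ (G : ℤ → ℝ) y, avg (fun _ => p) (cut A O) (fun z => G (S z)) y
        = avg (redProb p ℓ O fun u => colorSum ℓ y u Oᶜ) A
          (fun b => G (∑ u ∈ A, sg (b u))) (fun _ => false) := fun G y =>
      avg_cut hAO (fun b => G (∑ u ∈ A, sg (b u))) (hign G) y
    have key : ∀ y : Sym2 V → Bool,
        a * (1 / 4 - 1 / 4 * (if FewNbrs s A Oᶜ y then 0 else 1)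
          - (200 ^ 2 * k)⁻¹ * avg (fun _ => p) (cut A O) (fun z => (S z : ℝ) ^ 2) y)
        ≤ avg (fun _ => p) (cut A O) (fun z => if |(S z : ℝ)| ≤ D then 1 else 0) y := by
      intro y
      have hpos : 0 ≤ avg (fun _ => p) (cut A O) (fun z => (S z : ℝ) ^ 2) y :=
        const_le_avg h.isProb fun z => sq_nonneg _
      split_ifs with hy
      · have h1 := hball A (redProb p ℓ O fun u => colorSum ℓ y u Oᶜ) (fun _ => false) D
          (by nlinarith)
          (fun u hu => redProb_mem hp.le hp1 (by linarith) (h.variance_le hOc') hO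
            ((hy.abs_colorSum_le Subset.rfl hu).trans (by linarith))) hD (by linarith)
        rw [hlaw (fun t => (t : ℝ) ^ 2), hlaw (fun t => if |(t : ℝ)| ≤ D then 1 else 0)]
        refine le_trans (le_of_eq ?_) h1
        rw [ha, hk]
        ring
      · have h1 : 0 ≤ avg (fun _ => p) (cut A O) (fun z => if |(S z : ℝ)| ≤ D then 1 else 0) y :=
          avg_indicator_nonneg h.isProb fun z => |(S z : ℝ)| ≤ D
        have h2 : 0 ≤ (200 ^ 2 * k)⁻¹
            * avg (fun _ => p) (cut A O) (fun z => (S z : ℝ) ^ 2) y := by positivity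
        nlinarith
    rw [e1, ← avg_avg_of_subset hsub]
    refine le_trans ?_ (avg_mono h.isProb fun y _ => key y)
    rw [avg_const_mul, avg_sub, avg_sub, avg_const, avg_const_mul, avg_const_mul,
      avg_avg_of_subset hsub]
    have h3 : (200 ^ 2 * k)⁻¹
        * avg (fun _ => p) (away {v}) (fun z => (S z : ℝ) ^ 2) x ≤ 1 / 16 := by
      rw [inv_mul_le_iff₀ (by positivity)]
      refine hsecond.trans ?_
      linarith
    have h4 : a * (1 / 8) ≤ a * (1 / 4 - 1 / 4 * avg (fun _ => p) (away {v})
        (fun y => if FewNbrs s A Oᶜ y then 0 else 1) x - (200 ^ 2 * k)⁻¹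
        * avg (fun _ => p) (away {v}) (fun z => (S z : ℝ) ^ 2) x) :=
      mul_le_mul_of_nonneg_left (by linarith) ha0
    refine le_trans ?_ h4
    rw [ha, div_mul_eq_mul_div, div_le_div_iff₀ (by positivity) hskpos]
    have : 0 ≤ c * D := by positivity
    nlinarith
  -- The degree of `v` is typical with probability at least `1 / 2`.
  have hdeg : ∀ y : Sym2 V → Bool,
      c * D / (16 * s) * (1 - 9 / s ^ 4 * (#(nbr y v) - (s ^ 2 - p)) ^ 2)
        ≤ avg (fun _ => p) (away {v}) (fun y => if |(nextSum ℓ y v : ℝ)| ≤ D then 1 else 0) y := by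
    intro y
    have hcD : 0 ≤ c * D / (16 * s) := by positivity
    have hn : 0 ≤ 9 / s ^ 4 * (#(nbr y v) - (s ^ 2 - p)) ^ 2 := by positivity
    by_cases e : |(#(nbr y v) : ℝ) - (s ^ 2 - p)| ≤ s ^ 2 / 3
    · have e' := abs_le.1 e
      refine le_trans ?_ (main y (by nlinarith [e'.1]) (by linarith [e'.2]))
      nlinarith
    · have h1 : 1 ≤ 9 / s ^ 4 * (#(nbr y v) - (s ^ 2 - p)) ^ 2 := by
        rw [div_mul_eq_mul_div, le_div_iff₀ (by positivity), ← sq_abs]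
        have h1 := pow_le_pow_left₀ (by positivity) (not_le.1 e).le 2
        nlinarith
      have h2 : 0 ≤ avg (fun _ => p) (away {v})
          (fun y => if |(nextSum ℓ y v : ℝ)| ≤ D then 1 else 0) y :=
        avg_indicator_nonneg h.isProb fun z => |(nextSum ℓ z v : ℝ)| ≤ D
      nlinarith
  rw [← avg_avg_of_subset (subset_univ (away {v}))]
  refine le_trans ?_ (avg_mono h.isProb fun y _ => hdeg y)
  rw [avg_const_mul, avg_sub, avg_const, avg_const_mul]
  have h1 := avg_sq_card_nbr_sub_le h v x
  have h2 : 9 / s ^ 4 * avg (fun _ => p) univ (fun y => (#(nbr y v) - (s ^ 2 - p)) ^ 2) x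
      ≤ 1 / 2 := by
    calc _ ≤ 9 / s ^ 4 * s ^ 2 := mul_le_mul_of_nonneg_left h1 (by positivity)
      _ = 9 / s ^ 2 := by field_simp
      _ ≤ 1 / 2 := by rw [div_le_iff₀ (by positivity)]; nlinarith
  have hcD : 0 ≤ c * D / (16 * s) := by positivity
  have h3 : c / 32 * D / s = c * D / (16 * s) * (1 / 2) := by field_simp; ring
  rw [h3]
  exact mul_le_mul_of_nonneg_left (by linarith) hcD

end NextSumSmallBall

/-! ### Symmetry and monotonicity of majority dynamics -/

section Symmetry

variable {V : Type} [Fintype V] [DecidableEq V] {ℓ ℓ' : Coloring V} {x y : Sym2 V → Bool}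
  {p s L : ℝ}

lemma nextSum_eq_sum (ℓ : Coloring V) (y : Sym2 V → Bool) (v : V) :
    nextSum ℓ y v = ∑ u, if u ∈ nbr y v then sg (redNext ℓ y u) else 0 := by
  simp [nextSum]

lemma redNext_neg (ℓ : Coloring V) (y : Sym2 V → Bool) (u : V) :
    redNext (-ℓ) y u = !redNext ℓ y u := by
  have h1 : colorSum (-ℓ) y u univ = -colorSum ℓ y u univ := by
    simp [colorSum, ← sum_neg_distrib]
  have h2 : redThreshold (-ℓ) u = 1 - redThreshold ℓ u := by
    rcases Int.units_eq_one_or (ℓ u) with h | h <;> simp [redThreshold, h]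
  rw [redNext, redNext, h1, h2, ← decide_not, decide_eq_decide]
  omega

/-- Exchanging the two colors exchanges the two colors on every later day. -/
lemma nextSum_neg (ℓ : Coloring V) (y : Sym2 V → Bool) (v : V) :
    nextSum (-ℓ) y v = -nextSum ℓ y v := by
  rw [nextSum, nextSum, ← sum_neg_distrib]
  refine sum_congr rfl fun u _ => ?_
  rw [redNext_neg]
  cases redNext ℓ y u <;> rfl

/-- Majority dynamics is monotone in the initial coloring. -/
lemma nextSum_mono (h : ∀ u, (ℓ u : ℤ) ≤ ℓ' u) (y : Sym2 V → Bool) (v : V) :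
    nextSum ℓ y v ≤ nextSum ℓ' y v := by
  refine sum_le_sum fun u _ => ?_
  have h1 : colorSum ℓ y u univ ≤ colorSum ℓ' y u univ :=
    sum_le_sum fun w _ => by split_ifs; exacts [h w, le_rfl]
  have h2 : redThreshold ℓ' u ≤ redThreshold ℓ u := by
    have hu := h u
    unfold redThreshold
    rcases Int.units_eq_one_or (ℓ u) with h3 | h3 <;>
      rcases Int.units_eq_one_or (ℓ' u) with h4 | h4 <;> simp_all
  by_cases h3 : redThreshold ℓ u ≤ colorSum ℓ y u univ
  · have h4 : redThreshold ℓ' u ≤ colorSum ℓ' y u univ := h2.trans (h3.trans h1)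
    simp [redNext, h3, h4]
  · rw [redNext, decide_eq_false h3]
    cases redNext ℓ' y u <;> decide

lemma mem_nbr_relabel (σ : Equiv.Perm V) (y : Sym2 V → Bool) (u v : V) :
    u ∈ nbr (fun e => y (Sym2.map σ e)) v ↔ σ u ∈ nbr y (σ v) := by
  simp [mem_nbr, Sym2.map_mk]

/-- Relabelling the vertices of both the graph and the initial coloring. -/
lemma nextSum_relabel (σ : Equiv.Perm V) (ℓ : Coloring V) (y : Sym2 V → Bool) (v : V) :
    nextSum (ℓ ∘ σ) (fun e => y (Sym2.map σ e)) v = nextSum ℓ y (σ v) := by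
  have hc : ∀ u, colorSum (ℓ ∘ σ) (fun e => y (Sym2.map σ e)) u univ
      = colorSum ℓ y (σ u) univ := fun u => by
    rw [colorSum, colorSum, ← Equiv.sum_comp σ fun w => if w ∈ nbr y (σ u) then (ℓ w : ℤ) else 0]
    exact sum_congr rfl fun w _ => by simp only [mem_nbr_relabel, Function.comp]
  rw [nextSum_eq_sum, nextSum_eq_sum,
    ← Equiv.sum_comp σ fun u => if u ∈ nbr y (σ v) then sg (redNext ℓ y u) else 0]
  refine sum_congr rfl fun u _ => ?_
  have hr : redNext (ℓ ∘ σ) (fun e => y (Sym2.map σ e)) u = redNext ℓ y (σ u) := by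
    rw [redNext, redNext, hc]; rfl
  simp only [mem_nbr_relabel, hr]

/-- The law of the random graph does not depend on the labels of the vertices. -/
lemma avg_relabel (σ : Equiv.Perm V) (f : (Sym2 V → Bool) → ℝ) (x : Sym2 V → Bool) :
    avg (fun _ => p) univ (fun y => f (fun e => y (Sym2.map σ e))) x
      = avg (fun _ => p) univ f x := by
  have hf : Ignores f (univ : Finset (Sym2 V))ᶜ := fun a b hab => by
    rw [funext fun i => hab i (by simp)]
  have h := avg_image (T := univ) (S := univ) (f := f) (φ := Sym2.map σ)
    (Sym2.map.injective σ.injective).injOn (fun _ => p) hf Subset.rfl x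
    (fun i => x (Sym2.map σ i)) fun _ _ => rfl
  have himg : (univ : Finset (Sym2 V)).image (Sym2.map σ) = univ := by
    refine eq_univ_of_forall fun e => mem_image.2 ⟨Sym2.map σ.symm e, mem_univ _, ?_⟩
    rw [Sym2.map_map]
    simp
  rw [himg] at h
  rw [h]
  exact ignores_avg _ univ f _ _ (by simp)

/-- Some relabelling of the vertices makes every Blue vertex Red. -/
lemma exists_perm_blue_to_red (hR : (red ℓ).ncard = ⌈(Fintype.card V : ℝ) / 2⌉₊) :
    ∃ σ : Equiv.Perm V, ∀ v, ℓ v = -1 → ℓ (σ v) = 1 := by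
  set Rd : Finset V := {u | ℓ u = 1} with hRd
  set Bl : Finset V := {u | ℓ u = -1} with hBl
  have hcard : #Rd = ⌈(Fintype.card V : ℝ) / 2⌉₊ := by
    rw [← hR, ← Set.ncard_coe_finset]
    congr 1
    ext u
    simp [hRd, red]
  have hRB : Rdᶜ = Bl := by
    ext u
    rcases Int.units_eq_one_or (ℓ u) with h | h <;> simp [hRd, hBl, h]
  have hle : #Bl ≤ #Rd := by
    have h1 : (Fintype.card V : ℝ) / 2 ≤ #Rd := by rw [hcard]; exact Nat.le_ceil _
    have h2 : #Rd + #Bl = Fintype.card V := by rw [← hRB, card_add_card_compl]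
    have h3 : (#Rd : ℝ) + #Bl = Fintype.card V := by exact_mod_cast h2
    have h4 : (#Bl : ℝ) ≤ #Rd := by linarith
    exact_mod_cast h4
  obtain ⟨T, hT, hTcard⟩ := exists_subset_card_eq hle
  have e : {u // u ∈ Bl} ≃ {u // u ∈ T} := Fintype.equivOfCardEq (by simp [hTcard])
  refine ⟨e.extendSubtype, fun v hv => ?_⟩
  have hvB : v ∈ Bl := by simp [hBl, hv]
  have h1 := hT (e.extendSubtype_mem v hvB)
  simpa [hRd] using h1

/-- Averaged over the vertices `v`, the neighbourhood of `v` on day `1` is at least as likely to have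
a large sum as it is to have a small one: exchanging the colors and relabelling the vertices turns
`ℓ` into a coloring with fewer Red vertices. -/
lemma sum_avg_lt_neg_le (hp : IsProb (fun _ : Sym2 V => p))
    (hR : (red ℓ).ncard = ⌈(Fintype.card V : ℝ) / 2⌉₊) (k : ℤ) (x : Sym2 V → Bool) :
    ∑ v, avg (fun _ => p) univ (fun y => if nextSum ℓ y v < -k then 1 else 0) x
      ≤ ∑ v, avg (fun _ => p) univ (fun y => if k < nextSum ℓ y v then 1 else 0) x := by
  obtain ⟨σ, hσ⟩ := exists_perm_blue_to_red hR
  have hle : ∀ u, ((-(ℓ ∘ σ)) u : ℤ) ≤ ℓ u := by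
    intro u
    rcases Int.units_eq_one_or (ℓ u) with h | h
    · rcases Int.units_eq_one_or (ℓ (σ u)) with h' | h' <;> simp [h, h']
    · simp [h, hσ u h]
  rw [← Equiv.sum_comp σ]
  refine sum_le_sum fun v _ => ?_
  calc avg (fun _ => p) univ (fun y => if nextSum ℓ y (σ v) < -k then 1 else 0) x
      = avg (fun _ => p) univ (fun y => if nextSum (ℓ ∘ σ) y v < -k then 1 else 0) x := by
        rw [← avg_relabel σ (fun y => if nextSum (ℓ ∘ σ) y v < -k then 1 else 0)]
        simp only [nextSum_relabel]
    _ ≤ _ := avg_mono hp fun y _ => by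
        have h1 := nextSum_mono hle y v
        rw [nextSum_neg] at h1
        by_cases h2 : nextSum (ℓ ∘ σ) y v < -k
        · rw [if_pos h2, if_pos (by omega)]
        · rw [if_neg h2]
          split_ifs <;> norm_num

/-- The event `-k ≤ S` is the disjoint union of `|S| ≤ k` and `k < S`, and its complement is
`S < -k`, which is no likelier than `k < S` on average. -/
lemma card_add_le_two_mul_sum_avg_sumGe (hp : IsProb (fun _ : Sym2 V => p))
    (hR : (red ℓ).ncard = ⌈(Fintype.card V : ℝ) / 2⌉₊) {k : ℤ} (hk : 0 ≤ k) (x : Sym2 V → Bool) :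
    (Fintype.card V : ℝ)
        + ∑ v, avg (fun _ => p) univ (fun y => if |nextSum ℓ y v| ≤ k then 1 else 0) x
      ≤ 2 * ∑ v, avg (fun _ => p) univ (sumGe ℓ (-k) v) x := by
  have h1 : ∀ v, avg (fun _ => p) univ (sumGe ℓ (-k) v) x
      = avg (fun _ => p) univ (fun y => if |nextSum ℓ y v| ≤ k then 1 else 0) x
        + avg (fun _ => p) univ (fun y => if k < nextSum ℓ y v then 1 else 0) x := fun v => by
    rw [← avg_add]
    refine avg_congr fun y _ => ?_
    simp only [sumGe, abs_le]
    split_ifs <;> first | omega | norm_num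
  have h2 : ∀ v, avg (fun _ => p) univ (sumGe ℓ (-k) v) x
      + avg (fun _ => p) univ (fun y => if nextSum ℓ y v < -k then 1 else 0) x = 1 := fun v => by
    rw [← avg_add, ← avg_const (q := fun _ : Sym2 V => p) (S := univ) (x := x) 1]
    refine avg_congr fun y _ => ?_
    simp only [sumGe]
    split_ifs <;> first | omega | norm_num
  have h3 := sum_avg_lt_neg_le hp hR k x
  have h4 := sum_congr (s₁ := univ) rfl fun v _ => h1 v
  have h5 := sum_congr (s₁ := univ) rfl fun v _ => h2 v
  rw [sum_add_distrib] at h4 h5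
  simp only [sum_const, card_univ, nsmul_eq_mul, mul_one] at h5
  linarith

end Symmetry

/-! ### Chebyshev's inequality -/

section SecondMoment

variable {ι : Type*} [Fintype ι] [DecidableEq ι] {q : ι → ℝ} {S : Finset ι}
  {f g : (ι → Bool) → ℝ} {x : ι → Bool}

lemma covar_sum_self {κ : Type*} (s : Finset κ) (F : κ → (ι → Bool) → ℝ) :
    covar q S (fun y => ∑ v ∈ s, F v y) (fun y => ∑ v ∈ s, F v y) x
      = ∑ v ∈ s, ∑ w ∈ s, covar q S (F v) (F w) x := by
  simp only [covar, sum_mul_sum, sum_sub_distrib]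
  rw [avg_sum, avg_sum, sum_mul_sum]
  simp only [avg_sum]

open Classical in
/-- Chebyshev's inequality. -/
lemma avg_lt_le (hq : IsProb q) {m t : ℝ} (ht : 0 < t) (hm : m + t ≤ avg q S f x) :
    avg q S (fun y => if f y < m then 1 else 0) x ≤ covar q S f f x / t ^ 2 := by
  rw [le_div_iff₀ (by positivity), covar_eq (avg q S f x) (avg q S f x), mul_comm, ← avg_const_mul]
  simp only [sub_self, mul_zero, sub_zero]
  refine avg_mono hq fun y _ => ?_
  split_ifs with h
  · nlinarith
  · nlinarith [mul_self_nonneg (f y - avg q S f x)]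

end SecondMoment

/-! ### The number of vertices with a day `1` sum of at least `-D` -/

section Count

open Classical in
/-- With high probability, the day `1` sums of noticeably more than half of the vertices are at least
`-D`. -/
lemma exists_avg_count_lt_le :
    ∃ s₀ : ℝ, ∀ B : ℝ, 0 < B → ∃ a > 0, ∀ {V : Type} [Fintype V] [DecidableEq V] (ℓ : Coloring V)
      (p s L D : ℝ) (x : Sym2 V → Bool), Regime V p s L → s₀ ≤ s →
      (red ℓ).ncard = ⌈(Fintype.card V : ℝ) / 2⌉₊ → 2 ≤ D → D ≤ B * s →
      avg (fun _ => p) univ (fun y => if ∑ v, sumGe ℓ (-⌊D⌋) v y <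
          (Fintype.card V : ℝ) / 2 + a * (Fintype.card V * D / s) then 1 else 0) x
        ≤ 150001 * L / (a * D) ^ 2 := by
  obtain ⟨c, hc, s₀, hball⟩ := exists_nextSum_small_ball
  refine ⟨s₀, fun B hB => ?_⟩
  set b : ℝ := min 1 (1 / (2 * B)) with hb
  have hb0 : 0 < b := lt_min one_pos (by positivity)
  refine ⟨c / 4 * b, by positivity, ?_⟩
  intro V _ _ ℓ p s L D x h hs₀ hR hD hDB
  have hs := h.s_ge
  have hL := h.one_le
  set n : ℝ := (Fintype.card V : ℝ) with hn
  have hn0 : 0 < n := by have := h.sq_le_card; nlinarith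
  have hsn : s ^ 2 ≤ n * L := by have := h.sq_le_card; nlinarith
  -- The small ball estimate needs a radius of at most `s / 2`; this costs the factor `b`.
  set D' : ℝ := min D (s / 2) with hD'
  have hD'2 : 2 ≤ D' := le_min hD (by linarith)
  have hbD : b * D ≤ D' := by
    refine le_min (by have := min_le_left 1 (1 / (2 * B)); nlinarith) ?_
    calc b * D ≤ 1 / (2 * B) * (B * s) :=
          mul_le_mul (min_le_right _ _) hDB (by linarith) (by positivity)
      _ = s / 2 := by field_simp
  have hmean : n / 2 + c / 4 * b * (n * D / s) + c / 4 * b * (n * D / s)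
      ≤ avg (fun _ => p) univ (fun y => ∑ v, sumGe ℓ (-⌊D⌋) v y) x := by
    have h1 := card_add_le_two_mul_sum_avg_sumGe h.isProb hR
      (k := ⌊D⌋) (Int.floor_nonneg.2 (by linarith)) x
    have h2 : n * (c * D' / s)
        ≤ ∑ v, avg (fun _ => p) univ (fun y => if |nextSum ℓ y v| ≤ ⌊D⌋ then 1 else 0) x := by
      rw [hn, ← card_univ, ← nsmul_eq_mul, ← sum_const]
      refine sum_le_sum fun v _ => ?_
      refine (hball ℓ p s L D' v x h hs₀ hR hD'2 (min_le_right _ _)).trans ?_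
      refine avg_mono h.isProb fun y _ => ?_
      split_ifs with h3 h4 h4
      · exact le_rfl
      · refine absurd (Int.le_floor.2 ?_) h4
        push_cast
        exact h3.trans (min_le_left _ _)
      · norm_num
      · exact le_rfl
    have h3 : n * (c * (b * D) / s) ≤ n * (c * D' / s) := by gcongr
    have h4 : n * (c * (b * D) / s) = 4 * (c / 4 * b * (n * D / s)) := by ring
    rw [avg_sum]
    linarith
  have ht : 0 < c / 4 * b * (n * D / s) := by positivity
  refine (avg_lt_le h.isProb ht hmean).trans ?_
  have hvar : covar (fun _ => p) univ (fun y => ∑ v, sumGe ℓ (-⌊D⌋) v y)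
      (fun y => ∑ v, sumGe ℓ (-⌊D⌋) v y) x ≤ 150001 * (n ^ 2 * L / s ^ 2) := by
    rw [covar_sum_self]
    calc ∑ v : V, ∑ w, covar (fun _ => p) univ (sumGe ℓ (-⌊D⌋) v) (sumGe ℓ (-⌊D⌋) w) x
        ≤ ∑ v : V, ∑ w, (150000 * L / s ^ 2 + if v = w then 1 else 0) := by
          refine sum_le_sum fun v _ => sum_le_sum fun w _ => ?_
          split_ifs with hvw
          · have : 0 ≤ 150000 * L / s ^ 2 := by positivity
            linarith [covar_le_one (S := univ) (x := x) (h.isProb (κ := Sym2 V))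
              (sumGe_mem (ℓ := ℓ) (-⌊D⌋) v) (sumGe_mem (ℓ := ℓ) (-⌊D⌋) w)]
          · rw [add_zero]
            exact covar_sumGe_le h hvw hR _ x
      _ = 150000 * (n ^ 2 * L / s ^ 2) + n := by
          simp only [sum_add_distrib, sum_const, card_univ, nsmul_eq_mul, sum_ite_eq, mem_univ,
            if_true, ← hn]
          ring
      _ ≤ 150001 * (n ^ 2 * L / s ^ 2) := by
          have : n ≤ n ^ 2 * L / s ^ 2 := by
            rw [le_div_iff₀ (by positivity)]
            nlinarith
          linarith
  calc _ / (c / 4 * b * (n * D / s)) ^ 2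
      ≤ 150001 * (n ^ 2 * L / s ^ 2) / (c / 4 * b * (n * D / s)) ^ 2 := by gcongr
    _ = 150001 * L / (c / 4 * b * D) ^ 2 := by field_simp

end Count

/-! ### The binomial random graph -/

section RandomGraph

open MeasureTheory

variable {V : Type} [Fintype V] [DecidableEq V]

/-- The graph whose edges are the `true` bits of `y`. -/
def bitGraph (y : Sym2 V → Bool) : SimpleGraph V := SimpleGraph.fromEdgeSet {e | y e = true}

lemma bitGraph_adj {y : Sym2 V → Bool} {u v : V} :
    (bitGraph y).Adj u v ↔ v ∈ nbr y u := by
  rw [bitGraph, SimpleGraph.fromEdgeSet_adj, mem_nbr, ne_comm]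
  exact and_comm

lemma neighborSum_bitGraph (ℓ : Coloring V) (y : Sym2 V → Bool) (v : V) :
    neighborSum (bitGraph y) ℓ v = ∑ u ∈ nbr y v, (ℓ u : ℤ) := by
  rw [neighborSum]
  refine sum_congr ?_ fun _ _ => rfl
  ext u
  rw [SimpleGraph.mem_neighborFinset, bitGraph_adj]

lemma nextDay_bitGraph (ℓ : Coloring V) (y : Sym2 V → Bool) (v : V) :
    (nextDay (bitGraph y) ℓ v : ℤ) = sg (redNext ℓ y v) := by
  have h : colorSum ℓ y v univ = neighborSum (bitGraph y) ℓ v := by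
    simp [neighborSum_bitGraph, colorSum]
  rw [redNext, h, nextDay, redThreshold]
  rcases Int.units_eq_one_or (ℓ v) with h' | h'
  · by_cases h1 : 0 ≤ neighborSum (bitGraph y) ℓ v
    · simp [h', h1, h1.not_gt]
    · simp [h', h1, not_le.1 h1, (not_le.1 h1).not_gt]
  · have h2 : (-1 : ℤˣ) ≠ 1 := by decide
    by_cases h1 : 1 ≤ neighborSum (bitGraph y) ℓ v
    · have h3 : 0 < neighborSum (bitGraph y) ℓ v := by omega
      simp [h', h1, h2, h3]
    · have h3 : ¬0 < neighborSum (bitGraph y) ℓ v := by omega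
      simp [h', h1, h2, h3]

/-- The neighbour sums are integers, so the real threshold `-D` may be replaced by `-⌊D⌋`. -/
lemma numAlmostRed_bitGraph (ℓ : Coloring V) (y : Sym2 V → Bool) (D : ℝ) :
    (numAlmostRed (bitGraph y) ℓ D : ℝ) = ∑ v, sumGe ℓ (-⌊D⌋) v y := by
  have h : {v | IsAlmostRed (bitGraph y) ℓ D v}
      = ({v | -⌊D⌋ ≤ nextSum ℓ y v} : Finset V) := by
    ext v
    have h1 : neighborSum (bitGraph y) (day (bitGraph y) ℓ 1) v = nextSum ℓ y v := by
      rw [neighborSum_bitGraph, nextSum]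
      exact sum_congr rfl fun u _ => nextDay_bitGraph ℓ y u
    simp only [Set.mem_ofPred_eq, IsAlmostRed, h1, coe_filter, mem_univ, true_and]
    rw [neg_le, neg_le (a := ⌊D⌋), Int.le_floor]
    push_cast
    rfl
  rw [numAlmostRed, h, Set.ncard_coe_finset, card_filter]
  push_cast
  rfl

/-- The graph whose edges are independent random bits is a binomial random graph. -/
lemma binomialRandom_real_eq_avg (p : unitInterval) (E : Set (SimpleGraph V))
    [DecidablePred (· ∈ E)] (x : Sym2 V → Bool) :
    (SimpleGraph.binomialRandom V p).real E
      = avg (fun _ => (p : ℝ)) univ (fun y => if bitGraph y ∈ E then 1 else 0) x := by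
  classical
  set P : Finset (Sym2 V) := {e | ¬e.IsDiag} with hP
  have hig : Ignores (fun y : Sym2 V → Bool => if bitGraph y ∈ E then (1 : ℝ) else 0)
      (univ \ P) := by
    intro y z hyz
    have : bitGraph y = bitGraph z := by
      ext u v
      rw [bitGraph_adj, bitGraph_adj, mem_nbr, mem_nbr]
      refine and_congr_right fun h => ?_
      rw [hyz]
      simpa [hP] using h.symm
    simp only [this]
  -- Drop the bits on the diagonal, then match the weight of each set of edges.
  rw [avg_of_subset_of_ignores (subset_univ P) hig, avg_eq_sum_powerset]
  have hPcard : (Nat.card V).choose 2 = #P := by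
    rw [Nat.card_eq_fintype_card, ← Sym2.card_diagSet_compl, ← Set.toFinset_card]
    congr 1
    ext e
    simp [hP]
  have hE : (SimpleGraph.binomialRandom V p).real E
      = ∑ G : SimpleGraph V, (SimpleGraph.binomialRandom V p).real {G} * if G ∈ E then 1 else 0 := by
    have : MeasurableSingletonClass (SimpleGraph V) :=
      ⟨fun G => by
        have h : ({G} : Set (SimpleGraph V)) = SimpleGraph.edgeSet ⁻¹' {G.edgeSet} := by
          ext G'
          exact SimpleGraph.edgeSet_inj.symm
        rw [h]
        exact SimpleGraph.measurable_edgeSet (Set.toFinite _).measurableSet⟩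
    simp only [mul_ite, mul_one, mul_zero]
    rw [← sum_filter, sum_measureReal_singleton]
    simp
  rw [hE]
  refine sum_nbij' (fun G => G.edgeSet.toFinset)
    (fun T => SimpleGraph.fromEdgeSet (T : Set (Sym2 V))) ?_ ?_ ?_ ?_ ?_
  · intro G _
    rw [mem_powerset]
    intro e he
    have he : e ∈ G.edgeSet := by simpa using he
    simpa [hP] using G.not_isDiag_of_mem_edgeSet he
  · intro T _
    exact mem_univ _
  · intro G _
    simp
  · intro T hT
    rw [mem_powerset] at hT
    ext e
    have : e ∈ T → ¬e.IsDiag := fun h => by simpa [hP] using hT h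
    simpa [SimpleGraph.edgeSet_fromEdgeSet] using this
  · intro G _
    have hsub : G.edgeSet.toFinset ⊆ P := by
      intro e he
      have he : e ∈ G.edgeSet := by simpa using he
      simpa [hP] using G.not_isDiag_of_mem_edgeSet he
    have hG : bitGraph (P.piecewise (fun i => decide (i ∈ G.edgeSet.toFinset)) x) = G := by
      ext u v
      rw [bitGraph, SimpleGraph.fromEdgeSet_adj]
      constructor
      · rintro ⟨h1, h2⟩
        have : s(u, v) ∈ P := by simpa [hP] using h2
        simpa [this] using h1
      · intro h
        have : s(u, v) ∈ P := by simpa [hP] using h.ne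
        exact ⟨by simpa [this] using h, h.ne⟩
    rw [hG, prod_const, prod_const, card_sdiff_of_subset hsub, ← hPcard]
    congr 1
    rw [measureReal_def, SimpleGraph.binomialRandom_singleton, Set.ncard_eq_toFinset_card']
    simp [unitInterval.toNNReal]
    rfl

end RandomGraph

/-! ### The hypotheses on `n` and `p` -/

section Parameters

/-- For `n ≤ 1` the conventions `log 0 = log 1 = 0` make the upper bound on `p` equal to `0`, so that
`D ≤ 0`. -/
lemma two_le_of_sparse {n : ℕ} {p D B : ℝ}
    (hp : p ≤ (n : ℝ) ^ (-(1 / 2) : ℝ) * Real.log n ^ ((1 / 4) : ℝ)) (hD : 0 < D)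
    (hDB : D ≤ B * √(p * n)) : 0 < p ∧ 2 ≤ n := by
  have hpn : 0 < p * n := by
    by_contra h
    rw [Real.sqrt_eq_zero_of_nonpos (not_lt.1 h), mul_zero] at hDB
    linarith
  have hn0 : 0 < n := Nat.pos_of_ne_zero fun h => by simp [h] at hpn
  have hp0 : 0 < p := pos_of_mul_pos_left hpn (by positivity)
  refine ⟨hp0, ?_⟩
  by_contra h
  obtain rfl : n = 1 := by omega
  rw [Nat.cast_one, Real.log_one, Real.zero_rpow (by norm_num)] at hp
  linarith

/-- The hypotheses of the theorem give the `Regime` bounds, and any lower bound on `√(p n)` that the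
constant in front of `log² n` is made to provide. -/
lemma Regime.of_sparse {n : ℕ} {p C : ℝ} (hC : 10 ^ 6 ≤ C) (hp0 : 0 < p) (hp1 : p ≤ 1)
    (hn : 2 ≤ n) (hp : p ≤ (n : ℝ) ^ (-(1 / 2) : ℝ) * Real.log n ^ ((1 / 4) : ℝ))
    (hpn : C * Real.log n ^ 2 ≤ p * n) :
    Regime (Fin n) p (√(p * n)) (Real.log n) ∧ √(C - 10 ^ 6) ≤ √(p * n) := by
  have hn' : (2 : ℝ) ≤ n := by exact_mod_cast hn
  have hL0 : 1 / 2 ≤ Real.log n :=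
    (by linarith [Real.log_two_gt_d9] : 1 / 2 ≤ Real.log 2).trans
      (Real.log_le_log (by norm_num) hn')
  have hL1 : 1 ≤ Real.log n := by
    have h3 : (3 : ℝ) ≤ n := by nlinarith
    rw [Real.le_log_iff_exp_le (by linarith)]
    linarith [Real.exp_one_lt_d9]
  set L := Real.log n with hL
  have hs : √(p * n) ^ 2 = p * n := Real.sq_sqrt (by positivity)
  have hLpn : 10 ^ 6 * L ^ 2 ≤ p * n := le_trans (by gcongr) hpn
  have hq : ((n : ℝ) ^ (-(1 / 2) : ℝ)) ^ 2 * n = 1 := by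
    rw [← Real.rpow_natCast, ← Real.rpow_mul (by positivity), ← Real.rpow_add_one (by positivity)]
    norm_num
  have hr : (L ^ ((1 / 4) : ℝ)) ^ 4 = L := by
    rw [← Real.rpow_natCast, ← Real.rpow_mul (by positivity)]
    norm_num
  set q := (n : ℝ) ^ (-(1 / 2) : ℝ)
  set r := L ^ ((1 / 4) : ℝ)
  have h1 : p ^ 2 * n ≤ r ^ 2 := by
    calc p ^ 2 * n ≤ (q * r) ^ 2 * n := by gcongr
      _ = (q ^ 2 * n) * r ^ 2 := by ring
      _ = r ^ 2 := by rw [hq, one_mul]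
  have h2 : r ^ 2 ≤ L := by
    refine le_of_sq_le_sq ?_ (by linarith)
    nlinarith
  refine ⟨⟨hp0, ?_, ?_, hL1, ?_, ?_, ?_⟩, ?_⟩
  · have h3 : p * (10 ^ 6 * L ^ 2) ≤ p * (p * n) := by gcongr
    nlinarith
  · rw [hs, Fintype.card_fin]
  · refine Real.le_sqrt_of_sq_le ?_
    linarith
  · rw [hs]
    calc (p * (p * n)) ^ 2 = (p ^ 2 * n) ^ 2 := by ring
      _ ≤ (r ^ 2) ^ 2 := by gcongr
      _ = L := by rw [← hr]; ring
  · rw [Fintype.card_fin, hL, Real.exp_log (by positivity)]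
  · refine Real.sqrt_le_sqrt ?_
    have h3 : C * 1 ≤ C * L ^ 2 := by
      gcongr
      exact one_le_pow₀ hL1
    linarith

end Parameters

end MajorityDynamics

theorem lemma2p2 :
    ∃ C₁ C₂ A : ℝ, 0 < C₁ ∧ 0 < C₂ ∧ 0 < A ∧
      ∀ B : ℝ, 0 < B → ∃ c : ℝ, 0 < c ∧
        ∀ (n : ℕ) (p : unitInterval) (ℓ₀ : MajorityDynamics.Coloring (Fin n)) (D : ℝ),
          (p : ℝ) ≤ (n : ℝ) ^ (-(1 / 2) : ℝ) * Real.log n ^ ((1 / 4) : ℝ) →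
          (MajorityDynamics.red ℓ₀).ncard = ⌈(n : ℝ) / 2⌉₊ →
          C₁ * Real.log n ^ 2 ≤ (p : ℝ) * n →
          0 < D →
          C₂ * Real.log n ≤ D →
          D ≤ B * √((p : ℝ) * n) →
          1 - A * (Real.log n ^ 2 / (c ^ 2 * D ^ 2)) ≤
            (SimpleGraph.binomialRandom (Fin n) p).real
              {G | (n : ℝ) / 2 + c * D * √((n : ℝ) / (p : ℝ)) ≤
                (MajorityDynamics.numAlmostRed G ℓ₀ D : ℝ)} := by
  classical
  obtain ⟨s₀, hs₀⟩ := MajorityDynamics.exists_avg_count_lt_le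
  refine ⟨10 ^ 6 + s₀ ^ 2, 2, 1, by positivity, by norm_num, by norm_num, fun B hB => ?_⟩
  obtain ⟨a, ha0, hcount⟩ := hs₀ B hB
  -- As `400 ^ 2 ≥ 150001`, shrinking the gain over `n / 2` by the factor `400` absorbs the constant
  -- in the Chebyshev bound, and `A = 1` suffices.
  refine ⟨a / 400, by positivity, ?_⟩
  intro n p ℓ₀ D hp hR hpn hD0 hD hDB
  obtain ⟨hp0, hn⟩ := MajorityDynamics.two_le_of_sparse hp hD0 hDB
  obtain ⟨h, hs⟩ := MajorityDynamics.Regime.of_sparse (by nlinarith [sq_nonneg s₀]) hp0 p.2.2 hn hp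
    hpn
  rw [add_sub_cancel_left, Real.sqrt_sq_eq_abs] at hs
  have hL1 := h.one_le
  have hs1 := h.s_ge
  have hroot : √((n : ℝ) / p) = n / √((p : ℝ) * n) := by
    rw [← Real.sqrt_sq (Nat.cast_nonneg (α := ℝ) n), ← Real.sqrt_div (by positivity),
      Real.sqrt_sq (Nat.cast_nonneg n)]
    congr 1
    have : (0 : ℝ) < n := by exact_mod_cast (by omega : 0 < n)
    field_simp
  set L := Real.log n
  set s := √((p : ℝ) * n)
  have hbound := hcount ℓ₀ p s L D (fun _ => false) h ((le_abs_self _).trans hs)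
    (by rwa [Fintype.card_fin]) (by linarith) hDB
  rw [MajorityDynamics.binomialRandom_real_eq_avg p _ fun _ => false]
  calc 1 - 1 * (L ^ 2 / ((a / 400) ^ 2 * D ^ 2))
      ≤ 1 - 150001 * L / (a * D) ^ 2 := by
        have : 150001 * L / (a * D) ^ 2 ≤ 160000 * L ^ 2 / (a * D) ^ 2 := by
          gcongr ?_ / _
          nlinarith
        have h2 : L ^ 2 / ((a / 400) ^ 2 * D ^ 2) = 160000 * L ^ 2 / (a * D) ^ 2 := by
          field_simp
          norm_num
        rw [h2]
        linarith
    _ ≤ _ := sub_le_sub_left hbound 1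
    _ ≤ _ := by
        refine (sub_le_iff_le_add.2 ?_)
        rw [← MajorityDynamics.avg_add]
        refine MajorityDynamics.const_le_avg h.isProb fun y => ?_
        by_cases hy : ∑ v, MajorityDynamics.sumGe ℓ₀ (-⌊D⌋) v y
            < (Fintype.card (Fin n) : ℝ) / 2 + a * (Fintype.card (Fin n) * D / s)
        · rw [if_pos hy]
          split_ifs <;> norm_num
        · rw [if_neg hy, if_pos, add_zero]
          rw [Set.mem_ofPred_eq, MajorityDynamics.numAlmostRed_bitGraph, hroot]
          refine le_trans ?_ (not_lt.1 hy)
          rw [Fintype.card_fin]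
          have h3 : 0 ≤ a * (n * D / s) := by positivity
          have h4 : a / 400 * D * (n / s) = a * (n * D / s) / 400 := by ring
          linarith
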